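/- Let $\mathsf Q=\overline U_{\mathrm i}\,s\ell(2)$ be the restricted quantum group at $\mathfrak q=\mathrm i$: the complex Hopf algebra generated by $E,F,K^{\pm1}$ with relations $$KE=-EK,\quad KF=-FK,\quad [E,F]=\frac{K-K^{-1}}{\mathrm i-\mathrm i^{-1}},\quad E^2=F^2=0,\quad K^4=1,$$ with $\Delta(E)=1\otimes E+E\otimes K$, $\Delta(F)=K^{-1}\otimes F+F\otimes 1$, $\Delta(K)=K\otimes K$, $\epsilon(E)=\epsilon(F)=0$, $\epsilon(K)=1$, $S(E)=-EK^{-1}$, $S(F)=-KF$, $S(K)=K^{-1}$. Let $\beta\in\mathbb C$ with $\beta^4=-1$, put $e_0=\tfrac12(1+K^2)$, $e_1=\tfrac12(1-K^2)$, and let $\Phi\in \mathsf Q^{\otimes 3}$ be $$\begin{aligned}\Phi={}&e_0\otimes e_0\otimes e_0+e_1\otimes e_0\otimes e_0+\Phi^{010}\,e_0\otimes e_1\otimes e_0+e_0\otimes e_0\otimes e_1\\&+e_1\otimes e_1\otimes e_0+\Phi^{101}\,e_1\otimes e_0\otimes e_1+e_0\otimes e_1\otimes e_1+\Phi^{111}\,e_1\otimes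 e_1\otimes e_1,\end{aligned}$$ where $$\Phi^{010}=1\otimes1\otimes1-(1+\mathrm i)E\otimes K\otimes F+(1-\mathrm i)FK\otimes K\otimes EK+2\,EFK\otimes1\otimes EFK,$$ $$\begin{aligned}\Phi^{101}={}&(\mathrm i-1)1\otimes F\otimes EK+1\otimes K\otimes1+2\cdot1\otimes EF\otimes EFK-(1+\mathrm i)1\otimes EK\otimes F\\&-(1+\mathrm i)E\otimes FK\otimes1+2\mathrm i\,E\otimes EFK\otimes F+(1-\mathrm i)FK\otimes E\otimes1\\&-2\mathrm i\,FK\otimes EFK\otimes EK-2\,EFK\otimes EF\otimes1,\end{aligned}$$ $$\begin{aligned}\Phi^{111}={}&\mathrm i\beta^2\{(1+\mathrm i)1\otimes F\otimes EK-1\otimes K\otimes1-2\cdot1\otimes EF\otimes1-2\mathrm i\,1\otimes EF\otimes EFK\\&+(1+\mathrm i)1\otimes EK\otimes F-(1+\mathrm i)E\otimes1\otimes F+(1+\mathrm i)E\otimes FK\otimes1+2\mathrm i\,E\otimes FK\otimes EFK\\&+2\,E\otimes EFK\otimes F-(1+\mathrm i)FK\otimes1\otimes EK+(1+\mathrm i)FK\otimes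 E\otimes1+2\mathrm i\,FK\otimes E\otimes EFK\\&+2\,FK\otimes EFK\otimes EK+2\mathrm i\,EFK\otimes F\otimes EK+2\mathrm i\,EFK\otimes K\otimes EFK-2\mathrm i\,EFK\otimes EF\otimes1\\&+2\mathrm i\,EFK\otimes EK\otimes F+4\,EFK\otimes EF\otimes EFK\}.\end{aligned}$$ A *coassociator* (3-cocycle) on a bialgebra $A$ is an invertible $\Psi\in A^{\otimes3}$ with $(\Delta\otimes\mathrm{id})\Delta(a)\,\Psi=\Psi\,(\mathrm{id}\otimes\Delta)\Delta(a)$ for all $a$, $(\mathrm{id}\otimes\epsilon\otimes\mathrm{id})\Psi=1\otimes1$ and $$(\Delta\otimes\mathrm{id}\otimes\mathrm{id})(\Psi)\,(\mathrm{id}\otimes\mathrm{id}\otimes\Delta)(\Psi)=(\Psi\otimes1)\,(\mathrm{id}\otimes\Delta\otimes\mathrm{id})(\Psi)\,(1\otimes\Psi).$$ Two of them are cohomologous if they differ by $\Psi\mapsto(F\otimes1)(\Delta\otimes\mathrm{id})(F)\,\Psi\,(\mathrm{id}\otimes\Delta)(F)^{-1}(1\otimes F)^{-1}$ for some invertible counital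 $F\in A\otimes A$ commuting with $\Delta(A)$; the set of classes, pointed by the class of $1\otimes1\otimes1$, is the third Hopf algebra cohomology of $A$. $\mathbf{Rep}(A,\Psi)$ is the monoidal category of finite-dimensional $A$-modules, with $A$ acting on tensor products through $\Delta$, on the unit $\mathbb C$ through $\epsilon$, with the unit isomorphisms of vector spaces and the associativity isomorphisms $U\otimes(V\otimes W)\to(U\otimes V)\otimes W$ given by the action of $\Psi$; $\mathbf{Rep}\,A=\mathbf{Rep}(A,1\otimes1\otimes1)$. The *Drinfeld twist* of a Hopf algebra $A$ by an invertible counital $F\in A\otimes A$ is the quasi-bialgebra with the same algebra and counit, coproduct $F\Delta F^{-1}$ and coassociator $(F\otimes1)(\Delta\otimes\mathrm{id})(F)(\mathrm{id}\otimes\Delta)(F)^{-1}(1\otimes F)^{-1}$. **Corollary.** $\Phi$ is a coassociator on $\mathsf Q$, and 1. the class of $\Phi$ in the third Hopf algebra cohomology of $\mathsf Q$ is non-trivial; 2. the quasi-bialgebra $(\mathsf Q,\Phi)$ is not isomorphic to (in particular, not equal to) any Drinfeld twist of the Hopf algebra $\mathsf Q$; 3. the identity functor cannot be endowed with the structure of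 a monoidal functor $\mathbf{Rep}(\mathsf Q,\Phi)\to\mathbf{Rep}\,\mathsf Q$; 4. $\mathbf{Rep}(\mathsf Q,\Phi)$ is not equivalent to $\mathbf{Rep}\,\mathsf Q$ as a monoidal category. -/

import Mathlib

set_option maxSynthPendingDepth 3

open scoped TensorProduct
open CategoryTheory

noncomputable section

namespace QHopf

/-! ### Leg maps on tensor powers of an algebra -/

section Legs

variable {A : Type} [Ring A] [Algebra ℂ A]

/-- `Δ ⊗ id : A ⊗ A → A ⊗ A ⊗ A`. -/
def comulFst (Δ : A →ₐ[ℂ] A ⊗[ℂ] A) : A ⊗[ℂ] A →ₐ[ℂ] A ⊗[ℂ] (A ⊗[ℂ] A) :=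
  (Algebra.TensorProduct.assoc ℂ ℂ ℂ A A A).toAlgHom.comp
    (Algebra.TensorProduct.map Δ (AlgHom.id ℂ A))

/-- `id ⊗ Δ : A ⊗ A → A ⊗ A ⊗ A`. -/
def comulSnd (Δ : A →ₐ[ℂ] A ⊗[ℂ] A) : A ⊗[ℂ] A →ₐ[ℂ] A ⊗[ℂ] (A ⊗[ℂ] A) :=
  Algebra.TensorProduct.map (AlgHom.id ℂ A) Δ

/-- `x ↦ x ⊗ 1` from `A ⊗ A` to `A ⊗ A ⊗ A`. -/
def leg12 : A ⊗[ℂ] A →ₐ[ℂ] A ⊗[ℂ] (A ⊗[ℂ] A) :=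
  Algebra.TensorProduct.map (AlgHom.id ℂ A) Algebra.TensorProduct.includeLeft

/-- `x ↦ 1 ⊗ x` from `A ⊗ A` to `A ⊗ A ⊗ A`. -/
def leg23 : A ⊗[ℂ] A →ₐ[ℂ] A ⊗[ℂ] (A ⊗[ℂ] A) :=
  Algebra.TensorProduct.includeRight

/-- `Δ ⊗ id ⊗ id`. -/
def comul1 (Δ : A →ₐ[ℂ] A ⊗[ℂ] A) :
    A ⊗[ℂ] (A ⊗[ℂ] A) →ₐ[ℂ] A ⊗[ℂ] (A ⊗[ℂ] (A ⊗[ℂ] A)) :=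
  (Algebra.TensorProduct.assoc ℂ ℂ ℂ A A (A ⊗[ℂ] A)).toAlgHom.comp
    (Algebra.TensorProduct.map Δ (AlgHom.id ℂ (A ⊗[ℂ] A)))

/-- `id ⊗ Δ ⊗ id`. -/
def comul2 (Δ : A →ₐ[ℂ] A ⊗[ℂ] A) :
    A ⊗[ℂ] (A ⊗[ℂ] A) →ₐ[ℂ] A ⊗[ℂ] (A ⊗[ℂ] (A ⊗[ℂ] A)) :=
  Algebra.TensorProduct.map (AlgHom.id ℂ A) (comulFst Δ)

/-- `id ⊗ id ⊗ Δ`. -/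
def comul3 (Δ : A →ₐ[ℂ] A ⊗[ℂ] A) :
    A ⊗[ℂ] (A ⊗[ℂ] A) →ₐ[ℂ] A ⊗[ℂ] (A ⊗[ℂ] (A ⊗[ℂ] A)) :=
  Algebra.TensorProduct.map (AlgHom.id ℂ A) (comulSnd Δ)

/-- `x ↦ x ⊗ 1` from `A ⊗ A ⊗ A` to `A ⊗ A ⊗ A ⊗ A`. -/
def leg123 : A ⊗[ℂ] (A ⊗[ℂ] A) →ₐ[ℂ] A ⊗[ℂ] (A ⊗[ℂ] (A ⊗[ℂ] A)) :=
  Algebra.TensorProduct.map (AlgHom.id ℂ A) leg12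

/-- `x ↦ 1 ⊗ x` from `A ⊗ A ⊗ A` to `A ⊗ A ⊗ A ⊗ A`. -/
def leg234 : A ⊗[ℂ] (A ⊗[ℂ] A) →ₐ[ℂ] A ⊗[ℂ] (A ⊗[ℂ] (A ⊗[ℂ] A)) :=
  Algebra.TensorProduct.includeRight

/-- `ε ⊗ id : A ⊗ A → A`. -/
def counitFst (ε : A →ₐ[ℂ] ℂ) : A ⊗[ℂ] A →ₐ[ℂ] A :=
  (Algebra.TensorProduct.lid ℂ A).toAlgHom.comp
    (Algebra.TensorProduct.map ε (AlgHom.id ℂ A))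

/-- `id ⊗ ε : A ⊗ A → A`. -/
def counitSnd (ε : A →ₐ[ℂ] ℂ) : A ⊗[ℂ] A →ₐ[ℂ] A :=
  (Algebra.TensorProduct.rid ℂ ℂ A).toAlgHom.comp
    (Algebra.TensorProduct.map (AlgHom.id ℂ A) ε)

/-- `id ⊗ ε ⊗ id : A ⊗ A ⊗ A → A ⊗ A`. -/
def counitMid (ε : A →ₐ[ℂ] ℂ) : A ⊗[ℂ] (A ⊗[ℂ] A) →ₐ[ℂ] A ⊗[ℂ] A :=
  Algebra.TensorProduct.map (AlgHom.id ℂ A) (counitFst ε)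

end Legs

/-! ### Quasi-bialgebras -/

/-- A quasi-bialgebra structure on a complex algebra `A`
(with trivial unit constraints): counit, comultiplication and coassociator `Φ`. -/
structure QuasiBialgebra (A : Type) [Ring A] [Algebra ℂ A] where
  counit : A →ₐ[ℂ] ℂ
  comul : A →ₐ[ℂ] A ⊗[ℂ] A
  Φ : (A ⊗[ℂ] (A ⊗[ℂ] A))ˣ
  counit_fst : ∀ a, counitFst counit (comul a) = a
  counit_snd : ∀ a, counitSnd counit (comul a) = a
  quasi_coassoc : ∀ a, comulFst comul (comul a) = Φ * comulSnd comul (comul a) * (Φ⁻¹).val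
  counital : counitMid counit Φ.val = 1
  cocycle : comul1 comul Φ.val * comul3 comul Φ.val
    = leg123 Φ.val * comul2 comul Φ.val * leg234 Φ.val

namespace QuasiBialgebra

/-- `K` is the Drinfeld twist of `H` by the invertible element `F`:
`ε_K = ε`, `Δ_K = F Δ F⁻¹` and
`Φ_K = (F ⊗ 1) (Δ ⊗ id)(F) Φ (id ⊗ Δ)(F)⁻¹ (1 ⊗ F)⁻¹`, with `F` counital. -/
structure IsTwist {A : Type} [Ring A] [Algebra ℂ A] (H K : QuasiBialgebra A)
    (F : (A ⊗[ℂ] A)ˣ) : Prop where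
  counit_fst : counitFst H.counit F.val = 1
  counit_snd : counitSnd H.counit F.val = 1
  counit_eq : K.counit = H.counit
  comul_eq : ∀ a, K.comul a = F * H.comul a * (F⁻¹).val
  coassociator_eq : K.Φ.val = leg12 F.val * comulFst H.comul F.val * H.Φ.val
    * comulSnd H.comul (F⁻¹).val * leg23 (F⁻¹).val

/-- An isomorphism of quasi-bialgebras. -/
structure Iso {A B : Type} [Ring A] [Algebra ℂ A] [Ring B] [Algebra ℂ B]
    (H : QuasiBialgebra A) (K : QuasiBialgebra B) where
  toAlgEquiv : A ≃ₐ[ℂ] B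
  counit_eq : ∀ a, K.counit (toAlgEquiv a) = H.counit a
  comul_eq : ∀ a, K.comul (toAlgEquiv a) =
    Algebra.TensorProduct.map toAlgEquiv.toAlgHom toAlgEquiv.toAlgHom (H.comul a)
  coassociator_eq : K.Φ.val = Algebra.TensorProduct.map toAlgEquiv.toAlgHom
    (Algebra.TensorProduct.map toAlgEquiv.toAlgHom toAlgEquiv.toAlgHom) H.Φ.val

/-- Up to isomorphism, `K` can be obtained from `H` by a Drinfeld twist. -/
def IsTwistEquivalent {A B : Type} [Ring A] [Algebra ℂ A] [Ring B] [Algebra ℂ B]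
    (H : QuasiBialgebra A) (K : QuasiBialgebra B) : Prop :=
  ∃ (H' : QuasiBialgebra A) (F : (A ⊗[ℂ] A)ˣ), H.IsTwist H' F ∧ Nonempty (Iso H' K)

end QuasiBialgebra

/-! ### Coassociators on a bialgebra and cohomology in degree three -/

section Cohomology

open Bialgebra

variable {A : Type} [Ring A] [Bialgebra ℂ A]

/-- A coassociator on a bialgebra `A`, i.e. a `3`-cocycle: an invertible, counital element
`Φ` of `A ⊗ A ⊗ A` which commutes with the iterated coproduct (that is, it intertwines
`(id ⊗ Δ)Δ` and `(Δ ⊗ id)Δ`) and satisfies the `3`-cocycle condition. -/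
structure IsCoassociator (Φ : A ⊗[ℂ] (A ⊗[ℂ] A)) : Prop where
  isUnit : IsUnit Φ
  intertwines : ∀ a : A, comulFst (comulAlgHom ℂ A) (comulAlgHom ℂ A a) * Φ
    = Φ * comulSnd (comulAlgHom ℂ A) (comulAlgHom ℂ A a)
  counital : counitMid (counitAlgHom ℂ A) Φ = 1
  cocycle : comul1 (comulAlgHom ℂ A) Φ * comul3 (comulAlgHom ℂ A) Φ
    = leg123 Φ * comul2 (comulAlgHom ℂ A) Φ * leg234 Φ

lemma comulFst_comul (a : A) : comulFst (comulAlgHom ℂ A) (comulAlgHom ℂ A a)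
    = comulSnd (comulAlgHom ℂ A) (comulAlgHom ℂ A a) :=
  Coalgebra.coassoc_apply (R := ℂ) a

lemma isCoassociator_one : IsCoassociator (1 : A ⊗[ℂ] (A ⊗[ℂ] A)) where
  isUnit := isUnit_one
  intertwines a := by rw [mul_one, one_mul, comulFst_comul]
  counital := map_one _
  cocycle := by simp only [map_one, mul_one]

lemma counitFst_comul (a : A) : counitFst (counitAlgHom ℂ A) (comulAlgHom ℂ A a) = a := by
  have h : (Algebra.TensorProduct.map (counitAlgHom ℂ A) (AlgHom.id ℂ A)) (comulAlgHom ℂ A a)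
      = 1 ⊗ₜ a := Coalgebra.rTensor_counit_comul (R := ℂ) a
  rw [counitFst, AlgHom.comp_apply, h]
  simp

lemma counitSnd_comul (a : A) : counitSnd (counitAlgHom ℂ A) (comulAlgHom ℂ A a) = a := by
  have h : (Algebra.TensorProduct.map (AlgHom.id ℂ A) (counitAlgHom ℂ A)) (comulAlgHom ℂ A a)
      = a ⊗ₜ 1 := Coalgebra.lTensor_counit_comul (R := ℂ) a
  rw [counitSnd, AlgHom.comp_apply, h]
  simp

variable (A) in
/-- The quasi-bialgebra `(A, Φ)` obtained from a bialgebra `A` and a coassociator on it. -/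
def QuasiBialgebra.ofCoassociator (Φ : A ⊗[ℂ] (A ⊗[ℂ] A)) (h : IsCoassociator Φ) :
    QuasiBialgebra A where
  counit := counitAlgHom ℂ A
  comul := comulAlgHom ℂ A
  Φ := h.isUnit.unit
  counit_fst := counitFst_comul
  counit_snd := counitSnd_comul
  quasi_coassoc a := by
    rw [Units.eq_mul_inv_iff_mul_eq]
    exact h.intertwines a
  counital := h.counital
  cocycle := h.cocycle

variable (A) in
/-- A bialgebra regarded as a quasi-bialgebra with coassociator `1 ⊗ 1 ⊗ 1`. -/
def QuasiBialgebra.ofBialgebra : QuasiBialgebra A :=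
  QuasiBialgebra.ofCoassociator A 1 isCoassociator_one

/-- An invariant counital `2`-cochain: an invertible element `F` of `A ⊗ A` that commutes with
all coproducts and is normalised by the counit. -/
structure IsInvariantCochain (F : (A ⊗[ℂ] A)ˣ) : Prop where
  invariant : ∀ a : A, F.val * comulAlgHom ℂ A a = comulAlgHom ℂ A a * F.val
  counit_fst : counitFst (counitAlgHom ℂ A) F.val = 1
  counit_snd : counitSnd (counitAlgHom ℂ A) F.val = 1

/-- Two elements of `A ⊗ A ⊗ A` are cohomologous if they differ by the action
`Φ ↦ (F ⊗ 1) (Δ ⊗ id)(F) Φ (id ⊗ Δ)(F)⁻¹ (1 ⊗ F)⁻¹` of an invariant `2`-cochain `F`. In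
particular `Φ` is cohomologous to `1` iff it is the coboundary of such an `F`. -/
def Cohomologous (Φ Ψ : A ⊗[ℂ] (A ⊗[ℂ] A)) : Prop :=
  ∃ F : (A ⊗[ℂ] A)ˣ, IsInvariantCochain F ∧
    Ψ = leg12 F.val * comulFst (comulAlgHom ℂ A) F.val * Φ
      * comulSnd (comulAlgHom ℂ A) (F⁻¹).val * leg23 (F⁻¹).val

namespace IsInvariantCochain

lemma one : IsInvariantCochain (1 : (A ⊗[ℂ] A)ˣ) :=
  ⟨fun a => by simp, by simp, by simp⟩

lemma inv {F : (A ⊗[ℂ] A)ˣ} (h : IsInvariantCochain F) : IsInvariantCochain F⁻¹ := by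
  refine ⟨fun a => ?_, ?_, ?_⟩
  · rw [Units.inv_mul_eq_iff_eq_mul, ← mul_assoc, h.invariant, Units.mul_inv_cancel_right]
  · have := congrArg (counitFst (counitAlgHom ℂ A)) F.mul_inv
    rwa [map_mul, h.counit_fst, one_mul, map_one] at this
  · have := congrArg (counitSnd (counitAlgHom ℂ A)) F.mul_inv
    rwa [map_mul, h.counit_snd, one_mul, map_one] at this

lemma mul {F G : (A ⊗[ℂ] A)ˣ} (hF : IsInvariantCochain F) (hG : IsInvariantCochain G) :
    IsInvariantCochain (F * G) := by
  refine ⟨fun a => ?_, ?_, ?_⟩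
  · rw [Units.val_mul, mul_assoc, hG.invariant, ← mul_assoc, hF.invariant, mul_assoc]
  · rw [Units.val_mul, map_mul, hF.counit_fst, hG.counit_fst, one_mul]
  · rw [Units.val_mul, map_mul, hF.counit_snd, hG.counit_snd, one_mul]

lemma leg12_comm {F : (A ⊗[ℂ] A)ˣ} (hF : IsInvariantCochain F) (x : A ⊗[ℂ] A) :
    leg12 F.val * comulFst (comulAlgHom ℂ A) x = comulFst (comulAlgHom ℂ A) x * leg12 F.val := by
  have key : ∀ y : A ⊗[ℂ] A, leg12 y =
      (Algebra.TensorProduct.assoc ℂ ℂ ℂ A A A).toAlgHom (y ⊗ₜ 1) := by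
    intro y
    induction y with
    | zero => simp
    | tmul p q => simp [leg12]
    | add p q hp hq => simp only [map_add, hp, hq, TensorProduct.add_tmul]
  induction x with
  | zero => simp
  | tmul a b =>
    rw [key, comulFst, AlgHom.comp_apply, ← map_mul, ← map_mul]
    simp [hF.invariant a, -comulAlgHom_apply]
  | add p q hp hq => simp only [map_add, mul_add, add_mul, hp, hq]

lemma leg23_comm {F : (A ⊗[ℂ] A)ˣ} (hF : IsInvariantCochain F) (x : A ⊗[ℂ] A) :
    leg23 F.val * comulSnd (comulAlgHom ℂ A) x = comulSnd (comulAlgHom ℂ A) x * leg23 F.val := by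
  induction x with
  | zero => simp
  | tmul a b => simp [leg23, comulSnd, hF.invariant b, -comulAlgHom_apply]
  | add p q hp hq => simp only [map_add, mul_add, add_mul, hp, hq]

end IsInvariantCochain

lemma cohomologous_equivalence :
    Equivalence (Cohomologous : A ⊗[ℂ] (A ⊗[ℂ] A) → A ⊗[ℂ] (A ⊗[ℂ] A) → Prop) where
  refl Φ := ⟨1, IsInvariantCochain.one, by simp⟩
  symm := by
    rintro Φ Ψ ⟨F, hF, rfl⟩
    refine ⟨F⁻¹, hF.inv, ?_⟩
    rw [hF.inv.leg12_comm, inv_inv]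
    have e1 : comulFst (comulAlgHom ℂ A) (F⁻¹).val * leg12 (F⁻¹).val * (leg12 F.val *
        comulFst (comulAlgHom ℂ A) F.val) = 1 := by
      rw [mul_assoc, ← mul_assoc (leg12 (F⁻¹).val), ← map_mul leg12, F.inv_mul, map_one, one_mul,
        ← map_mul, F.inv_mul, map_one]
    have e2 : comulSnd (comulAlgHom ℂ A) (F⁻¹).val * leg23 (F⁻¹).val *
        (comulSnd (comulAlgHom ℂ A) F.val * leg23 F.val) = 1 := by
      rw [← hF.leg23_comm, mul_assoc, ← mul_assoc (leg23 (F⁻¹).val), ← map_mul leg23, F.inv_mul,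
        map_one, one_mul, ← map_mul, F.inv_mul, map_one]
    calc Φ = (comulFst (comulAlgHom ℂ A) (F⁻¹).val * leg12 (F⁻¹).val * (leg12 F.val *
        comulFst (comulAlgHom ℂ A) F.val)) * Φ * (comulSnd (comulAlgHom ℂ A) (F⁻¹).val *
        leg23 (F⁻¹).val * (comulSnd (comulAlgHom ℂ A) F.val * leg23 F.val)) := by
          rw [e1, e2, one_mul, mul_one]
      _ = _ := by simp only [mul_assoc]
  trans := by
    rintro Φ Ψ Θ ⟨F, hF, rfl⟩ ⟨G, hG, rfl⟩
    refine ⟨G * F, hG.mul hF, ?_⟩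
    have e1 : leg12 (G * F).val * comulFst (comulAlgHom ℂ A) (G * F).val =
        leg12 G.val * comulFst (comulAlgHom ℂ A) G.val *
          (leg12 F.val * comulFst (comulAlgHom ℂ A) F.val) := by
      rw [Units.val_mul, map_mul, map_mul, mul_assoc, ← mul_assoc (leg12 F.val), hF.leg12_comm]
      simp only [mul_assoc]
    have e2 : comulSnd (comulAlgHom ℂ A) ((G * F)⁻¹).val * leg23 ((G * F)⁻¹).val =
        comulSnd (comulAlgHom ℂ A) (F⁻¹).val * leg23 (F⁻¹).val *
          (comulSnd (comulAlgHom ℂ A) (G⁻¹).val * leg23 (G⁻¹).val) := by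
      rw [mul_inv_rev, Units.val_mul, map_mul, map_mul, mul_assoc (comulSnd _ (F⁻¹).val),
        ← mul_assoc (comulSnd _ (G⁻¹).val), ← hF.inv.leg23_comm]
      simp only [mul_assoc]
    rw [mul_assoc _ (comulSnd _ ((G * F)⁻¹).val), e1, e2]
    simp only [mul_assoc]

variable (A) in
/-- The third (non-abelian) cohomology of a bialgebra, as a pointed set: `3`-cocycles modulo the
action of invariant `2`-cochains. (For a non-commutative bialgebra only the invariant `2`-cochains
leave the comultiplication unchanged, hence act on the `3`-cocycles of the given bialgebra.) -/
def H3 : Type :=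
  Quotient (⟨fun x y => Cohomologous x.1 y.1, fun x => cohomologous_equivalence.refl x.1,
    fun h => cohomologous_equivalence.symm h, fun h => cohomologous_equivalence.trans h⟩ :
    Setoid {Φ : A ⊗[ℂ] (A ⊗[ℂ] A) // IsCoassociator Φ})

/-- The class of a `3`-cocycle. -/
def H3.mk (Φ : A ⊗[ℂ] (A ⊗[ℂ] A)) (h : IsCoassociator Φ) : H3 A := Quotient.mk _ ⟨Φ, h⟩

/-- The trivial class. -/
def H3.trivial : H3 A := H3.mk 1 isCoassociator_one

end Cohomology

/-! ### The monoidal category of finite-dimensional representations -/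

section Actions

variable {A B C D : Type} [Ring A] [Algebra ℂ A] [Ring B] [Algebra ℂ B] [Ring C] [Algebra ℂ C]
  [Ring D] [Algebra ℂ D]
variable {U V W X : Type} [AddCommGroup U] [Module ℂ U] [AddCommGroup V] [Module ℂ V]
  [AddCommGroup W] [Module ℂ W] [AddCommGroup X] [Module ℂ X]

/-- The action of `A ⊗ B` on `U ⊗ V` given by actions of `A` on `U` and of `B` on `V`. -/
def tensorAction (ρ : A →ₐ[ℂ] Module.End ℂ U) (σ : B →ₐ[ℂ] Module.End ℂ V) :
    A ⊗[ℂ] B →ₐ[ℂ] Module.End ℂ (U ⊗[ℂ] V) :=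
  Module.endTensorEndAlgHom.comp (Algebra.TensorProduct.map ρ σ)

@[simp] lemma tensorAction_tmul (ρ : A →ₐ[ℂ] Module.End ℂ U) (σ : B →ₐ[ℂ] Module.End ℂ V)
    (a : A) (b : B) (u : U) (v : V) :
    tensorAction ρ σ (a ⊗ₜ b) (u ⊗ₜ v) = ρ a u ⊗ₜ σ b v := rfl

lemma tensorAction_comp_right (ρ : A →ₐ[ℂ] Module.End ℂ U) (σ : C →ₐ[ℂ] Module.End ℂ V)
    (f : B →ₐ[ℂ] C) (x : A ⊗[ℂ] B) :
    tensorAction ρ (σ.comp f) x =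
      tensorAction ρ σ (Algebra.TensorProduct.map (AlgHom.id ℂ A) f x) := by
  induction x with
  | zero => simp
  | tmul a b => ext; simp
  | add p q hp hq => simp only [map_add, hp, hq]

lemma tensorAction_comp_left (ρ : C →ₐ[ℂ] Module.End ℂ U) (σ : B →ₐ[ℂ] Module.End ℂ V)
    (f : A →ₐ[ℂ] C) (x : A ⊗[ℂ] B) :
    tensorAction (ρ.comp f) σ x =
      tensorAction ρ σ (Algebra.TensorProduct.map f (AlgHom.id ℂ B) x) := by
  induction x with
  | zero => simp
  | tmul a b => ext; simp
  | add p q hp hq => simp only [map_add, hp, hq]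

lemma assoc_tensorAction (ρ : A →ₐ[ℂ] Module.End ℂ U) (σ : B →ₐ[ℂ] Module.End ℂ V)
    (τ : C →ₐ[ℂ] Module.End ℂ W) (x : (A ⊗[ℂ] B) ⊗[ℂ] C) (w : (U ⊗[ℂ] V) ⊗[ℂ] W) :
    TensorProduct.assoc ℂ U V W (tensorAction (tensorAction ρ σ) τ x w) =
      tensorAction ρ (tensorAction σ τ) ((Algebra.TensorProduct.assoc ℂ ℂ ℂ A B C).toAlgHom x)
        (TensorProduct.assoc ℂ U V W w) := by
  induction x with
  | zero => simp
  | add p q hp hq => simp only [map_add, LinearMap.add_apply, hp, hq]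
  | tmul ab c =>
    induction ab with
    | zero => simp
    | add p q hp hq => simp only [TensorProduct.add_tmul, map_add, LinearMap.add_apply, hp, hq]
    | tmul a b =>
      induction w with
      | zero => simp
      | add p q hp hq => simp only [map_add, hp, hq]
      | tmul uv w =>
        induction uv with
        | zero => simp
        | add p q hp hq => simp only [TensorProduct.add_tmul, map_add, hp, hq]
        | tmul u v => simp

/-- Tensor products of intertwiners intertwine the tensor product actions. -/
lemma map_tensorAction {U' V' : Type} [AddCommGroup U'] [Module ℂ U'] [AddCommGroup V']
    [Module ℂ V'] (ρ : A →ₐ[ℂ] Module.End ℂ U) (σ : B →ₐ[ℂ] Module.End ℂ V)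
    (ρ' : A →ₐ[ℂ] Module.End ℂ U') (σ' : B →ₐ[ℂ] Module.End ℂ V') (f : U →ₗ[ℂ] U')
    (g : V →ₗ[ℂ] V') (hf : ∀ a u, f (ρ a u) = ρ' a (f u)) (hg : ∀ b v, g (σ b v) = σ' b (g v))
    (x : A ⊗[ℂ] B) (w : U ⊗[ℂ] V) :
    TensorProduct.map f g (tensorAction ρ σ x w) =
      tensorAction ρ' σ' x (TensorProduct.map f g w) := by
  induction x with
  | zero => simp
  | add p q hp hq => simp only [map_add, LinearMap.add_apply, hp, hq]
  | tmul a b =>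
    induction w with
    | zero => simp
    | add p q hp hq => simp only [map_add, hp, hq]
    | tmul u v => simp [hf, hg]

lemma tensorAction_includeRight (ρ : A →ₐ[ℂ] Module.End ℂ U) (σ : B →ₐ[ℂ] Module.End ℂ V)
    (x : B) : tensorAction ρ σ (Algebra.TensorProduct.includeRight x)
      = TensorProduct.map LinearMap.id (σ x) := by
  ext; simp

lemma tensorAction_tmul_one (ρ : A →ₐ[ℂ] Module.End ℂ U) (σ : B →ₐ[ℂ] Module.End ℂ V)
    (x : A) : tensorAction ρ σ (x ⊗ₜ 1)
      = TensorProduct.map (ρ x) LinearMap.id := by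
  ext; simp

lemma leg123_assoc (x : A ⊗[ℂ] (A ⊗[ℂ] A)) : leg123 x =
    (Algebra.TensorProduct.map (AlgHom.id ℂ A)
      (Algebra.TensorProduct.assoc ℂ ℂ ℂ A A A).toAlgHom)
      ((Algebra.TensorProduct.assoc ℂ ℂ ℂ A (A ⊗[ℂ] A) A).toAlgHom (x ⊗ₜ 1)) := by
  induction x with
  | zero => simp
  | add p q hp hq => simp only [map_add, hp, hq, TensorProduct.add_tmul]
  | tmul a y =>
    induction y with
    | zero => simp
    | add p q hp hq =>
      simp only [map_add, hp, hq, TensorProduct.add_tmul, TensorProduct.tmul_add]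
    | tmul b c => simp [leg123, leg12]

/-- The action of `A` on `U ⊗ V` through a comultiplication. -/
abbrev comulAction (Δ : A →ₐ[ℂ] A ⊗[ℂ] A) (ρ : A →ₐ[ℂ] Module.End ℂ U)
    (σ : A →ₐ[ℂ] Module.End ℂ V) : A →ₐ[ℂ] Module.End ℂ (U ⊗[ℂ] V) :=
  (tensorAction ρ σ).comp Δ

/-- The action of `A` on `ℂ` through a counit. -/
abbrev counitAction (ε : A →ₐ[ℂ] ℂ) : A →ₐ[ℂ] Module.End ℂ ℂ :=
  (Algebra.ofId ℂ (Module.End ℂ ℂ)).comp ε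

lemma lid_counitAction (ε : A →ₐ[ℂ] ℂ) (ρ : A →ₐ[ℂ] Module.End ℂ U) (x : A ⊗[ℂ] A)
    (w : ℂ ⊗[ℂ] U) : TensorProduct.lid ℂ U (tensorAction (counitAction ε) ρ x w) =
      ρ (counitFst ε x) (TensorProduct.lid ℂ U w) := by
  induction x with
  | zero => simp
  | add p q hp hq => simp only [map_add, LinearMap.add_apply, hp, hq]
  | tmul p q =>
    induction w with
    | zero => simp
    | add p q hp hq => simp only [map_add, hp, hq]
    | tmul c m => simp [counitFst, Algebra.ofId_apply, mul_smul, smul_comm c]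

lemma rid_counitAction (ε : A →ₐ[ℂ] ℂ) (ρ : A →ₐ[ℂ] Module.End ℂ U) (x : A ⊗[ℂ] A)
    (w : U ⊗[ℂ] ℂ) : TensorProduct.rid ℂ U (tensorAction ρ (counitAction ε) x w) =
      ρ (counitSnd ε x) (TensorProduct.rid ℂ U w) := by
  induction x with
  | zero => simp
  | add p q hp hq => simp only [map_add, LinearMap.add_apply, hp, hq]
  | tmul p q =>
    induction w with
    | zero => simp
    | add p q hp hq => simp only [map_add, hp, hq]
    | tmul m c => simp [counitSnd, Algebra.ofId_apply, mul_smul, smul_comm c]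

/-- The canonical map `(U ⊗ V) ⊗ W → U ⊗ (V ⊗ W)` followed by the action of `x ∈ A ⊗ A ⊗ A`. -/
def assocBy (ρ : A →ₐ[ℂ] Module.End ℂ U) (σ : A →ₐ[ℂ] Module.End ℂ V)
    (τ : A →ₐ[ℂ] Module.End ℂ W) (x : A ⊗[ℂ] (A ⊗[ℂ] A)) :
    (U ⊗[ℂ] V) ⊗[ℂ] W →ₗ[ℂ] U ⊗[ℂ] (V ⊗[ℂ] W) :=
  tensorAction ρ (tensorAction σ τ) x ∘ₗ (TensorProduct.assoc ℂ U V W).toLinearMap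

/-- The equivalence `(U ⊗ V) ⊗ W ≃ U ⊗ (V ⊗ W)` given by `u ⊗ v ⊗ w ↦ x . (u ⊗ v ⊗ w)`. -/
def assocByEquiv (ρ : A →ₐ[ℂ] Module.End ℂ U) (σ : A →ₐ[ℂ] Module.End ℂ V)
    (τ : A →ₐ[ℂ] Module.End ℂ W) (x : (A ⊗[ℂ] (A ⊗[ℂ] A))ˣ) :
    (U ⊗[ℂ] V) ⊗[ℂ] W ≃ₗ[ℂ] U ⊗[ℂ] (V ⊗[ℂ] W) :=
  let e : (U ⊗[ℂ] (V ⊗[ℂ] W)) ≃ₗ[ℂ] (U ⊗[ℂ] (V ⊗[ℂ] W)) := LinearEquiv.ofLinearMap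
    (tensorAction ρ (tensorAction σ τ) x.val) (tensorAction ρ (tensorAction σ τ) (x⁻¹).val)
    (by rw [← Module.End.mul_eq_comp, ← map_mul, Units.mul_inv, map_one]; rfl)
    (by rw [← Module.End.mul_eq_comp, ← map_mul, Units.inv_mul, map_one]; rfl)
  (TensorProduct.assoc ℂ U V W).trans e

lemma assocByEquiv_toLinearMap (ρ : A →ₐ[ℂ] Module.End ℂ U) (σ : A →ₐ[ℂ] Module.End ℂ V)
    (τ : A →ₐ[ℂ] Module.End ℂ W) (x : (A ⊗[ℂ] (A ⊗[ℂ] A))ˣ) :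
    (assocByEquiv ρ σ τ x).toLinearMap = assocBy ρ σ τ x.val := rfl

lemma assoc_comulAction (Δ : A →ₐ[ℂ] A ⊗[ℂ] A) (ρ : A →ₐ[ℂ] Module.End ℂ U)
    (σ : A →ₐ[ℂ] Module.End ℂ V) (τ : C →ₐ[ℂ] Module.End ℂ W) (x : A ⊗[ℂ] C)
    (w : (U ⊗[ℂ] V) ⊗[ℂ] W) :
    TensorProduct.assoc ℂ U V W (tensorAction (comulAction Δ ρ σ) τ x w) =
      tensorAction ρ (tensorAction σ τ) ((Algebra.TensorProduct.assoc ℂ ℂ ℂ A A C).toAlgHom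
        (Algebra.TensorProduct.map Δ (AlgHom.id ℂ C) x)) (TensorProduct.assoc ℂ U V W w) := by
  rw [comulAction, tensorAction_comp_left, assoc_tensorAction]

lemma assocBy_comm (Δ : A →ₐ[ℂ] A ⊗[ℂ] A) (ρ : A →ₐ[ℂ] Module.End ℂ U)
    (σ : A →ₐ[ℂ] Module.End ℂ V) (τ : A →ₐ[ℂ] Module.End ℂ W) (x : A ⊗[ℂ] (A ⊗[ℂ] A)) (a : A)
    (h : x * comulFst Δ (Δ a) = comulSnd Δ (Δ a) * x) (w : (U ⊗[ℂ] V) ⊗[ℂ] W) :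
    assocBy ρ σ τ x (comulAction Δ (comulAction Δ ρ σ) τ a w) =
      comulAction Δ ρ (comulAction Δ σ τ) a (assocBy ρ σ τ x w) := by
  have h2 : comulAction Δ ρ (comulAction Δ σ τ) a =
      tensorAction ρ (tensorAction σ τ) (comulSnd Δ (Δ a)) :=
    tensorAction_comp_right ρ (tensorAction σ τ) Δ (Δ a)
  have h1 : TensorProduct.assoc ℂ U V W (comulAction Δ (comulAction Δ ρ σ) τ a w) =
      tensorAction ρ (tensorAction σ τ) (comulFst Δ (Δ a)) (TensorProduct.assoc ℂ U V W w) :=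
    assoc_comulAction Δ ρ σ τ (Δ a) w
  simp only [assocBy, LinearMap.comp_apply, LinearEquiv.coe_coe]
  rw [h1, h2, ← Module.End.mul_apply, ← Module.End.mul_apply, ← map_mul, ← map_mul, h]

lemma assocBy_triangle (ε : A →ₐ[ℂ] ℂ) (ρ : A →ₐ[ℂ] Module.End ℂ U)
    (σ : A →ₐ[ℂ] Module.End ℂ V) (x : A ⊗[ℂ] (A ⊗[ℂ] A)) (h : counitMid ε x = 1)
    (w : (U ⊗[ℂ] ℂ) ⊗[ℂ] V) :
    TensorProduct.map LinearMap.id (TensorProduct.lid ℂ V).toLinearMap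
      (assocBy ρ (counitAction ε) σ x w) =
    TensorProduct.map (TensorProduct.rid ℂ U).toLinearMap LinearMap.id w := by
  have key : ∀ z, TensorProduct.map LinearMap.id (TensorProduct.lid ℂ V).toLinearMap
      (tensorAction ρ (tensorAction (counitAction ε) σ) x z) =
      tensorAction ρ σ (counitMid ε x)
        (TensorProduct.map LinearMap.id (TensorProduct.lid ℂ V).toLinearMap z) := by
    intro z
    rw [counitMid, ← tensorAction_comp_right]
    exact map_tensorAction _ _ _ _ _ _ (fun _ _ => rfl)
      (fun b v => lid_counitAction ε σ b v) x z
  simp only [assocBy, LinearMap.comp_apply, LinearEquiv.coe_coe]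
  rw [key, h, map_one, Module.End.one_apply]
  induction w with
  | zero => simp
  | add p q hp hq => simp only [map_add, hp, hq]
  | tmul y v =>
    induction y with
    | zero => simp
    | add p q hp hq => simp only [map_add, hp, hq, TensorProduct.add_tmul]
    | tmul u c => simp [TensorProduct.smul_tmul]

lemma map_assoc_tensorAction (ρ : D →ₐ[ℂ] Module.End ℂ X) (σ : A →ₐ[ℂ] Module.End ℂ U)
    (τ : B →ₐ[ℂ] Module.End ℂ V) (υ : C →ₐ[ℂ] Module.End ℂ W) (x : D ⊗[ℂ] ((A ⊗[ℂ] B) ⊗[ℂ] C))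
    (w : X ⊗[ℂ] ((U ⊗[ℂ] V) ⊗[ℂ] W)) :
    TensorProduct.map LinearMap.id (TensorProduct.assoc ℂ U V W).toLinearMap
      (tensorAction ρ (tensorAction (tensorAction σ τ) υ) x w) =
    tensorAction ρ (tensorAction σ (tensorAction τ υ))
      (Algebra.TensorProduct.map (AlgHom.id ℂ D)
        (Algebra.TensorProduct.assoc ℂ ℂ ℂ A B C).toAlgHom x)
      (TensorProduct.map LinearMap.id (TensorProduct.assoc ℂ U V W).toLinearMap w) := by
  rw [← tensorAction_comp_right]
  exact map_tensorAction _ _ _ _ _ _ (fun _ _ => rfl)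
    (fun b v => assoc_tensorAction σ τ υ b v) x w

lemma assocBy_pentagon (Δ : A →ₐ[ℂ] A ⊗[ℂ] A) (ρ : A →ₐ[ℂ] Module.End ℂ U)
    (σ : A →ₐ[ℂ] Module.End ℂ V) (τ : A →ₐ[ℂ] Module.End ℂ W) (υ : A →ₐ[ℂ] Module.End ℂ X)
    (x : A ⊗[ℂ] (A ⊗[ℂ] A)) (h : leg234 x * comul2 Δ x * leg123 x = comul3 Δ x * comul1 Δ x)
    (w : ((U ⊗[ℂ] V) ⊗[ℂ] W) ⊗[ℂ] X) :
    TensorProduct.map LinearMap.id (assocBy σ τ υ x)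
      (assocBy ρ (comulAction Δ σ τ) υ x
        (TensorProduct.map (assocBy ρ σ τ x) LinearMap.id w)) =
    assocBy ρ σ (comulAction Δ τ υ) x (assocBy (comulAction Δ ρ σ) τ υ x w) := by
  set T := tensorAction ρ (tensorAction σ (tensorAction τ υ)) with hT
  set a := TensorProduct.map (LinearMap.id : U →ₗ[ℂ] U) (TensorProduct.assoc ℂ V W X).toLinearMap
    with ha
  set b := (TensorProduct.assoc ℂ U (V ⊗[ℂ] W) X).toLinearMap with hb
  -- each of the five associators acts by one leg of `x`
  have h1 : ∀ z, TensorProduct.map LinearMap.id (assocBy σ τ υ x) z = T (leg234 x) (a z) := by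
    intro z
    rw [hT, leg234, tensorAction_includeRight, ha, ← LinearMap.comp_apply,
      ← TensorProduct.map_comp]
    rfl
  have h2 : ∀ z, a (assocBy ρ (comulAction Δ σ τ) υ x z) = T (comul2 Δ x) (a (b z)) := by
    intro z
    have e : tensorAction ρ (tensorAction (comulAction Δ σ τ) υ) x =
        tensorAction ρ (tensorAction (tensorAction σ τ) υ) (Algebra.TensorProduct.map
          (AlgHom.id ℂ A) (Algebra.TensorProduct.map Δ (AlgHom.id ℂ A)) x) := by
      rw [← tensorAction_comp_right]
      congr 2
      exact AlgHom.ext fun y => tensorAction_comp_left (tensorAction σ τ) υ Δ y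
    have e2 : comul2 Δ x = Algebra.TensorProduct.map (AlgHom.id ℂ A)
        (Algebra.TensorProduct.assoc ℂ ℂ ℂ A A A).toAlgHom
        (Algebra.TensorProduct.map (AlgHom.id ℂ A)
          (Algebra.TensorProduct.map Δ (AlgHom.id ℂ A)) x) := by
      rw [← AlgHom.comp_apply, ← Algebra.TensorProduct.map_comp]
      rfl
    rw [e2, assocBy, LinearMap.comp_apply, e, ha, map_assoc_tensorAction]
  have h3 : ∀ z, a (b (TensorProduct.map (assocBy ρ σ τ x) LinearMap.id z)) =
      T (leg123 x) (a (b (TensorProduct.map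
        (TensorProduct.assoc ℂ U V W).toLinearMap LinearMap.id z))) := by
    intro z
    have e : TensorProduct.map (assocBy ρ σ τ x) (LinearMap.id : X →ₗ[ℂ] X) z =
        tensorAction (tensorAction ρ (tensorAction σ τ)) υ (x ⊗ₜ 1) (TensorProduct.map
        (TensorProduct.assoc ℂ U V W).toLinearMap LinearMap.id z) := by
      rw [tensorAction_tmul_one, ← LinearMap.comp_apply, ← TensorProduct.map_comp]
      rfl
    rw [e, leg123_assoc, ha, hb, LinearEquiv.coe_coe, assoc_tensorAction, map_assoc_tensorAction]
  have h4 : ∀ z, assocBy ρ σ (comulAction Δ τ υ) x z =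
      T (comul3 Δ x) (TensorProduct.assoc ℂ U V (W ⊗[ℂ] X) z) := by
    intro z
    have e : tensorAction ρ (tensorAction σ (comulAction Δ τ υ)) x = T (comul3 Δ x) := by
      rw [hT, comul3, ← tensorAction_comp_right]
      congr 2
      exact AlgHom.ext fun y => tensorAction_comp_right σ (tensorAction τ υ) Δ y
    rw [assocBy, LinearMap.comp_apply, e, LinearEquiv.coe_coe]
  have h5 : ∀ z, TensorProduct.assoc ℂ U V (W ⊗[ℂ] X) (assocBy (comulAction Δ ρ σ) τ υ x z) =
      T (comul1 Δ x) (TensorProduct.assoc ℂ U V (W ⊗[ℂ] X)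
        (TensorProduct.assoc ℂ (U ⊗[ℂ] V) W X z)) := by
    intro z
    rw [assocBy, LinearMap.comp_apply, assoc_comulAction, hT, LinearEquiv.coe_coe]
    rfl
  rw [h1, h2, h3, h4, h5, ← Module.End.mul_apply, ← Module.End.mul_apply,
    ← Module.End.mul_apply, ← map_mul, ← map_mul, ← map_mul, h]
  congr 1
  refine LinearMap.congr_fun (f := a ∘ₗ b ∘ₗ TensorProduct.map
    (TensorProduct.assoc ℂ U V W).toLinearMap LinearMap.id)
    (g := (TensorProduct.assoc ℂ U V (W ⊗[ℂ] X)).toLinearMap ∘ₗ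
      (TensorProduct.assoc ℂ (U ⊗[ℂ] V) W X).toLinearMap) ?_ w
  ext
  rfl

lemma assocBy_naturality {U' V' W' : Type} [AddCommGroup U'] [Module ℂ U'] [AddCommGroup V']
    [Module ℂ V'] [AddCommGroup W'] [Module ℂ W'] (ρ : A →ₐ[ℂ] Module.End ℂ U)
    (σ : A →ₐ[ℂ] Module.End ℂ V) (τ : A →ₐ[ℂ] Module.End ℂ W) (ρ' : A →ₐ[ℂ] Module.End ℂ U')
    (σ' : A →ₐ[ℂ] Module.End ℂ V') (τ' : A →ₐ[ℂ] Module.End ℂ W') (f : U →ₗ[ℂ] U')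
    (g : V →ₗ[ℂ] V') (k : W →ₗ[ℂ] W') (hf : ∀ a u, f (ρ a u) = ρ' a (f u))
    (hg : ∀ a v, g (σ a v) = σ' a (g v)) (hk : ∀ a w, k (τ a w) = τ' a (k w))
    (x : A ⊗[ℂ] (A ⊗[ℂ] A)) (w : (U ⊗[ℂ] V) ⊗[ℂ] W) :
    assocBy ρ' σ' τ' x (TensorProduct.map (TensorProduct.map f g) k w) =
      TensorProduct.map f (TensorProduct.map g k) (assocBy ρ σ τ x w) := by
  have e : TensorProduct.assoc ℂ U' V' W' (TensorProduct.map (TensorProduct.map f g) k w) =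
      TensorProduct.map f (TensorProduct.map g k) (TensorProduct.assoc ℂ U V W w) := by
    refine LinearMap.congr_fun (f := (TensorProduct.assoc ℂ U' V' W').toLinearMap ∘ₗ
      TensorProduct.map (TensorProduct.map f g) k) (g := TensorProduct.map f
      (TensorProduct.map g k) ∘ₗ (TensorProduct.assoc ℂ U V W).toLinearMap) ?_ w
    ext
    rfl
  simp only [assocBy, LinearMap.comp_apply, LinearEquiv.coe_coe]
  rw [e, map_tensorAction ρ (tensorAction σ τ) ρ' (tensorAction σ' τ') f (TensorProduct.map g k)
    hf (map_tensorAction σ τ σ' τ' g k hg hk)]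

end Actions

namespace QuasiBialgebra

variable {A : Type} [Ring A] [Algebra ℂ A]

/-- A finite-dimensional representation of (the underlying algebra of) the quasi-bialgebra `H`. -/
structure Rep (H : QuasiBialgebra A) where
  V : Type
  [addCommGroup : AddCommGroup V]
  [module : Module ℂ V]
  [finiteDimensional : FiniteDimensional ℂ V]
  ρ : A →ₐ[ℂ] Module.End ℂ V

namespace Rep

attribute [instance] addCommGroup module finiteDimensional

variable {H : QuasiBialgebra A}

/-- Morphisms of representations: linear maps commuting with the action. -/
@[ext]
structure Hom (M N : H.Rep) where
  hom : M.V →ₗ[ℂ] N.V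
  comm : ∀ (a : A) (v : M.V), hom (M.ρ a v) = N.ρ a (hom v)

instance : Category H.Rep where
  Hom M N := Hom M N
  id M := ⟨LinearMap.id, fun _ _ => rfl⟩
  comp f g := ⟨g.hom ∘ₗ f.hom, fun a v => by simp [f.comm, g.comm]⟩

@[ext] lemma hom_ext {M N : H.Rep} {f g : M ⟶ N} (h : f.hom = g.hom) : f = g := Hom.ext h

@[simp] lemma id_hom (M : H.Rep) : Hom.hom (𝟙 M) = LinearMap.id := rfl

@[simp] lemma comp_hom {M N P : H.Rep} (f : M ⟶ N) (g : N ⟶ P) :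
    Hom.hom (f ≫ g) = g.hom ∘ₗ f.hom := rfl

/-- An invertible intertwiner is an isomorphism. -/
def mkIso {M N : H.Rep} (e : M.V ≃ₗ[ℂ] N.V) (he : ∀ a v, e (M.ρ a v) = N.ρ a (e v)) : M ≅ N where
  hom := ⟨e.toLinearMap, he⟩
  inv := ⟨e.symm.toLinearMap, fun a v => by
    simp only [LinearEquiv.coe_coe]
    rw [LinearEquiv.symm_apply_eq, he, LinearEquiv.apply_symm_apply]⟩
  hom_inv_id := by ext; simp
  inv_hom_id := by ext; simp

@[simp] lemma mkIso_hom_hom {M N : H.Rep} (e : M.V ≃ₗ[ℂ] N.V)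
    (he : ∀ a v, e (M.ρ a v) = N.ρ a (e v)) : Hom.hom (mkIso e he).hom = e.toLinearMap := rfl

/-- The tensor product of representations; `A` acts through the comultiplication. -/
abbrev tensor (M N : H.Rep) : H.Rep where
  V := M.V ⊗[ℂ] N.V
  ρ := comulAction H.comul M.ρ N.ρ

variable (H) in
/-- The unit object `ℂ`, on which `A` acts through the counit. -/
abbrev unit : H.Rep where
  V := ℂ
  ρ := counitAction H.counit

/-- The tensor product of morphisms. -/
def tensorMap {M N M' N' : H.Rep} (f : M ⟶ N) (g : M' ⟶ N') : tensor M M' ⟶ tensor N N' :=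
  ⟨TensorProduct.map f.hom g.hom, fun a v =>
    map_tensorAction M.ρ M'.ρ N.ρ N'.ρ f.hom g.hom f.comm g.comm (H.comul a) v⟩

lemma inv_intertwines (a : A) : (H.Φ⁻¹).val * comulFst H.comul (H.comul a) =
    comulSnd H.comul (H.comul a) * (H.Φ⁻¹).val := by
  rw [H.quasi_coassoc, mul_assoc, Units.inv_mul_cancel_left]

/-- The associator: its inverse `U ⊗ (V ⊗ W) → (U ⊗ V) ⊗ W` is
`u ⊗ (v ⊗ w) ↦ Φ . (u ⊗ v ⊗ w)`, so that `(U ⊗ V) ⊗ W → U ⊗ (V ⊗ W)` acts by `Φ⁻¹`. -/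
def associator (U V W : H.Rep) : tensor (tensor U V) W ≅ tensor U (tensor V W) :=
  mkIso (assocByEquiv U.ρ V.ρ W.ρ H.Φ⁻¹)
    (fun a w => assocBy_comm H.comul U.ρ V.ρ W.ρ (H.Φ⁻¹).val a (inv_intertwines a) w)

/-- The left unit isomorphism is that of vector spaces. -/
def leftUnitor (M : H.Rep) : tensor (unit H) M ≅ M :=
  mkIso (TensorProduct.lid ℂ M.V) (fun a w =>
    (lid_counitAction H.counit M.ρ (H.comul a) w).trans (by rw [H.counit_fst]))

/-- The right unit isomorphism is that of vector spaces. -/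
def rightUnitor (M : H.Rep) : tensor M (unit H) ≅ M :=
  mkIso (TensorProduct.rid ℂ M.V) (fun a w =>
    (rid_counitAction H.counit M.ρ (H.comul a) w).trans (by rw [H.counit_snd]))

instance : MonoidalCategoryStruct H.Rep where
  tensorObj := tensor
  tensorHom f g := tensorMap f g
  whiskerLeft M _ _ f := tensorMap (𝟙 M) f
  whiskerRight f M := tensorMap f (𝟙 M)
  tensorUnit := unit H
  associator := associator
  leftUnitor := leftUnitor
  rightUnitor := rightUnitor

lemma inv_counital : counitMid H.counit (H.Φ⁻¹).val = 1 := by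
  have h := congrArg (counitMid H.counit) H.Φ.mul_inv
  rwa [map_mul, H.counital, one_mul, map_one] at h

lemma inv_cocycle : leg234 (H.Φ⁻¹).val * comul2 H.comul (H.Φ⁻¹).val * leg123 (H.Φ⁻¹).val =
    comul3 H.comul (H.Φ⁻¹).val * comul1 H.comul (H.Φ⁻¹).val := by
  have h : Units.map (comul1 H.comul : _ →* _) H.Φ * Units.map (comul3 H.comul : _ →* _) H.Φ =
      Units.map (leg123 : _ →ₐ[ℂ] _).toMonoidHom H.Φ * Units.map (comul2 H.comul : _ →* _) H.Φ *
        Units.map (leg234 : _ →ₐ[ℂ] _).toMonoidHom H.Φ := Units.ext H.cocycle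
  have h2 := congrArg (fun u => (u⁻¹).val) h
  simp only [mul_inv_rev, Units.val_mul, ← map_inv, Units.coe_map, ← mul_assoc] at h2
  exact h2.symm

instance : MonoidalCategory H.Rep := MonoidalCategory.ofTensorHom
  (id_tensorHom_id := fun M N => hom_ext TensorProduct.map_id)
  (id_tensorHom := fun _ _ _ _ => rfl)
  (tensorHom_id := fun _ _ => rfl)
  (tensorHom_comp_tensorHom := fun f g f' g' =>
    hom_ext (TensorProduct.map_comp f'.hom g'.hom f.hom g.hom).symm)
  (associator_naturality := fun {U V W U' V' W'} f g h => hom_ext <| LinearMap.ext fun w => by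
    change assocBy U'.ρ V'.ρ W'.ρ (H.Φ⁻¹).val
        (TensorProduct.map (TensorProduct.map f.hom g.hom) h.hom w) =
      TensorProduct.map f.hom (TensorProduct.map g.hom h.hom) (assocBy U.ρ V.ρ W.ρ (H.Φ⁻¹).val w)
    exact assocBy_naturality _ _ _ _ _ _ f.hom g.hom h.hom f.comm g.comm h.comm _ w)
  (leftUnitor_naturality := fun f => hom_ext <| by
    apply TensorProduct.ext'
    intro c m
    change TensorProduct.lid ℂ _ (c ⊗ₜ f.hom m) = f.hom (TensorProduct.lid ℂ _ (c ⊗ₜ m))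
    simp)
  (rightUnitor_naturality := fun f => hom_ext <| by
    apply TensorProduct.ext'
    intro m c
    change TensorProduct.rid ℂ _ (f.hom m ⊗ₜ c) = f.hom (TensorProduct.rid ℂ _ (m ⊗ₜ c))
    simp)
  (pentagon := fun U V W X => hom_ext <| LinearMap.ext fun w =>
    assocBy_pentagon H.comul U.ρ V.ρ W.ρ X.ρ (H.Φ⁻¹).val inv_cocycle w)
  (triangle := fun U V => hom_ext <| LinearMap.ext fun w =>
    assocBy_triangle H.counit U.ρ V.ρ (H.Φ⁻¹).val inv_counital w)

end Rep

/-- The functor `Rep(A, Φ) ⥤ Rep(A, Φ')` which is the identity on underlying representations and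
morphisms, for two quasi-bialgebra structures on the same algebra. -/
def idFunctor (H K : QuasiBialgebra A) : H.Rep ⥤ K.Rep where
  obj M := ⟨M.V, M.ρ⟩
  map f := ⟨f.hom, f.comm⟩

/-- `Rep H` and `Rep K` are equivalent as monoidal categories. -/
def MonoidallyEquivalent {B : Type} [Ring B] [Algebra ℂ B] (H : QuasiBialgebra A)
    (K : QuasiBialgebra B) : Prop :=
  ∃ F : H.Rep ⥤ K.Rep, F.IsEquivalence ∧ Nonempty F.Monoidal

end QuasiBialgebra

/-! ### The restricted quantum group of `sl(2)` at `q = i` -/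

/-- The generators `E`, `F`, `K`. -/
inductive Gen : Type
  | E
  | F
  | K

open FreeAlgebra in
/-- The defining relations, with `K⁻¹ = K³`:
`K E = - E K`, `K F = - F K`, `[E, F] = (K - K⁻¹) / (i - i⁻¹)`, `E² = F² = 0`, `K⁴ = 1`. -/
inductive Rel : FreeAlgebra ℂ Gen → FreeAlgebra ℂ Gen → Prop
  | KE : Rel (ι ℂ Gen.K * ι ℂ Gen.E) (-(ι ℂ Gen.E * ι ℂ Gen.K))
  | KF : Rel (ι ℂ Gen.K * ι ℂ Gen.F) (-(ι ℂ Gen.F * ι ℂ Gen.K))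
  | EF : Rel (ι ℂ Gen.E * ι ℂ Gen.F - ι ℂ Gen.F * ι ℂ Gen.E)
      ((Complex.I - Complex.I⁻¹)⁻¹ • (ι ℂ Gen.K - ι ℂ Gen.K ^ 3))
  | EE : Rel (ι ℂ Gen.E ^ 2) 0
  | FF : Rel (ι ℂ Gen.F ^ 2) 0
  | KK : Rel (ι ℂ Gen.K ^ 4) 1

/-- The restricted quantum group `Q` of `sl(2)` at `q = i`, as an algebra. -/
def Q : Type := RingQuot Rel

namespace Q

instance : Ring Q := inferInstanceAs (Ring (RingQuot Rel))

instance : Algebra ℂ Q := inferInstanceAs (Algebra ℂ (RingQuot Rel))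

/-- The quotient map from the free algebra. -/
def proj : FreeAlgebra ℂ Gen →ₐ[ℂ] Q := RingQuot.mkAlgHom ℂ Rel

/-- The generator `E`. -/
def E : Q := proj (FreeAlgebra.ι ℂ Gen.E)

/-- The generator `F`. -/
def F : Q := proj (FreeAlgebra.ι ℂ Gen.F)

/-- The generator `K`. -/
def K : Q := proj (FreeAlgebra.ι ℂ Gen.K)

lemma KE : K * E = -(E * K) := by
  simpa [K, E] using (show proj _ = proj _ from RingQuot.mkAlgHom_rel ℂ Rel.KE)

lemma KF : K * F = -(F * K) := by
  simpa [K, F] using (show proj _ = proj _ from RingQuot.mkAlgHom_rel ℂ Rel.KF)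

lemma EF : E * F - F * E = (Complex.I - Complex.I⁻¹)⁻¹ • (K - K ^ 3) := by
  have h : proj _ = proj _ := RingQuot.mkAlgHom_rel ℂ Rel.EF
  rw [map_sub, map_mul, map_mul, map_smul, map_sub, map_pow] at h
  exact h

lemma EE : E ^ 2 = 0 := by
  simpa [E] using (show proj _ = proj _ from RingQuot.mkAlgHom_rel ℂ Rel.EE)

lemma FF : F ^ 2 = 0 := by
  simpa [F] using (show proj _ = proj _ from RingQuot.mkAlgHom_rel ℂ Rel.FF)

lemma KK : K ^ 4 = 1 := by
  simpa [K] using (show proj _ = proj _ from RingQuot.mkAlgHom_rel ℂ Rel.KK)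

section Lift

variable {B : Type} [Ring B] [Algebra ℂ B]

/-- Algebra homomorphisms out of `Q` are given by the images of the generators. -/
def lift (e f k : B) (hKE : k * e = -(e * k)) (hKF : k * f = -(f * k))
    (hEF : e * f - f * e = (Complex.I - Complex.I⁻¹)⁻¹ • (k - k ^ 3))
    (hE : e ^ 2 = 0) (hF : f ^ 2 = 0) (hK : k ^ 4 = 1) : Q →ₐ[ℂ] B :=
  RingQuot.liftAlgHom ℂ ⟨FreeAlgebra.lift ℂ (fun g => match g with
    | Gen.E => e
    | Gen.F => f
    | Gen.K => k), by
      intro x y h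
      cases h <;> simp_all⟩

variable {e f k : B} {hKE : k * e = -(e * k)} {hKF : k * f = -(f * k)}
    {hEF : e * f - f * e = (Complex.I - Complex.I⁻¹)⁻¹ • (k - k ^ 3)}
    {hE : e ^ 2 = 0} {hF : f ^ 2 = 0} {hK : k ^ 4 = 1}

@[simp] lemma lift_E : lift e f k hKE hKF hEF hE hF hK E = e :=
  (RingQuot.liftAlgHom_mkAlgHom_apply ℂ _ _ _).trans (by simp)

@[simp] lemma lift_F : lift e f k hKE hKF hEF hE hF hK F = f :=
  (RingQuot.liftAlgHom_mkAlgHom_apply ℂ _ _ _).trans (by simp)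

@[simp] lemma lift_K : lift e f k hKE hKF hEF hE hF hK K = k :=
  (RingQuot.liftAlgHom_mkAlgHom_apply ℂ _ _ _).trans (by simp)

lemma algHom_ext {g h : Q →ₐ[ℂ] B} (hE : g E = h E) (hF : g F = h F) (hK : g K = h K) :
    g = h := by
  refine RingQuot.ringQuot_ext' ℂ g h (FreeAlgebra.hom_ext (funext fun x => ?_))
  cases x
  · exact hE
  · exact hF
  · exact hK

end Lift

/-- A property stable under the algebra operations holds everywhere once it holds for the
generators. -/
lemma induction {P : Q → Prop} (hE : P E) (hF : P F) (hK : P K)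
    (halg : ∀ c : ℂ, P (algebraMap ℂ Q c)) (hadd : ∀ a b, P a → P b → P (a + b))
    (hmul : ∀ a b, P a → P b → P (a * b)) (a : Q) : P a := by
  obtain ⟨x, rfl⟩ := RingQuot.mkAlgHom_surjective ℂ Rel a
  induction x using FreeAlgebra.induction with
  | grade0 c => exact (AlgHom.commutes proj c) ▸ halg c
  | grade1 g =>
    cases g
    · exact hE
    · exact hF
    · exact hK
  | mul a b ha hb => exact (map_mul proj a b) ▸ hmul _ _ ha hb
  | add a b ha hb => exact (map_add proj a b) ▸ hadd _ _ ha hb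

lemma K3E : K ^ 3 * E = -(E * K ^ 3) := by
  simp only [pow_succ, pow_zero, one_mul, mul_assoc, KE, mul_neg]
  simp only [← mul_assoc, KE, mul_neg, neg_mul, neg_neg]

lemma K3F : K ^ 3 * F = -(F * K ^ 3) := by
  simp only [pow_succ, pow_zero, one_mul, mul_assoc, KF, mul_neg]
  simp only [← mul_assoc, KF, mul_neg, neg_mul, neg_neg]

lemma K_mul_K3 : K * K ^ 3 = 1 := by rw [← pow_succ', KK]

lemma K3_mul_K : K ^ 3 * K = 1 := by rw [← pow_succ, KK]

open Algebra.TensorProduct in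
/-- The comultiplication: `Δ(E) = 1 ⊗ E + E ⊗ K`, `Δ(F) = K⁻¹ ⊗ F + F ⊗ 1`, `Δ(K) = K ⊗ K`. -/
def comul : Q →ₐ[ℂ] Q ⊗[ℂ] Q :=
  lift (1 ⊗ₜ E + E ⊗ₜ K) ((K ^ 3) ⊗ₜ F + F ⊗ₜ 1) (K ⊗ₜ K)
    (by simp only [mul_add, add_mul, tmul_mul_tmul, mul_one, one_mul, KE, neg_add,
          TensorProduct.tmul_neg, TensorProduct.neg_tmul])
    (by simp only [mul_add, add_mul, tmul_mul_tmul, mul_one, one_mul, KF, neg_add,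
          TensorProduct.tmul_neg, TensorProduct.neg_tmul, ← pow_succ, ← pow_succ'])
    (by
      have e1 : E * F = F * E + (Complex.I - Complex.I⁻¹)⁻¹ • (K - K ^ 3) := by
        rw [← EF]; abel
      simp only [mul_add, add_mul, tmul_mul_tmul, mul_one, one_mul, K3E, KF, e1,
        TensorProduct.tmul_neg, TensorProduct.neg_tmul, TensorProduct.tmul_add,
        TensorProduct.add_tmul, TensorProduct.tmul_smul, TensorProduct.smul_tmul',
        TensorProduct.tmul_sub, TensorProduct.sub_tmul, smul_sub, tmul_pow]
      abel)
    (by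
      simp only [pow_two, mul_add, add_mul, tmul_mul_tmul, mul_one, one_mul, KE,
        TensorProduct.tmul_neg]
      simp only [← pow_two, EE, TensorProduct.tmul_zero, TensorProduct.zero_tmul]
      abel)
    (by
      simp only [pow_two, mul_add, add_mul, tmul_mul_tmul, mul_one, one_mul, K3F,
        TensorProduct.neg_tmul]
      simp only [← pow_two, FF, TensorProduct.tmul_zero, TensorProduct.zero_tmul]
      abel)
    (by rw [tmul_pow, KK, one_def])

/-- The counit: `ε(E) = ε(F) = 0`, `ε(K) = 1`. -/
def counit : Q →ₐ[ℂ] ℂ :=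
  lift 0 0 1 (by simp) (by simp) (by simp) (by simp) (by simp) (by simp)

open MulOpposite in
/-- The antipode as an algebra homomorphism to the opposite algebra:
`S(E) = - E K⁻¹`, `S(F) = - K F`, `S(K) = K⁻¹`. -/
def antipodeHom : Q →ₐ[ℂ] Qᵐᵒᵖ :=
  lift (op (-(E * K ^ 3))) (op (-(K * F))) (op (K ^ 3))
    (by
      rw [← MulOpposite.op_mul, ← MulOpposite.op_mul, ← MulOpposite.op_neg]
      congr 1
      rw [mul_neg, ← mul_assoc, K3E, neg_mul, neg_neg])
    (by
      rw [← MulOpposite.op_mul, ← MulOpposite.op_mul, ← MulOpposite.op_neg]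
      congr 1
      rw [mul_neg, ← mul_assoc (K ^ 3), K3_mul_K, one_mul, neg_neg, neg_mul, mul_assoc,
        ← neg_eq_iff_eq_neg.2 K3F, mul_neg, ← mul_assoc, K_mul_K3, neg_neg, one_mul])
    (by
      rw [← MulOpposite.op_mul, ← MulOpposite.op_mul, ← MulOpposite.op_sub, ← MulOpposite.op_pow, ← MulOpposite.op_sub, ← MulOpposite.op_smul]
      congr 1
      have h1 : -(K * F) * -(E * K ^ 3) = F * E := by
        rw [neg_mul_neg, mul_assoc, ← mul_assoc F, mul_assoc, ← neg_eq_iff_eq_neg.2 K3E]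
        rw [mul_neg, mul_neg, ← mul_assoc F, ← neg_eq_iff_eq_neg.2 K3F, neg_mul, mul_neg, neg_neg,
          ← mul_assoc, ← mul_assoc, K_mul_K3, one_mul]
      have h2 : -(E * K ^ 3) * -(K * F) = E * F := by
        rw [neg_mul_neg, mul_assoc, ← mul_assoc (K ^ 3), K3_mul_K, one_mul]
      have h3 : (K ^ 3) ^ 3 = K := by
        rw [← pow_mul, show 3 * 3 = 4 + 4 + 1 from rfl, pow_add, pow_add, KK]
        simp
      rw [h1, h2, h3, ← neg_sub (E * F), EF, ← smul_neg, neg_sub])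
    (by
      rw [← MulOpposite.op_pow, neg_sq, pow_two, mul_assoc, ← mul_assoc (K ^ 3), K3E, neg_mul, mul_neg,
        ← mul_assoc, ← mul_assoc, ← pow_two, EE]
      simp)
    (by
      rw [← MulOpposite.op_pow, neg_sq, pow_two, KF, neg_mul_neg, mul_assoc, ← mul_assoc K, KF, neg_mul,
        mul_neg, ← mul_assoc, ← mul_assoc, ← pow_two, FF]
      simp)
    (by rw [← MulOpposite.op_pow, ← pow_mul, mul_comm 3 4, pow_mul, KK, one_pow, MulOpposite.op_one])

@[simp] lemma comul_E : comul E = 1 ⊗ₜ E + E ⊗ₜ K := lift_E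
@[simp] lemma comul_F : comul F = (K ^ 3) ⊗ₜ F + F ⊗ₜ 1 := lift_F
@[simp] lemma comul_K : comul K = K ⊗ₜ K := lift_K
@[simp] lemma counit_E : counit E = 0 := lift_E
@[simp] lemma counit_F : counit F = 0 := lift_F
@[simp] lemma counit_K : counit K = 1 := lift_K

instance : Bialgebra ℂ Q := Bialgebra.ofAlgHom comul counit
  (by
    apply algHom_ext
    · simp [TensorProduct.tmul_add, TensorProduct.add_tmul, Algebra.TensorProduct.one_def]
      try abel
    · simp [TensorProduct.tmul_add, TensorProduct.add_tmul, Algebra.TensorProduct.one_def]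
      try abel
    · simp)
  (by apply algHom_ext <;> simp)
  (by apply algHom_ext <;> simp)

/-- The antipode as a linear map. -/
def antipodeMap : Q →ₗ[ℂ] Q :=
  (MulOpposite.opLinearEquiv ℂ).symm.toLinearMap ∘ₗ antipodeHom.toLinearMap

lemma antipodeMap_mul (a b : Q) : antipodeMap (a * b) = antipodeMap b * antipodeMap a := by
  simp [antipodeMap]

@[simp] lemma antipodeMap_E : antipodeMap E = -(E * K ^ 3) := by simp [antipodeMap, antipodeHom]
@[simp] lemma antipodeMap_F : antipodeMap F = -(K * F) := by simp [antipodeMap, antipodeHom]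
@[simp] lemma antipodeMap_K : antipodeMap K = K ^ 3 := by simp [antipodeMap, antipodeHom]
@[simp] lemma antipodeMap_one : antipodeMap 1 = 1 := by simp [antipodeMap]
@[simp] lemma antipodeMap_K3 : antipodeMap (K ^ 3) = K := by
  have h : antipodeMap (K ^ 3) * K ^ 3 = 1 := by
    have := antipodeMap_mul K (K ^ 3)
    rw [K_mul_K3, antipodeMap_one, antipodeMap_K] at this
    exact this.symm
  calc antipodeMap (K ^ 3) = antipodeMap (K ^ 3) * (K ^ 3 * K) := by rw [K3_mul_K, mul_one]
    _ = K := by rw [← mul_assoc, h, one_mul]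

lemma antipode_left (a : Q) (t : Q ⊗[ℂ] Q) :
    LinearMap.mul' ℂ Q (antipodeMap.rTensor Q (comul a * t)) =
      counit a • LinearMap.mul' ℂ Q (antipodeMap.rTensor Q t) := by
  induction a using induction generalizing t with
  | hE =>
    induction t with
    | zero => simp
    | add p q hp hq => simp only [mul_add, map_add, smul_add, hp, hq]
    | tmul x y =>
      simp only [comul_E, add_mul, Algebra.TensorProduct.tmul_mul_tmul, map_add,
        LinearMap.rTensor_tmul, LinearMap.mul'_apply, one_mul, antipodeMap_mul, antipodeMap_E,
        counit_E, zero_smul]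
      have : -(E * K ^ 3) * (K * y) = -(E * y) := by
        rw [neg_mul, mul_assoc, ← mul_assoc (K ^ 3), K3_mul_K, one_mul]
      rw [mul_assoc, this, mul_neg, add_neg_cancel]
  | hF =>
    induction t with
    | zero => simp
    | add p q hp hq => simp only [mul_add, map_add, smul_add, hp, hq]
    | tmul x y =>
      simp only [comul_F, add_mul, Algebra.TensorProduct.tmul_mul_tmul, map_add,
        LinearMap.rTensor_tmul, LinearMap.mul'_apply, one_mul, antipodeMap_mul, antipodeMap_F,
        antipodeMap_K3, counit_F, zero_smul]
      simp only [mul_assoc, mul_neg, neg_mul, add_neg_cancel]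
  | hK =>
    induction t with
    | zero => simp
    | add p q hp hq => simp only [mul_add, map_add, smul_add, hp, hq]
    | tmul x y =>
      simp only [comul_K, Algebra.TensorProduct.tmul_mul_tmul,
        LinearMap.rTensor_tmul, LinearMap.mul'_apply, antipodeMap_mul, antipodeMap_K,
        counit_K, one_smul]
      rw [mul_assoc, ← mul_assoc (K ^ 3), K3_mul_K, one_mul]
  | halg c => simp [Algebra.algebraMap_eq_smul_one]
  | hadd a b ha hb => simp only [map_add, add_mul, ha, hb, add_smul]
  | hmul a b ha hb => rw [map_mul comul, mul_assoc, ha, hb, map_mul counit, mul_smul]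

lemma antipode_right (a : Q) (t : Q ⊗[ℂ] Q) :
    LinearMap.mul' ℂ Q (antipodeMap.lTensor Q (t * comul a)) =
      counit a • LinearMap.mul' ℂ Q (antipodeMap.lTensor Q t) := by
  induction a using induction generalizing t with
  | hE =>
    induction t with
    | zero => simp
    | add p q hp hq => simp only [add_mul, map_add, smul_add, hp, hq]
    | tmul x y =>
      simp only [comul_E, mul_add, Algebra.TensorProduct.tmul_mul_tmul, map_add,
        LinearMap.lTensor_tmul, LinearMap.mul'_apply, mul_one, antipodeMap_mul, antipodeMap_E,
        antipodeMap_K, counit_E, zero_smul]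
      simp only [mul_assoc, mul_neg, neg_mul, neg_add_cancel]
  | hF =>
    induction t with
    | zero => simp
    | add p q hp hq => simp only [add_mul, map_add, smul_add, hp, hq]
    | tmul x y =>
      simp only [comul_F, mul_add, Algebra.TensorProduct.tmul_mul_tmul, map_add,
        LinearMap.lTensor_tmul, LinearMap.mul'_apply, mul_one, antipodeMap_mul, antipodeMap_F,
        counit_F, zero_smul]
      have : K ^ 3 * (-(K * F) * antipodeMap y) = -(F * antipodeMap y) := by
        rw [neg_mul, mul_neg, mul_assoc, ← mul_assoc (K ^ 3), K3_mul_K, one_mul]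
      rw [mul_assoc, this, mul_neg, ← mul_assoc, neg_add_cancel]
  | hK =>
    induction t with
    | zero => simp
    | add p q hp hq => simp only [add_mul, map_add, smul_add, hp, hq]
    | tmul x y =>
      simp only [comul_K, Algebra.TensorProduct.tmul_mul_tmul,
        LinearMap.lTensor_tmul, LinearMap.mul'_apply, antipodeMap_mul, antipodeMap_K,
        counit_K, one_smul]
      rw [mul_assoc, ← mul_assoc K, K_mul_K3, one_mul]
  | halg c => simp [Algebra.algebraMap_eq_smul_one]
  | hadd a b ha hb => simp only [map_add, mul_add, ha, hb, add_smul]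
  | hmul a b ha hb => rw [map_mul comul, ← mul_assoc, hb, ha, map_mul counit, mul_comm, mul_smul]

/-- The Hopf algebra structure of `Q`. -/
instance : HopfAlgebra ℂ Q where
  antipode := antipodeMap
  mul_antipode_rTensor_comul := by
    ext a
    have h := antipode_left a 1
    rw [mul_one] at h
    refine h.trans ?_
    simp [Algebra.TensorProduct.one_def, Algebra.algebraMap_eq_smul_one]
    rfl
  mul_antipode_lTensor_comul := by
    ext a
    have h := antipode_right a 1
    rw [one_mul] at h
    refine h.trans ?_
    simp [Algebra.TensorProduct.one_def, Algebra.algebraMap_eq_smul_one]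
    rfl

/-- The central idempotent `e₀ = (1 + K²) / 2`. -/
def e0 : Q := (1 / 2 : ℂ) • (1 + K ^ 2)

/-- The central idempotent `e₁ = (1 - K²) / 2`. -/
def e1 : Q := (1 / 2 : ℂ) • (1 - K ^ 2)

section Coassociator

open Complex (I)

/-- The component `Φ⁰¹⁰`. -/
def Φ010 : Q ⊗[ℂ] (Q ⊗[ℂ] Q) :=
  1 ⊗ₜ (1 ⊗ₜ 1) - (1 + I) • E ⊗ₜ (K ⊗ₜ F) + (1 - I) • (F * K) ⊗ₜ (K ⊗ₜ (E * K))
    + (2 : ℂ) • (E * F * K) ⊗ₜ (1 ⊗ₜ (E * F * K))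

/-- The component `Φ¹⁰¹`. -/
def Φ101 : Q ⊗[ℂ] (Q ⊗[ℂ] Q) :=
  (I - 1) • 1 ⊗ₜ (F ⊗ₜ (E * K)) + 1 ⊗ₜ (K ⊗ₜ 1) + (2 : ℂ) • 1 ⊗ₜ ((E * F) ⊗ₜ (E * F * K))
    - (1 + I) • 1 ⊗ₜ ((E * K) ⊗ₜ F) - (1 + I) • E ⊗ₜ ((F * K) ⊗ₜ 1)
    + (2 * I) • E ⊗ₜ ((E * F * K) ⊗ₜ F) + (1 - I) • (F * K) ⊗ₜ (E ⊗ₜ 1)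
    - (2 * I) • (F * K) ⊗ₜ ((E * F * K) ⊗ₜ (E * K)) - (2 : ℂ) • (E * F * K) ⊗ₜ ((E * F) ⊗ₜ 1)

/-- The component `Φ¹¹¹`, which depends on `β`. -/
def Φ111 (β : ℂ) : Q ⊗[ℂ] (Q ⊗[ℂ] Q) :=
  (I * β ^ 2) • ((1 + I) • 1 ⊗ₜ (F ⊗ₜ (E * K)) - 1 ⊗ₜ (K ⊗ₜ 1)
    - (2 : ℂ) • 1 ⊗ₜ ((E * F) ⊗ₜ 1) - (2 * I) • 1 ⊗ₜ ((E * F) ⊗ₜ (E * F * K))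
    + (1 + I) • 1 ⊗ₜ ((E * K) ⊗ₜ F) - (1 + I) • E ⊗ₜ (1 ⊗ₜ F)
    + (1 + I) • E ⊗ₜ ((F * K) ⊗ₜ 1) + (2 * I) • E ⊗ₜ ((F * K) ⊗ₜ (E * F * K))
    + (2 : ℂ) • E ⊗ₜ ((E * F * K) ⊗ₜ F) - (1 + I) • (F * K) ⊗ₜ (1 ⊗ₜ (E * K))
    + (1 + I) • (F * K) ⊗ₜ (E ⊗ₜ 1) + (2 * I) • (F * K) ⊗ₜ (E ⊗ₜ (E * F * K))
    + (2 : ℂ) • (F * K) ⊗ₜ ((E * F * K) ⊗ₜ (E * K)) + (2 * I) • (E * F * K) ⊗ₜ (F ⊗ₜ (E * K))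
    + (2 * I) • (E * F * K) ⊗ₜ (K ⊗ₜ (E * F * K)) - (2 * I) • (E * F * K) ⊗ₜ ((E * F) ⊗ₜ 1)
    + (2 * I) • (E * F * K) ⊗ₜ ((E * K) ⊗ₜ F) + (4 : ℂ) • (E * F * K) ⊗ₜ ((E * F) ⊗ₜ (E * F * K)))

/-- The coassociator `Φ ∈ Q ⊗ Q ⊗ Q`, depending on a parameter `β` (with `β⁴ = -1`). -/
def Φ (β : ℂ) : Q ⊗[ℂ] (Q ⊗[ℂ] Q) :=
  e0 ⊗ₜ (e0 ⊗ₜ e0)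
    + e1 ⊗ₜ (e0 ⊗ₜ e0) + Φ010 * e0 ⊗ₜ (e1 ⊗ₜ e0) + e0 ⊗ₜ (e0 ⊗ₜ e1)
    + e1 ⊗ₜ (e1 ⊗ₜ e0) + Φ101 * e1 ⊗ₜ (e0 ⊗ₜ e1) + e0 ⊗ₜ (e1 ⊗ₜ e1)
    + Φ111 β * e1 ⊗ₜ (e1 ⊗ₜ e1)

end Coassociator

end Q

end QHopf

end

/-! The last assertion implies the three before it. If the class of Φ is trivial, then Φ is the
coboundary of an invariant cochain, so (Q, Φ) is a Drinfeld twist of Q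
(`isTwistEquivalent_of_H3_eq`). If (Q, Φ) is isomorphic to a twist of Q by F, restriction along the
isomorphism is a monoidal equivalence whose tensorator is the action of F
(`IsTwistEquivalent.monoidallyEquivalent`). The identity functor is an equivalence, so a monoidal
structure on it is also excluded.

That Φ is a coassociator is a finite computation. Since (iβ²)² = -β⁴ = 1, the parameter enters only
through the sign iβ² = ±1. In the monomials e_s E^a Y^b K^c with Y = FK, all structure constants and
all coefficients of Φ are Gaussian integers. Tensor powers of Q are modelled by nested lists of
coefficients, the operations on them are shown to be sound (`Node.interprets_eval`), and the kernel
evaluates the identities for both signs (`isCoassociator_Φ`).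

Inequivalence comes from an invariant formulated only in terms of the monoidal structure. A
`Crossing` consists of p : M → 1 and an object T such that M ⊗ T → T and T ⊗ M → T each have exactly
one section. Inserting M on both sides of T in the two possible orders gives two maps T → M ⊗ (T ⊗
M), and one asks whether they agree. Monoidal equivalences preserve crossings and reflect this
commutation.

For representations, the absence of maps from self-inverse objects to T forces T into the block e₁,
where EY + YE = i. If T is nonzero, uniqueness of sections yields m in M with Km = m, p(m) = 1 and
EYm = 0, and then the sections are given by explicit formulas. With trivial associativity the two
composites differ by -i(Em ⊗ Kt ⊗ Ym + Ym ⊗ Kt ⊗ Em). The component Φ⁰¹⁰ contributes -(1+i) Em ⊗ Kt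
⊗ Ym + (1-i) Ym ⊗ Kt ⊗ Em. Comparability of maps into M makes Em and Ym multiples of one vector, and
then both corrections are the same, because -(1+i) + (1-i) = -2i. Hence every crossing commutes over
(Q, Φ) (`Crossing.commutes`). Over Q itself, the crossing of two explicit two-dimensional
representations does not commute (`not_commutes_standardCrossing`). -/

noncomputable section

namespace QHopf

/-! ### Coefficients for computations in tensor powers -/

/-- Gaussian integers, with operations that the kernel evaluates quickly. -/
structure GInt : Type where
  re : ℤ
  im : ℤ

namespace GInt

/-- The complex number given by a Gaussian integer. -/
def toComplex (z : GInt) : ℂ := z.re + z.im * Complex.I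

/-- The sum. -/
def add : GInt → GInt → GInt
  | ⟨a, b⟩, ⟨c, d⟩ => ⟨Int.add a c, Int.add b d⟩

/-- The product. -/
def mul : GInt → GInt → GInt
  | ⟨a, b⟩, ⟨c, d⟩ =>
    ⟨Int.add (Int.mul a c) (Int.neg (Int.mul b d)), Int.add (Int.mul a d) (Int.mul b c)⟩

/-- The fourth root of unity `± 1` or `± I`. -/
def unit (s t : Bool) : GInt :=
  match s, t with
  | false, false => ⟨1, 0⟩
  | false, true => ⟨0, 1⟩
  | true, false => ⟨-1, 0⟩
  | true, true => ⟨0, -1⟩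

/-- The product with a fourth root of unity. -/
def unitMul (s t : Bool) (z : GInt) : GInt :=
  match s, t, z with
  | false, false, z => z
  | false, true, ⟨a, b⟩ => ⟨Int.neg b, a⟩
  | true, false, ⟨a, b⟩ => ⟨Int.neg a, Int.neg b⟩
  | true, true, ⟨a, b⟩ => ⟨b, Int.neg a⟩

/-- Equality with zero. -/
def isZero : GInt → Bool
  | ⟨Int.ofNat a, Int.ofNat b⟩ => Nat.beq a 0 && Nat.beq b 0
  | _ => false

@[simp] lemma toComplex_add (z w : GInt) : (add z w).toComplex = z.toComplex + w.toComplex := by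
  change ((z.re + w.re : ℤ) : ℂ) + ((z.im + w.im : ℤ) : ℂ) * Complex.I = _
  simp only [toComplex]
  push_cast
  ring

@[simp] lemma toComplex_mul (z w : GInt) : (mul z w).toComplex = z.toComplex * w.toComplex := by
  change ((z.re * w.re + -(z.im * w.im) : ℤ) : ℂ) +
    ((z.re * w.im + z.im * w.re : ℤ) : ℂ) * Complex.I = _
  simp only [toComplex]
  push_cast
  linear_combination (-(z.im * w.im) : ℂ) * Complex.I_mul_I

@[simp] lemma toComplex_unitMul (s t : Bool) (z : GInt) :
    (unitMul s t z).toComplex = (unit s t).toComplex * z.toComplex := by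
  obtain ⟨a, b⟩ := z
  have hn : ∀ n : ℤ, ((Int.neg n : ℤ) : ℂ) = -n := fun n => Int.cast_neg n
  rcases s <;> rcases t <;> simp only [unitMul, unit, toComplex, hn] <;> push_cast
  · ring
  · linear_combination (-b : ℂ) * Complex.I_mul_I
  · ring
  · linear_combination (b : ℂ) * Complex.I_mul_I

lemma toComplex_eq_zero {z : GInt} (h : z.isZero = true) : z.toComplex = 0 := by
  obtain ⟨a | a, b | b⟩ := z <;> simp_all [isZero, toComplex]

end GInt

/-- The operations on coefficients: scaled addition and fused multiplication. -/
class CoeffOps (R : Type) where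
  zero : R
  isZero : R → Bool
  /-- remove zero coefficients -/
  prune : R → R
  /-- `addScaled c p a = c p + a` -/
  addScaled : GInt → R → R → R
  /-- `mulAdd s t p q a = u p q + a` for the fourth root of unity `u = GInt.unit s t` -/
  mulAdd : Bool → Bool → R → R → R → R

instance : CoeffOps GInt where
  zero := ⟨0, 0⟩
  isZero := GInt.isZero
  prune z := z
  addScaled c p a := GInt.add (GInt.mul c p) a
  mulAdd s t p q a := GInt.add (GInt.unitMul s t (GInt.mul p q)) a

/-- `ev` interprets coefficients in an algebra. -/
structure Interprets {R B : Type} [CoeffOps R] [Ring B] [Algebra ℂ B] (ev : R → B) : Prop where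
  zero : ev CoeffOps.zero = 0
  isZero : ∀ r, CoeffOps.isZero r = true → ev r = 0
  prune : ∀ r, ev (CoeffOps.prune r) = ev r
  addScaled : ∀ c p a, ev (CoeffOps.addScaled c p a) = c.toComplex • ev p + ev a
  mulAdd : ∀ s t p q a, ev (CoeffOps.mulAdd s t p q a) =
    (GInt.unit s t).toComplex • (ev p * ev q) + ev a

lemma interprets_toComplex : Interprets GInt.toComplex where
  zero := by simp [CoeffOps.zero, GInt.toComplex]
  isZero _ h := GInt.toComplex_eq_zero h
  prune _ := rfl
  addScaled c p a := by simp [CoeffOps.addScaled]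
  mulAdd s t p q a := by simp [CoeffOps.mulAdd]

end QHopf

namespace QHopf.Q

open Complex

/-! ### The monomial basis of `Q` -/

/-- The odd generator `Y = F K`, which together with `E` and `K` generates `Q`. -/
def Y : Q := F * K

lemma E_mul_E : E * E = 0 := by rw [← pow_two, EE]

lemma Y_mul_Y : Y * Y = 0 := by
  rw [Y, mul_assoc, ← mul_assoc K, KF, neg_mul, mul_neg, mul_assoc, ← mul_assoc F F, ← pow_two F,
    FF, zero_mul, neg_zero]

lemma K_mul_Y : K * Y = -(Y * K) := by
  rw [Y, ← mul_assoc, KF, neg_mul]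

lemma K_sq : K * K = e0 - e1 := by
  rw [e0, e1, ← smul_sub, ← pow_two, add_sub_sub_cancel, ← two_smul ℂ (K ^ 2), smul_smul]
  norm_num

lemma e0_add_e1 : e0 + e1 = 1 := by
  rw [e0, e1, ← smul_add, add_add_sub_cancel, ← two_smul ℂ (1 : Q), smul_smul]
  norm_num

lemma inv_I_sub : (I - I⁻¹)⁻¹ = -(1 / 2) * I := by
  rw [inv_I, sub_neg_eq_add, ← two_mul, mul_inv, inv_I]
  ring

/-- Multiplying [E, F] by K turns K - K³ into K² - 1 = -2e₁. Together with E² = Y² = 0 this makes E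
and Y anticommute on the block e₀, while on e₁ they satisfy Clifford relations. This contrast drives
the whole argument. -/
lemma Y_mul_E : Y * E = I • e1 - E * Y := by
  have h : E * F - F * E = (-(1 / 2) * I) • (K - K ^ 3) := by rw [EF, inv_I_sub]
  have h2 : Y * E = -(F * E * K) := by rw [Y, mul_assoc, KE, mul_neg, mul_assoc]
  have h3 := congrArg (· * K) h
  simp only [sub_mul, smul_mul_assoc, ← pow_succ, ← pow_two] at h3
  rw [show 3 + 1 = 4 from rfl, KK] at h3
  have h4 : F * E * K = E * F * K - (-(1 / 2) * I) • (K ^ 2 - 1) := by rw [← h3]; abel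
  rw [h2, h4, Y, e1, mul_assoc, smul_smul, neg_mul, neg_smul, ← neg_sub 1 (K ^ 2), smul_neg,
    mul_comm I]
  abel

lemma E_mul_K_sq : E * K ^ 2 = K ^ 2 * E := by
  rw [pow_two, mul_assoc K, KE, mul_neg, ← mul_assoc K, KE, neg_mul, neg_neg, mul_assoc]

lemma Y_mul_K_sq : Y * K ^ 2 = K ^ 2 * Y := by
  rw [pow_two, mul_assoc K, K_mul_Y, mul_neg, ← mul_assoc K, K_mul_Y, neg_mul, neg_neg, mul_assoc]

lemma E_mul_e0 : E * e0 = e0 * E := by simp [e0, mul_add, add_mul, E_mul_K_sq]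
lemma E_mul_e1 : E * e1 = e1 * E := by simp [e1, mul_sub, sub_mul, E_mul_K_sq]
lemma Y_mul_e0 : Y * e0 = e0 * Y := by simp [e0, mul_add, add_mul, Y_mul_K_sq]
lemma Y_mul_e1 : Y * e1 = e1 * Y := by simp [e1, mul_sub, sub_mul, Y_mul_K_sq]
lemma K_mul_e0 : K * e0 = e0 * K := by simp [e0, mul_add, add_mul, ← pow_succ, ← pow_succ']
lemma K_mul_e1 : K * e1 = e1 * K := by simp [e1, mul_sub, sub_mul, ← pow_succ, ← pow_succ']

lemma K_sq_mul_K_sq : K ^ 2 * K ^ 2 = 1 := by rw [← pow_add, KK]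

lemma e0_mul_e0 : e0 * e0 = e0 := by
  simp only [e0, mul_add, add_mul, smul_mul_smul_comm, mul_one, one_mul, K_sq_mul_K_sq]
  module

lemma e0_mul_e1 : e0 * e1 = 0 := by
  simp only [e0, e1, mul_sub, add_mul, smul_mul_smul_comm, mul_one, one_mul, K_sq_mul_K_sq]
  module

lemma e1_mul_e0 : e1 * e0 = 0 := by
  simp only [e0, e1, mul_add, sub_mul, smul_mul_smul_comm, mul_one, one_mul, K_sq_mul_K_sq]
  module

lemma e1_mul_e1 : e1 * e1 = e1 := by
  simp only [e1, mul_sub, sub_mul, smul_mul_smul_comm, mul_one, one_mul, K_sq_mul_K_sq]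
  module

/-- The monomial `e_s E^a Y^b K^c`. -/
structure Mon : Type where
  s : Bool
  a : Bool
  b : Bool
  c : Bool

namespace Mon

/-- The element of `Q` given by a monomial. -/
def ev (m : Mon) : Q :=
  (bif m.s then e1 else e0) * ((bif m.a then E else 1) * ((bif m.b then Y else 1) *
    (bif m.c then K else 1)))

/-- Equality of truth values, as a test that continues with `t` on success. -/
def test (a b t : Bool) : Bool :=
  Bool.rec (Bool.rec t false b) (Bool.rec false t b) a

/-- Equality of monomials. -/
def beq (m n : Mon) : Bool :=
  test m.s n.s (test m.a n.a (test m.b n.b (test m.c n.c true)))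

lemma eq_of_beq {m n : Mon} (h : beq m n = true) : m = n := by
  obtain ⟨s, a, b, c⟩ := m
  obtain ⟨s', a', b', c'⟩ := n
  revert h
  cases s <;> cases s' <;> cases a <;> cases a' <;> cases b <;> cases b' <;> cases c <;>
    cases c' <;> simp [beq, test]

lemma assoc_rule {a b c : Q} (h : a * b = c) (z : Q) : a * (b * z) = c * z := by
  rw [← mul_assoc, h]

/-- Addition of truth values. -/
def xor (a b : Bool) : Bool := Bool.rec b (Bool.rec true false b) a

lemma xor_eq (a b : Bool) : xor a b = (a ^^ b) := by cases a <;> cases b <;> rfl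

/-- The sign that arises from normal ordering a product. -/
def mulSign (m n : Mon) : Bool :=
  Bool.rec false (xor (xor n.a n.b) (Bool.rec false m.s n.c)) m.c

-- Normal ordering: moving K past E or Y costs a sign, and K² is 1 on e₀ and -1 on e₁; `mulSign`
-- collects both. The only product with two terms comes from YE = i e₁ - EY, whose first term
-- survives only on e₁ and whose second dies as soon as another E stands on the left or another Y on
-- the right.
set_option maxHeartbeats 1000000 in
lemma ev_mul (m n : Mon) : m.ev * n.ev =
    bif m.s ^^ n.s then 0 else
    bif m.b && n.a then
      (bif m.s then (GInt.unit (mulSign m n) true).toComplex •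
        ev ⟨m.s, m.a, n.b, m.c ^^ n.c⟩ else 0) +
      (bif m.a || n.b then 0 else (GInt.unit (!mulSign m n) false).toComplex •
        ev ⟨m.s, true, true, m.c ^^ n.c⟩)
    else bif (m.a && n.a) || (m.b && n.b) then 0 else
      (GInt.unit (mulSign m n) false).toComplex •
        ev ⟨m.s, m.a || n.a, m.b || n.b, m.c ^^ n.c⟩ := by
  obtain ⟨s, a, b, c⟩ := m
  obtain ⟨s', a', b', c'⟩ := n
  cases s <;> cases s' <;> cases a <;> cases b <;> cases c <;> cases a' <;> cases b' <;>
    cases c' <;>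
  simp [ev, mulSign, xor_eq, GInt.unit, GInt.toComplex, mul_assoc,
      E_mul_E, Y_mul_Y, KE, K_mul_Y, K_sq, Y_mul_E, E_mul_e0, E_mul_e1, Y_mul_e0, Y_mul_e1,
      K_mul_e0, K_mul_e1, e0_mul_e0, e0_mul_e1, e1_mul_e0, e1_mul_e1,
      assoc_rule E_mul_E, assoc_rule Y_mul_Y, assoc_rule KE, assoc_rule K_mul_Y,
      assoc_rule Y_mul_E, assoc_rule E_mul_e0, assoc_rule E_mul_e1,
      assoc_rule Y_mul_e0, assoc_rule Y_mul_e1, assoc_rule K_mul_e0, assoc_rule K_mul_e1,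
      assoc_rule e0_mul_e0, assoc_rule e0_mul_e1, assoc_rule e1_mul_e0, assoc_rule e1_mul_e1,
      mul_sub, sub_mul] <;> abel

end Mon

/-! ### Tries -/

/-- Evaluate a truth value before passing it on. -/
def force {α : Type} (b : Bool) (f : Bool → α) : α := Bool.rec (f false) (f true) b

@[simp] lemma force_eq {α : Type} (b : Bool) (f : Bool → α) : force b f = f b := by
  cases b <;> rfl

/-- `cond` in terms of the recursor. -/
def ite {α : Type} (b : Bool) (x y : α) : α := Bool.rec y x b

lemma ite_eq {α : Type} (b : Bool) (x y : α) : ite b x y = bif b then x else y := by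
  cases b <;> rfl

/-- Left fold over a list. -/
def fold {α β : Type} (f : α → β → β) (p : List α) : β → β :=
  List.rec (motive := fun _ => β → β) (fun acc => acc) (fun x _ ih acc => ih (f x acc)) p

@[simp] lemma fold_nil {α β : Type} (f : α → β → β) (acc : β) : fold f [] acc = acc := rfl

lemma fold_cons {α β : Type} (f : α → β → β) (x : α) (p : List α) (acc : β) :
    fold f (x :: p) acc = fold f p (f x acc) := rfl

/-- Linear combinations of monomials with coefficients in `R`. -/
abbrev Node (R : Type) : Type := List (Mon × R)

namespace Node

section Eval

variable {R : Type} {B B' : Type} [Ring B] [Algebra ℂ B] [Ring B'] [Algebra ℂ B']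

/-- The interpretation of a linear combination, given the one of the coefficients. -/
def eval (φ : Q →ₗ[ℂ] B →ₗ[ℂ] B') (ev : R → B) (p : Node R) : B' :=
  (p.map fun x => φ x.1.ev (ev x.2)).sum

variable {φ : Q →ₗ[ℂ] B →ₗ[ℂ] B'} {ev : R → B}

@[simp] lemma eval_nil : eval φ ev [] = 0 := rfl

@[simp] lemma eval_cons (x : Mon × R) (p : Node R) :
    eval φ ev (x :: p) = φ x.1.ev (ev x.2) + eval φ ev p := by
  simp [eval]

end Eval

variable {R : Type} [CoeffOps R]

/-- Change the coefficient of a monomial. -/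
def update (k : Mon) (f : R → R) (p : Node R) : Node R :=
  List.rec (motive := fun _ => Node R) [(k, f CoeffOps.zero)]
    (fun x p ih => ite (Mon.beq k x.1) ((x.1, f x.2) :: p) (x :: ih)) p

lemma update_cons (k : Mon) (f : R → R) (x : Mon × R) (p : Node R) : update k f (x :: p) =
    ite (Mon.beq k x.1) ((x.1, f x.2) :: p) (x :: update k f p) := rfl

/-- The product of two monomials with coefficients, times a fourth root of unity. -/
def mulTerm (s t : Bool) (m n : Mon) (x y : R) (acc : Node R) : Node R :=
  ite (Mon.xor m.s n.s) acc <|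
    force (Mon.xor s (Mon.mulSign m n)) fun d => force (Mon.xor m.c n.c) fun c =>
    force m.s fun e => force m.a fun a => force n.b fun b =>
    ite (ite m.b n.a false)
      (ite (ite a true b)
        (ite e (update ⟨e, a, b, c⟩ (CoeffOps.mulAdd (Mon.xor d t) (!t) x y) acc) acc)
        (update ⟨e, true, true, c⟩ (CoeffOps.mulAdd (!d) t x y)
          (ite e (update ⟨e, a, b, c⟩ (CoeffOps.mulAdd (Mon.xor d t) (!t) x y) acc) acc)))
      (ite (ite a n.a false) acc <| ite (ite m.b b false) acc <|
      force (ite a true n.a) fun a => force (ite m.b true b) fun b =>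
      update ⟨e, a, b, c⟩ (CoeffOps.mulAdd d t x y) acc)

/-- Remove zero coefficients. -/
def prune : Node R → Node R
  | [] => []
  | (m, r) :: p => bif CoeffOps.isZero r then prune p else (m, CoeffOps.prune r) :: prune p

instance : CoeffOps (Node R) where
  prune := prune
  zero := []
  isZero p := p.all fun x => CoeffOps.isZero x.2
  addScaled c p acc := fold (fun x acc => update x.1 (CoeffOps.addScaled c x.2) acc) p acc
  mulAdd s t p q acc :=
    fold (fun x acc => fold (fun y acc => mulTerm s t x.1 y.1 x.2 y.2 acc) q acc) p acc

variable {B B' : Type} [Ring B] [Algebra ℂ B] [Ring B'] [Algebra ℂ B']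
  {φ : Q →ₗ[ℂ] B →ₗ[ℂ] B'} {ev : R → B}

lemma eval_update (h : Interprets ev) (k : Mon) (f : R → R) (z : B)
    (hf : ∀ r, ev (f r) = z + ev r) (p : Node R) :
    eval φ ev (update k f p) = φ k.ev z + eval φ ev p := by
  induction p with
  | nil => simp [update, hf, h.zero]
  | cons x p ih =>
    rw [update_cons, ite_eq]
    rcases hk : Mon.beq k x.1
    · simp only [cond_false, eval_cons, ih]
      abel
    · simp only [cond_true, eval_cons, hf, map_add, Mon.eq_of_beq hk]
      abel

lemma unit_xor_left (s d t : Bool) : (GInt.unit (s ^^ d) t).toComplex =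
    (GInt.unit s t).toComplex * (GInt.unit d false).toComplex := by
  cases s <;> cases d <;> cases t <;> simp [GInt.unit, GInt.toComplex]

/-- A further factor i toggles the second bit; if that bit was already set, i · i = -1 is absorbed
by the sign bit. -/
lemma unit_mul_I (s d t : Bool) : (GInt.unit (s ^^ d ^^ t) (!t)).toComplex =
    (GInt.unit s t).toComplex * (GInt.unit d true).toComplex := by
  cases s <;> cases d <;> cases t <;> simp [GInt.unit, GInt.toComplex]

lemma eval_mulTerm (h : Interprets ev) (hφ : ∀ a b a' b', φ a b * φ a' b' = φ (a * a') (b * b'))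
    (s t : Bool) (m n : Mon) (x y : R) (acc : Node R) :
    eval φ ev (mulTerm s t m n x y acc) =
      (GInt.unit s t).toComplex • (φ m.ev (ev x) * φ n.ev (ev y)) + eval φ ev acc := by
  have hu : ∀ (k : Mon) (d t : Bool) (acc : Node R),
      eval φ ev (update k (CoeffOps.mulAdd d t x y) acc) =
      (GInt.unit d t).toComplex • φ k.ev (ev x * ev y) + eval φ ev acc := by
    intro k d t acc
    rw [eval_update h k _ _ (fun r => h.mulAdd d t x y r), map_smul]
  have hneg : ∀ d, (!(s ^^ d)) = (s ^^ !d) := by intro d; cases s <;> cases d <;> rfl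
  rw [hφ, Mon.ev_mul, mulTerm]
  simp only [force_eq, ite_eq, Mon.xor_eq]
  rcases m.s ^^ n.s
  swap
  · simp
  rcases hma : m.a <;> rcases hmb : m.b <;> rcases hna : n.a <;> rcases hnb : n.b <;>
    rcases m.s <;>
    simp only [cond_false, cond_true, hu, map_smul, LinearMap.smul_apply, smul_smul,
      hneg, unit_xor_left s _ t, unit_mul_I, map_add, LinearMap.add_apply, map_zero,
      LinearMap.zero_apply, smul_add, smul_zero, zero_add, add_zero, Bool.and_true,
      Bool.and_false, Bool.or_true, Bool.or_false]
  abel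

/-- The induction step for tensor powers: once the coefficients are interpreted soundly in B, linear
combinations of monomials over them are interpreted soundly in the target of any multiplicative
pairing φ. Starting from Gaussian integers, four applications reach the fourth tensor power. -/
lemma interprets_eval (h : Interprets ev)
    (hφ : ∀ a b a' b', φ a b * φ a' b' = φ (a * a') (b * b')) : Interprets (eval φ ev) where
  zero := rfl
  isZero p hp := by
    induction p with
    | nil => rfl
    | cons x p ih =>
      simp only [CoeffOps.isZero, List.all_cons, Bool.and_eq_true] at hp ih
      rw [eval_cons, h.isZero _ hp.1, map_zero, ih hp.2, add_zero]
  prune p := by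
    induction p with
    | nil => rfl
    | cons x p ih =>
      obtain ⟨m, r⟩ := x
      simp only [CoeffOps.prune] at ih ⊢
      rw [prune]
      rcases hr : CoeffOps.isZero r
      · rw [cond_false, eval_cons, eval_cons, ih, h.prune]
      · rw [cond_true, eval_cons, ih, h.isZero r hr, map_zero, zero_add]
  addScaled c p acc := by
    simp only [CoeffOps.addScaled]
    induction p generalizing acc with
    | nil => simp
    | cons x p ih =>
      rw [fold_cons, ih, eval_update h _ _ _ (fun r => h.addScaled c x.2 r), eval_cons,
        map_smul, smul_add]
      abel
  mulAdd s t p q acc := by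
    have hq : ∀ (x : Mon × R) (acc : Node R),
        eval φ ev (fold (fun y acc => mulTerm s t x.1 y.1 x.2 y.2 acc) q acc) =
        (GInt.unit s t).toComplex • (φ x.1.ev (ev x.2) * eval φ ev q) + eval φ ev acc := by
      intro x
      induction q with
      | nil => simp
      | cons y q ih =>
        intro acc
        rw [fold_cons, ih, eval_mulTerm h hφ, eval_cons, mul_add, smul_add]
        abel
    simp only [CoeffOps.mulAdd]
    induction p generalizing acc with
    | nil => simp
    | cons x p ih =>
      rw [fold_cons, ih, hq, eval_cons, add_mul, smul_add]
      abel

end Node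

/-- Elements of `Q` as linear combinations. -/
abbrev Comb1 : Type := Node GInt
/-- Elements of `Q ⊗ Q` as linear combinations. -/
abbrev Comb2 : Type := Node Comb1
/-- Elements of `Q ⊗ Q ⊗ Q` as linear combinations. -/
abbrev Comb3 : Type := Node Comb2
/-- Elements of `Q ⊗ Q ⊗ Q ⊗ Q` as linear combinations. -/
abbrev Comb4 : Type := Node Comb3

/-- The interpretation of `Comb1`. -/
def ev1 : Comb1 → Q := Node.eval (LinearMap.lsmul ℂ Q).flip GInt.toComplex
/-- The interpretation of `Comb2`. -/
def ev2 : Comb2 → Q ⊗[ℂ] Q := Node.eval (TensorProduct.mk ℂ Q Q) ev1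
/-- The interpretation of `Comb3`. -/
def ev3 : Comb3 → Q ⊗[ℂ] (Q ⊗[ℂ] Q) := Node.eval (TensorProduct.mk ℂ Q _) ev2
/-- The interpretation of `Comb4`. -/
def ev4 : Comb4 → Q ⊗[ℂ] (Q ⊗[ℂ] (Q ⊗[ℂ] Q)) := Node.eval (TensorProduct.mk ℂ Q _) ev3

lemma interprets_ev1 : Interprets ev1 := Node.interprets_eval interprets_toComplex <| by
  intros
  simp [smul_smul, mul_comm]
lemma interprets_ev2 : Interprets ev2 := Node.interprets_eval interprets_ev1 (by simp)
lemma interprets_ev3 : Interprets ev3 := Node.interprets_eval interprets_ev2 (by simp)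
lemma interprets_ev4 : Interprets ev4 := Node.interprets_eval interprets_ev3 (by simp)

end QHopf.Q

/-! ### Algebra operations, coproducts and leg maps on linear combinations -/

namespace QHopf.Q

open Complex

section MapCoeff

variable {R S : Type} {B C : Type} [Ring B] [Algebra ℂ B] [Ring C] [Algebra ℂ C] {ev : R → B}
  {ev' : S → C}

/-- Apply a map to all coefficients. -/
def mapCoeff (f : R → S) (p : Node R) : Node S := p.map fun x => (x.1, f x.2)

lemma eval_mapCoeff {f : R → S} (g : B →ₐ[ℂ] C) (h : ∀ r, ev' (f r) = g (ev r)) (p : Node R) :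
    Node.eval (TensorProduct.mk ℂ Q C) ev' (mapCoeff f p) =
      Algebra.TensorProduct.map (AlgHom.id ℂ Q) g (Node.eval (TensorProduct.mk ℂ Q B) ev p) := by
  induction p with
  | nil => simp [mapCoeff]
  | cons x p ih =>
    have : mapCoeff f (x :: p) = (x.1, f x.2) :: mapCoeff f p := rfl
    rw [this, Node.eval_cons, Node.eval_cons, ih, map_add, h]
    simp

end MapCoeff

section Linear

variable {R S : Type} [CoeffOps R] [CoeffOps S] {B C : Type} [Ring B] [Algebra ℂ B] [Ring C]
  [Algebra ℂ C] {ev : R → B} {ev' : S → C}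

/-- The product of two linear combinations. -/
def mul (p q : R) : R := CoeffOps.prune (CoeffOps.mulAdd false false p q CoeffOps.zero)

/-- The sum of two linear combinations. -/
def add (p q : R) : R := CoeffOps.addScaled ⟨1, 0⟩ p q

/-- A multiple of a linear combination. -/
def scale (c : GInt) (p : R) : R := CoeffOps.addScaled c p CoeffOps.zero

/-- Equality of linear combinations. -/
def beq (p q : R) : Bool := CoeffOps.isZero (CoeffOps.addScaled ⟨-1, 0⟩ q p)

lemma ev_mul (h : Interprets ev) (p q : R) : ev (mul p q) = ev p * ev q := by
  rw [mul, h.prune, h.mulAdd, h.zero]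
  simp [GInt.unit, GInt.toComplex]

lemma ev_add (h : Interprets ev) (p q : R) : ev (add p q) = ev p + ev q := by
  rw [add, h.addScaled]
  simp [GInt.toComplex]

lemma ev_scale (h : Interprets ev) (c : GInt) (p : R) : ev (scale c p) = c.toComplex • ev p := by
  rw [scale, h.addScaled, h.zero, add_zero]

/-- Only this direction is needed: a difference with all coefficients zero evaluates to zero. Linear
independence of the monomials plays no role. -/
lemma ev_eq_of_beq (h : Interprets ev) {p q : R} (hpq : beq p q = true) : ev p = ev q := by
  have h0 := h.isZero _ hpq
  rw [h.addScaled] at h0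
  simp only [GInt.toComplex, Int.cast_neg, Int.cast_one, Int.cast_zero, zero_mul, add_zero,
    neg_smul, one_smul] at h0
  exact (neg_add_eq_zero.1 h0).symm

/-- The linear extension of a map on monomials. -/
def bind (f : Mon → R → S → S) (p : Node R) : S :=
  p.foldl (fun acc x => f x.1 x.2 acc) CoeffOps.zero

/-- Soundness criterion for all linear maps defined monomial by monomial: it suffices that each step
adds the image of its term to the accumulator. -/
lemma ev_bind {B' : Type} [Ring B'] [Algebra ℂ B'] {φ : Q →ₗ[ℂ] B →ₗ[ℂ] B'} (h' : Interprets ev')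
    (f : Mon → R → S → S) (g : B' →ₗ[ℂ] C)
    (hf : ∀ m r acc, ev' (f m r acc) = g (φ m.ev (ev r)) + ev' acc) (p : Node R) :
    ev' (bind f p) = g (Node.eval φ ev p) := by
  have key : ∀ acc, ev' (p.foldl (fun acc x => f x.1 x.2 acc) acc) =
      g (Node.eval φ ev p) + ev' acc := by
    induction p with
    | nil => simp
    | cons x p ih =>
      intro acc
      rw [List.foldl_cons, ih, hf, Node.eval_cons, map_add]
      abel
  rw [bind, key, h'.zero, add_zero]

end Linear

/-! ### The comultiplication and the coassociator as linear combinations -/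

/-- The pure tensor of two linear combinations. -/
def tensor2 (p q : Comb1) : Comb2 := mapCoeff (fun c => scale c q) p

/-- The pure tensor of three linear combinations. -/
def tensor3 (p q r : Comb1) : Comb3 := mapCoeff (fun c => scale c (tensor2 q r)) p

lemma eval_scale {R B : Type} [CoeffOps R] [Ring B] [Algebra ℂ B] {ev : R → B}
    (h : Interprets ev) (p : Comb1) (r : R) :
    Node.eval (TensorProduct.mk ℂ Q B) ev (mapCoeff (fun c => scale c r) p) = ev1 p ⊗ₜ ev r := by
  induction p with
  | nil => simp [ev1, mapCoeff]
  | cons x p ih =>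
    have : mapCoeff (fun c => scale c r) (x :: p) =
      (x.1, scale x.2 r) :: mapCoeff (fun c => scale c r) p := rfl
    rw [this, Node.eval_cons, ih, ev_scale h, ev1, Node.eval_cons, TensorProduct.add_tmul]
    simp [TensorProduct.smul_tmul']

@[simp] lemma ev2_tensor2 (p q : Comb1) : ev2 (tensor2 p q) = ev1 p ⊗ₜ ev1 q :=
  eval_scale interprets_ev1 p q

@[simp] lemma ev3_tensor3 (p q r : Comb1) :
    ev3 (tensor3 p q r) = ev1 p ⊗ₜ (ev1 q ⊗ₜ ev1 r) := by
  rw [← ev2_tensor2]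
  exact eval_scale interprets_ev2 p _

/-- The idempotents as linear combinations. -/
def combIdem (s : Bool) : Comb1 := [(⟨s, false, false, false⟩, ⟨1, 0⟩)]

/-- `1` as a linear combination. -/
def combOne : Comb1 :=
  [(⟨false, false, false, false⟩, ⟨1, 0⟩), (⟨true, false, false, false⟩, ⟨1, 0⟩)]

/-- `E` as a linear combination. -/
def combE : Comb1 :=
  [(⟨false, true, false, false⟩, ⟨1, 0⟩), (⟨true, true, false, false⟩, ⟨1, 0⟩)]

/-- `Y` as a linear combination. -/
def combY : Comb1 :=
  [(⟨false, false, true, false⟩, ⟨1, 0⟩), (⟨true, false, true, false⟩, ⟨1, 0⟩)]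

/-- `K` as a linear combination. -/
def combK : Comb1 :=
  [(⟨false, false, false, true⟩, ⟨1, 0⟩), (⟨true, false, false, true⟩, ⟨1, 0⟩)]

/-- `F` as a linear combination. -/
def combF : Comb1 :=
  [(⟨false, false, true, true⟩, ⟨1, 0⟩), (⟨true, false, true, true⟩, ⟨-1, 0⟩)]

@[simp] lemma ev1_combIdem (s : Bool) : ev1 (combIdem s) = bif s then e1 else e0 := by
  cases s <;> simp [combIdem, ev1, Mon.ev, GInt.toComplex]

@[simp] lemma ev1_combOne : ev1 combOne = 1 := by
  simp [combOne, ev1, Mon.ev, GInt.toComplex, e0_add_e1]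

@[simp] lemma ev1_combE : ev1 combE = E := by
  simp [combE, ev1, Mon.ev, GInt.toComplex, ← add_mul, e0_add_e1]

@[simp] lemma ev1_combY : ev1 combY = Y := by
  simp [combY, ev1, Mon.ev, GInt.toComplex, ← add_mul, e0_add_e1]

@[simp] lemma ev1_combK : ev1 combK = K := by
  simp [combK, ev1, Mon.ev, GInt.toComplex, ← add_mul, e0_add_e1]

-- F = Y K⁻¹ = K² Y K, and K² = e₀ - e₁ accounts for the sign on the second monomial.
@[simp] lemma ev1_combF : ev1 combF = F := by
  have h : ev1 combF = (e0 - e1) * (Y * K) := by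
    simp [combF, ev1, Mon.ev, GInt.toComplex, sub_mul]
    abel
  rw [h, ← K_sq, ← pow_two, ← mul_assoc, ← Y_mul_K_sq, Y, mul_assoc, mul_assoc, ← pow_succ,
    ← pow_succ', KK, mul_one]

lemma comul_e0 : comul e0 = e0 ⊗ₜ e0 + e1 ⊗ₜ e1 := by
  simp only [e0, e1, map_smul, map_add, map_one, map_pow, comul_K, Algebra.TensorProduct.tmul_pow,
    Algebra.TensorProduct.one_def, ← TensorProduct.smul_tmul', TensorProduct.tmul_smul,
    TensorProduct.add_tmul, TensorProduct.tmul_add, TensorProduct.sub_tmul,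
    TensorProduct.tmul_sub]
  module

lemma comul_e1 : comul e1 = e0 ⊗ₜ e1 + e1 ⊗ₜ e0 := by
  simp only [e0, e1, map_smul, map_sub, map_one, map_pow, comul_K, Algebra.TensorProduct.tmul_pow,
    Algebra.TensorProduct.one_def, ← TensorProduct.smul_tmul', TensorProduct.tmul_smul,
    TensorProduct.add_tmul, TensorProduct.tmul_add, TensorProduct.sub_tmul,
    TensorProduct.tmul_sub]
  module

/-- One reason for preferring Y to F: its coproduct has the same shape as that of E. -/
lemma comul_Y : comul Y = 1 ⊗ₜ Y + Y ⊗ₜ K := by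
  rw [Y, map_mul, comul_F, comul_K, add_mul, Algebra.TensorProduct.tmul_mul_tmul,
    Algebra.TensorProduct.tmul_mul_tmul, K3_mul_K, one_mul]

/-- The comultiplication of a monomial. -/
def comulMon (m : Mon) : Comb2 :=
  mul (add (tensor2 (combIdem false) (combIdem m.s)) (tensor2 (combIdem true) (combIdem !m.s)))
    (mul (bif m.a then add (tensor2 combOne combE) (tensor2 combE combK)
        else tensor2 combOne combOne)
      (mul (bif m.b then add (tensor2 combOne combY) (tensor2 combY combK)
          else tensor2 combOne combOne)
        (bif m.c then tensor2 combK combK else tensor2 combOne combOne)))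

lemma ev2_comulMon (m : Mon) : ev2 (comulMon m) = comul m.ev := by
  obtain ⟨s, a, b, c⟩ := m
  simp only [comulMon, ev_mul interprets_ev2, Mon.ev, map_mul]
  congr 1
  · cases s <;> simp [ev_add interprets_ev2, comul_e0, comul_e1]
  congr 1
  · cases a <;> simp [ev_add interprets_ev2, Algebra.TensorProduct.one_def]
  congr 1
  · cases b <;> simp [ev_add interprets_ev2, Algebra.TensorProduct.one_def, comul_Y]
  · cases c <;> simp [Algebra.TensorProduct.one_def]

section LegMaps

variable {R : Type} [CoeffOps R] {B : Type} [Ring B] [Algebra ℂ B] {ev : R → B}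

/-- Multiply a coefficient into an element of `Q`. -/
def spread1 (r : R) (p : Comb1) (acc : Node R) : Node R :=
  p.foldl (fun acc x => Node.update x.1 (CoeffOps.addScaled x.2 r) acc) acc

/-- Multiply a coefficient into an element of `Q ⊗ Q`. -/
def spread2 (r : R) (p : Comb2) (acc : Node (Node R)) : Node (Node R) :=
  p.foldl (fun acc x => Node.update x.1 (spread1 r x.2) acc) acc

lemma eval_spread1 (h : Interprets ev) (r : R) (p : Comb1) (acc : Node R) :
    Node.eval (TensorProduct.mk ℂ Q B) ev (spread1 r p acc) =
      ev1 p ⊗ₜ ev r + Node.eval (TensorProduct.mk ℂ Q B) ev acc := by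
  induction p generalizing acc with
  | nil => simp [spread1, ev1]
  | cons x p ih =>
    rw [spread1, List.foldl_cons]
    refine (ih _).trans ?_
    rw [Node.eval_update h _ _ _ (fun a => h.addScaled x.2 r a), ev1, Node.eval_cons,
      TensorProduct.add_tmul]
    simp only [TensorProduct.mk_apply, LinearMap.flip_apply, LinearMap.lsmul_apply,
      TensorProduct.tmul_smul, TensorProduct.smul_tmul']
    abel

/-- Appending r to both legs of p realises (a ⊗ b) ⊗ r ↦ a ⊗ (b ⊗ r), which is what applying Δ to
the first leg of a right-nested tensor requires. -/
lemma eval_spread2 (h : Interprets ev) (r : R) (p : Comb2) (acc : Node (Node R)) :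
    Node.eval (TensorProduct.mk ℂ Q _) (Node.eval (TensorProduct.mk ℂ Q B) ev)
        (spread2 r p acc) =
      Algebra.TensorProduct.assoc ℂ ℂ ℂ Q Q B (ev2 p ⊗ₜ ev r) +
        Node.eval (TensorProduct.mk ℂ Q _) (Node.eval (TensorProduct.mk ℂ Q B) ev) acc := by
  induction p generalizing acc with
  | nil => simp [spread2, ev2]
  | cons x p ih =>
    rw [spread2, List.foldl_cons]
    refine (ih _).trans ?_
    rw [Node.eval_update (Node.interprets_eval h (by simp)) _ _ _
      (fun a => eval_spread1 h r x.2 a), ev2, Node.eval_cons, TensorProduct.add_tmul, map_add]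
    simp only [TensorProduct.mk_apply, Algebra.TensorProduct.assoc_tmul]
    abel

/-- The comultiplication of the first leg. -/
def comulHead (p : Node R) : Node (Node R) :=
  bind (fun m r acc => spread2 r (comulMon m) acc) p

lemma eval_comulHead (h : Interprets ev) (p : Node R) :
    Node.eval (TensorProduct.mk ℂ Q _) (Node.eval (TensorProduct.mk ℂ Q B) ev) (comulHead p) =
      (Algebra.TensorProduct.assoc ℂ ℂ ℂ Q Q B).toAlgHom.comp
        (Algebra.TensorProduct.map comul (AlgHom.id ℂ B))
        (Node.eval (TensorProduct.mk ℂ Q B) ev p) := by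
  refine ev_bind (Node.interprets_eval (Node.interprets_eval h (by simp)) (by simp)) _
    ((Algebra.TensorProduct.assoc ℂ ℂ ℂ Q Q B).toAlgHom.comp
        (Algebra.TensorProduct.map comul (AlgHom.id ℂ B))).toLinearMap (fun m r acc => ?_) p
  rw [eval_spread2 h, ev2_comulMon]
  rfl

end LegMaps

/-- The comultiplication. -/
def combComul (p : Comb1) : Comb2 :=
  bind (fun m c acc => CoeffOps.addScaled c (comulMon m) acc) p

lemma ev2_combComul (p : Comb1) : ev2 (combComul p) = comul (ev1 p) := by
  refine ev_bind interprets_ev2 _ comul.toLinearMap (fun m c acc => ?_) p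
  rw [interprets_ev2.addScaled, ev2_comulMon]
  simp

/-- `id ⊗ Δ`. -/
def combComulSnd : Comb2 → Comb3 := mapCoeff combComul
/-- `id ⊗ Δ ⊗ id`. -/
def combComul2 : Comb3 → Comb4 := mapCoeff comulHead
/-- `id ⊗ id ⊗ Δ`. -/
def combComul3 : Comb3 → Comb4 := mapCoeff combComulSnd
/-- `x ↦ x ⊗ 1`. -/
def combLeg123 : Comb3 → Comb4 :=
  mapCoeff (mapCoeff (fun p => bind (fun m c acc => CoeffOps.addScaled c (tensor2 [(m, ⟨1, 0⟩)]
    combOne) acc) p))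

lemma ev3_comulFst (p : Comb2) : ev3 (comulHead p) = comulFst comul (ev2 p) :=
  eval_comulHead interprets_ev1 p

lemma ev3_combComulSnd (p : Comb2) : ev3 (combComulSnd p) = comulSnd comul (ev2 p) :=
  eval_mapCoeff comul ev2_combComul p

lemma ev4_comul1 (p : Comb3) : ev4 (comulHead p) = comul1 comul (ev3 p) :=
  eval_comulHead interprets_ev2 p

lemma ev4_combComul2 (p : Comb3) : ev4 (combComul2 p) = comul2 comul (ev3 p) :=
  eval_mapCoeff (comulFst comul) ev3_comulFst p

lemma ev4_combComul3 (p : Comb3) : ev4 (combComul3 p) = comul3 comul (ev3 p) :=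
  eval_mapCoeff (comulSnd comul) ev3_combComulSnd p

lemma ev4_combLeg123 (p : Comb3) : ev4 (combLeg123 p) = leg123 (ev3 p) := by
  refine eval_mapCoeff leg12 (eval_mapCoeff Algebra.TensorProduct.includeLeft fun p => ?_) p
  refine ev_bind interprets_ev2 _
    (Algebra.TensorProduct.includeLeft : Q →ₐ[ℂ] Q ⊗[ℂ] Q).toLinearMap (fun m c acc => ?_) p
  rw [interprets_ev2.addScaled, ev2_tensor2, ev1_combOne]
  simp [ev1, GInt.toComplex, TensorProduct.smul_tmul']

/-- `x ↦ 1 ⊗ x`. -/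
def combLeg234 (p : Comb3) : Comb4 := mapCoeff (fun c => scale c p) combOne

lemma ev4_combLeg234 (p : Comb3) : ev4 (combLeg234 p) = leg234 (ev3 p) := by
  refine (eval_scale interprets_ev3 combOne p).trans ?_
  rw [ev1_combOne]
  rfl

/-- The counit of a monomial. -/
def counitMon (m : Mon) : GInt := bif m.s || m.a || m.b then ⟨0, 0⟩ else ⟨1, 0⟩

lemma counit_ev (m : Mon) : counit m.ev = (counitMon m).toComplex := by
  obtain ⟨s, a, b, c⟩ := m
  cases s <;> cases a <;> cases b <;> cases c <;>
    simp [counitMon, Mon.ev, GInt.toComplex, e0, e1, Y, -one_div]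

/-- `id ⊗ ε ⊗ id`. -/
def combCounitMid : Comb3 → Comb2 :=
  mapCoeff fun p => bind (fun m r acc => CoeffOps.addScaled (counitMon m) r acc) p

lemma ev2_combCounitMid (p : Comb3) : ev2 (combCounitMid p) = counitMid counit (ev3 p) := by
  refine eval_mapCoeff (counitFst counit) (fun p => ?_) p
  refine ev_bind interprets_ev1 _ (counitFst counit).toLinearMap (fun m r acc => ?_) p
  rw [interprets_ev1.addScaled, ← counit_ev]
  simp [counitFst]

end QHopf.Q

/-! ### The coassociator and a candidate inverse as linear combinations -/

namespace QHopf.Q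

open Complex

/-- A sum of multiples. -/
def sumTerms : List (GInt × Comb3) → Comb3
  | [] => CoeffOps.zero
  | t :: l => CoeffOps.addScaled t.1 t.2 (sumTerms l)

lemma ev3_sumTerms_nil : ev3 (sumTerms []) = 0 := rfl

lemma ev3_sumTerms_cons (t : GInt × Comb3) (l : List (GInt × Comb3)) :
    ev3 (sumTerms (t :: l)) = t.1.toComplex • ev3 t.2 + ev3 (sumTerms l) :=
  interprets_ev3.addScaled _ _ _

/-- `E K`. -/
def combEK : Comb1 := mul combE combK
/-- `F K`. -/
def combFK : Comb1 := mul combF combK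
/-- `E F`. -/
def combEF : Comb1 := mul combE combF
/-- `E F K`. -/
def combEFK : Comb1 := mul combEF combK

@[simp] lemma ev1_combEK : ev1 combEK = E * K := by simp [combEK, ev_mul interprets_ev1]
@[simp] lemma ev1_combFK : ev1 combFK = F * K := by simp [combFK, ev_mul interprets_ev1]
@[simp] lemma ev1_combEF : ev1 combEF = E * F := by simp [combEF, ev_mul interprets_ev1]
@[simp] lemma ev1_combEFK : ev1 combEFK = E * F * K := by simp [combEFK, ev_mul interprets_ev1]

/-- `Φ⁰¹⁰` as a linear combination. -/
def comb010 : Comb3 :=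
  sumTerms [
    (⟨1, 0⟩, tensor3 combOne combOne combOne),
    (⟨-1, -1⟩, tensor3 combE combK combF),
    (⟨1, -1⟩, tensor3 combFK combK combEK),
    (⟨2, 0⟩, tensor3 combEFK combOne combEFK)]

/-- `Φ¹⁰¹` as a linear combination. -/
def comb101 : Comb3 :=
  sumTerms [
    (⟨-1, 1⟩, tensor3 combOne combF combEK),
    (⟨1, 0⟩, tensor3 combOne combK combOne),
    (⟨2, 0⟩, tensor3 combOne combEF combEFK),
    (⟨-1, -1⟩, tensor3 combOne combEK combF),
    (⟨-1, -1⟩, tensor3 combE combFK combOne),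
    (⟨0, 2⟩, tensor3 combE combEFK combF),
    (⟨1, -1⟩, tensor3 combFK combE combOne),
    (⟨0, -2⟩, tensor3 combFK combEFK combEK),
    (⟨-2, 0⟩, tensor3 combEFK combEF combOne)]

/-- `Φ¹¹¹` as a linear combination, without the scalar factor. -/
def comb111 : Comb3 :=
  sumTerms [
    (⟨1, 1⟩, tensor3 combOne combF combEK),
    (⟨-1, 0⟩, tensor3 combOne combK combOne),
    (⟨-2, 0⟩, tensor3 combOne combEF combOne),
    (⟨0, -2⟩, tensor3 combOne combEF combEFK),
    (⟨1, 1⟩, tensor3 combOne combEK combF),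
    (⟨-1, -1⟩, tensor3 combE combOne combF),
    (⟨1, 1⟩, tensor3 combE combFK combOne),
    (⟨0, 2⟩, tensor3 combE combFK combEFK),
    (⟨2, 0⟩, tensor3 combE combEFK combF),
    (⟨-1, -1⟩, tensor3 combFK combOne combEK),
    (⟨1, 1⟩, tensor3 combFK combE combOne),
    (⟨0, 2⟩, tensor3 combFK combE combEFK),
    (⟨2, 0⟩, tensor3 combFK combEFK combEK),
    (⟨0, 2⟩, tensor3 combEFK combF combEK),
    (⟨0, 2⟩, tensor3 combEFK combK combEFK),
    (⟨0, -2⟩, tensor3 combEFK combEF combOne),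
    (⟨0, 2⟩, tensor3 combEFK combEK combF),
    (⟨4, 0⟩, tensor3 combEFK combEF combEFK)]

lemma ev3_comb010 : ev3 comb010 = Φ010 := by
  simp only [comb010, Φ010, ev3_sumTerms_cons, ev3_sumTerms_nil, ev3_tensor3, ev1_combOne,
    ev1_combE, ev1_combF, ev1_combK, ev1_combEK, ev1_combFK, ev1_combEFK, GInt.toComplex]
  push_cast
  module

lemma ev3_comb101 : ev3 comb101 = Φ101 := by
  simp only [comb101, Φ101, ev3_sumTerms_cons, ev3_sumTerms_nil, ev3_tensor3, ev1_combOne,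
    ev1_combE, ev1_combF, ev1_combK, ev1_combEK, ev1_combFK, ev1_combEF, ev1_combEFK,
    GInt.toComplex]
  push_cast
  module

lemma ev3_comb111 (β : ℂ) : (I * β ^ 2) • ev3 comb111 = Φ111 β := by
  simp only [comb111, Φ111, ev3_sumTerms_cons, ev3_sumTerms_nil, ev3_tensor3, ev1_combOne,
    ev1_combE, ev1_combF, ev1_combK, ev1_combEK, ev1_combFK, ev1_combEF, ev1_combEFK,
    GInt.toComplex]
  congr 1
  push_cast
  module

/-- The idempotents of `Q ⊗ Q ⊗ Q`. -/
def combIdem3 (s t u : Bool) : Comb3 := tensor3 (combIdem s) (combIdem t) (combIdem u)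

/-- `Φ` as a linear combination; `w` stands for `i β²`. -/
def combΦ (w : GInt) : Comb3 := CoeffOps.prune <| sumTerms [
    (⟨1, 0⟩, combIdem3 false false false), (⟨1, 0⟩, combIdem3 true false false),
    (⟨1, 0⟩, mul comb010 (combIdem3 false true false)), (⟨1, 0⟩, combIdem3 false false true),
    (⟨1, 0⟩, combIdem3 true true false), (⟨1, 0⟩, mul comb101 (combIdem3 true false true)),
    (⟨1, 0⟩, combIdem3 false true true), (w, mul comb111 (combIdem3 true true true))]

lemma ev3_combΦ {w : GInt} {β : ℂ} (h : w.toComplex = I * β ^ 2) : ev3 (combΦ w) = Φ β := by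
  have h1 : GInt.toComplex ⟨1, 0⟩ = 1 := by simp [GInt.toComplex]
  rw [Φ, ← ev3_comb111, ← ev3_comb010, ← ev3_comb101, ← h]
  simp only [combΦ, interprets_ev3.prune, combIdem3, ev3_sumTerms_cons, ev3_sumTerms_nil,
    ev_mul interprets_ev3, ev3_tensor3,
    h1, ev1_combIdem, one_smul, cond_true, cond_false, smul_mul_assoc]
  abel

/-- The third power. -/
def cube (p : Comb3) : Comb3 := mul p (mul p p)

/-- The inverse of `Φ` as a linear combination. -/
def combΦInv (w : GInt) : Comb3 := CoeffOps.prune <| sumTerms [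
    (⟨1, 0⟩, combIdem3 false false false), (⟨1, 0⟩, combIdem3 true false false),
    (⟨1, 0⟩, mul (sumTerms [(⟨3, 0⟩, tensor3 combOne combOne combOne), (⟨-3, 0⟩, comb010),
      (⟨1, 0⟩, mul comb010 comb010)]) (combIdem3 false true false)),
    (⟨1, 0⟩, combIdem3 false false true), (⟨1, 0⟩, combIdem3 true true false),
    (⟨1, 0⟩, mul comb101 (combIdem3 true false true)), (⟨1, 0⟩, combIdem3 false true true),
    (w, cube (mul comb111 (combIdem3 true true true)))]

end QHopf.Q

namespace QHopf.Q

open Complex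

/-! ### The cocycle conditions for `Φ` -/

/-- The truth value is the sign iβ² = ±1. For each of its two values the pentagon identity is an
equality of concrete Gaussian integer coefficients in the fourth tensor power. -/
lemma combΦ_cocycle : ∀ b : Bool,
    beq (mul (comulHead (combΦ (GInt.unit b false))) (combComul3 (combΦ (GInt.unit b false))))
      (mul (combLeg123 (combΦ (GInt.unit b false)))
        (mul (combComul2 (combΦ (GInt.unit b false)))
          (combLeg234 (combΦ (GInt.unit b false))))) = true := by
  decide +kernel

lemma combΦ_intertwines : ∀ b : Bool, ∀ p ∈ [combE, combF, combK],
    beq (mul (comulHead (combComul p)) (combΦ (GInt.unit b false)))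
      (mul (combΦ (GInt.unit b false)) (combComulSnd (combComul p))) = true := by
  decide +kernel

lemma combΦ_counital : ∀ b : Bool,
    beq (combCounitMid (combΦ (GInt.unit b false))) (tensor2 combOne combOne) = true := by
  decide +kernel

/-- The candidate inverse is built block by block. On block 010 the element x = Φ⁰¹⁰ is unipotent
with (x - 1)³ = 0, so its inverse is 3 - 3x + x². On block 101 the element Φ¹⁰¹ is an involution. On
block 111 the element without its factor w = ±1 has fourth power one, so w times its cube is the
inverse. The remaining blocks are identities. -/
lemma combΦ_mul_inv : ∀ b : Bool,
    beq (mul (combΦ (GInt.unit b false)) (combΦInv (GInt.unit b false)))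
      (tensor3 combOne combOne combOne) = true := by
  decide +kernel

lemma combΦ_inv_mul : ∀ b : Bool,
    beq (mul (combΦInv (GInt.unit b false)) (combΦ (GInt.unit b false)))
      (tensor3 combOne combOne combOne) = true := by
  decide +kernel

lemma comulAlgHom_eq : Bialgebra.comulAlgHom ℂ Q = comul := rfl

lemma counitAlgHom_eq : Bialgebra.counitAlgHom ℂ Q = counit := rfl

/-- `Φ` is a coassociator on `Q`. -/
theorem isCoassociator_Φ {β : ℂ} (hβ : β ^ 4 = -1) : IsCoassociator (Φ β) := by
  -- This is where β⁴ = -1 enters: it reduces β to a sign, so that the two evaluated cases suffice.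
  obtain ⟨b, hb⟩ : ∃ b : Bool, (GInt.unit b false).toComplex = I * β ^ 2 := by
    have h : (I * β ^ 2) ^ 2 = 1 := by
      rw [mul_pow, I_sq, ← pow_mul, hβ]
      norm_num
    rcases mul_self_eq_one_iff.1 ((pow_two _).symm.trans h) with h | h
    · exact ⟨false, by rw [h]; simp [GInt.unit, GInt.toComplex]⟩
    · exact ⟨true, by rw [h]; simp [GInt.unit, GInt.toComplex]⟩
  have hΦ := ev3_combΦ hb
  have h1 : ev3 (tensor3 combOne combOne combOne) = 1 := by
    simp [Algebra.TensorProduct.one_def]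
  refine ⟨?_, ?_, ?_, ?_⟩
  · rw [← hΦ, isUnit_iff_exists]
    refine ⟨ev3 (combΦInv (GInt.unit b false)), ?_, ?_⟩
    · rw [← ev_mul interprets_ev3, ev_eq_of_beq interprets_ev3 (combΦ_mul_inv b), h1]
    · rw [← ev_mul interprets_ev3, ev_eq_of_beq interprets_ev3 (combΦ_inv_mul b), h1]
  -- The elements a for which Φ intertwines the two iterated coproducts form a subalgebra, so the
  -- generators are enough.
  · have key : ∀ p ∈ [combE, combF, combK], comulFst comul (comul (ev1 p)) * Φ β =
        Φ β * comulSnd comul (comul (ev1 p)) := by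
      intro p hp
      rw [← hΦ, ← ev2_combComul, ← ev3_comulFst, ← ev3_combComulSnd,
        ← ev_mul interprets_ev3, ← ev_mul interprets_ev3]
      exact ev_eq_of_beq interprets_ev3 (combΦ_intertwines b p hp)
    rw [comulAlgHom_eq]
    intro a
    induction a using Q.induction with
    | hE => exact ev1_combE ▸ key combE (by simp)
    | hF => exact ev1_combF ▸ key combF (by simp)
    | hK => exact ev1_combK ▸ key combK (by simp)
    | halg c => simp only [AlgHom.commutes, Algebra.commutes]
    | hadd a b ha hb => simp only [map_add, add_mul, mul_add, ha, hb]
    | hmul a b ha hb => rw [map_mul, map_mul, map_mul, mul_assoc, hb, ← mul_assoc, ha, mul_assoc]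
  · rw [← hΦ, counitAlgHom_eq, ← ev2_combCounitMid, ev_eq_of_beq interprets_ev2 (combΦ_counital b),
      ev2_tensor2, ev1_combOne]
    rfl
  · rw [← hΦ, comulAlgHom_eq, ← ev4_comul1, ← ev4_combComul2, ← ev4_combComul3,
      ← ev4_combLeg123, ← ev4_combLeg234, mul_assoc, ← ev_mul interprets_ev4,
      ← ev_mul interprets_ev4, ← ev_mul interprets_ev4]
    exact ev_eq_of_beq interprets_ev4 (combΦ_cocycle b)

end QHopf.Q

namespace QHopf

/-! ### Drinfeld twists give monoidal equivalences -/

section Actions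

variable {A B C : Type} [Ring A] [Algebra ℂ A] [Ring B] [Algebra ℂ B] [Ring C] [Algebra ℂ C]
variable {U V W : Type} [AddCommGroup U] [Module ℂ U] [AddCommGroup V] [Module ℂ V]
  [AddCommGroup W] [Module ℂ W]

lemma tensorAction_comp (ρ : B →ₐ[ℂ] Module.End ℂ U) (σ : B →ₐ[ℂ] Module.End ℂ V) (f : A →ₐ[ℂ] B)
    (x : A ⊗[ℂ] A) : tensorAction (ρ.comp f) (σ.comp f) x =
      tensorAction ρ σ (Algebra.TensorProduct.map f f x) := by
  induction x with
  | zero => simp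
  | tmul a b => ext; simp
  | add p q hp hq => simp only [map_add, hp, hq]

lemma tensorAction_comp₃ (ρ : B →ₐ[ℂ] Module.End ℂ U) (σ : B →ₐ[ℂ] Module.End ℂ V)
    (τ : B →ₐ[ℂ] Module.End ℂ W) (f : A →ₐ[ℂ] B) (x : A ⊗[ℂ] (A ⊗[ℂ] A)) :
    tensorAction (ρ.comp f) (tensorAction (σ.comp f) (τ.comp f)) x = tensorAction ρ
      (tensorAction σ τ) (Algebra.TensorProduct.map f (Algebra.TensorProduct.map f f) x) := by
  induction x with
  | zero => simp
  | tmul a b =>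
    ext u w
    simp only [TensorProduct.AlgebraTensorModule.curry_apply, LinearMap.restrictScalars_self,
      TensorProduct.curry_apply, tensorAction_tmul, Algebra.TensorProduct.map_tmul,
      tensorAction_comp, AlgHom.comp_apply]
  | add p q hp hq => simp only [map_add, hp, hq]

lemma leg12_eq_assoc (x : A ⊗[ℂ] A) : leg12 x =
    (Algebra.TensorProduct.assoc ℂ ℂ ℂ A A A).toAlgHom (x ⊗ₜ 1) := by
  induction x with
  | zero => simp
  | tmul p q => simp [leg12]
  | add p q hp hq => simp only [map_add, hp, hq, TensorProduct.add_tmul]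

/-- An invertible element acts invertibly. -/
def actionEquiv (ρ : A →ₐ[ℂ] Module.End ℂ U) (x : Aˣ) : U ≃ₗ[ℂ] U :=
  LinearEquiv.ofLinearMap (ρ x.val) (ρ (x⁻¹).val)
    (by rw [← Module.End.mul_eq_comp, ← map_mul, Units.mul_inv, map_one]; rfl)
    (by rw [← Module.End.mul_eq_comp, ← map_mul, Units.inv_mul, map_one]; rfl)

end Actions

namespace QuasiBialgebra

variable {A B : Type} [Ring A] [Algebra ℂ A] [Ring B] [Algebra ℂ B] {H H' : QuasiBialgebra A}
  {K : QuasiBialgebra B} {F : (A ⊗[ℂ] A)ˣ}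

namespace IsTwist

/-- The relation Δ' F = F Δ, applied in the first two legs. -/
lemma comulFst_eq (h : H.IsTwist H' F) (x : A ⊗[ℂ] A) : comulFst H'.comul x * leg12 F.val =
    leg12 F.val * comulFst H.comul x := by
  induction x with
  | zero => simp
  | tmul a b =>
    rw [leg12_eq_assoc, comulFst, comulFst, AlgHom.comp_apply, AlgHom.comp_apply, ← map_mul,
      ← map_mul]
    simp [h.comul_eq]
  | add p q hp hq => simp only [map_add, mul_add, add_mul, hp, hq]

lemma comulSnd_eq (h : H.IsTwist H' F) (x : A ⊗[ℂ] A) : comulSnd H'.comul x * leg23 F.val =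
    leg23 F.val * comulSnd H.comul x := by
  induction x with
  | zero => simp
  | tmul a b => simp [leg23, comulSnd, h.comul_eq]
  | add p q hp hq => simp only [map_add, mul_add, add_mul, hp, hq]

/-- The formula for the twisted coassociator, solved for its inverse. In this form it is the
associativity axiom of a tensorator given by F, because associators act by inverse coassociators. -/
lemma inv_Φ (h : H.IsTwist H' F) :
    (H'.Φ⁻¹).val * (comulFst H'.comul F.val * leg12 F.val) =
      comulSnd H'.comul F.val * leg23 F.val * (H.Φ⁻¹).val := by
  rw [h.comulFst_eq, h.comulSnd_eq, Units.inv_mul_eq_iff_eq_mul, h.coassociator_eq]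
  have e : comulSnd H.comul (F⁻¹).val * leg23 (F⁻¹).val *
      (leg23 F.val * comulSnd H.comul F.val) = 1 := by
    rw [mul_assoc, ← mul_assoc (leg23 _), ← map_mul leg23, F.inv_mul, map_one, one_mul, ← map_mul,
      F.inv_mul, map_one]
  symm
  calc _ = leg12 F.val * comulFst H.comul F.val * H.Φ.val * (comulSnd H.comul (F⁻¹).val *
        leg23 (F⁻¹).val * (leg23 F.val * comulSnd H.comul F.val)) * (H.Φ⁻¹).val := by
        simp only [mul_assoc]
    _ = _ := by rw [e, mul_one, Units.mul_inv_cancel_right]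

section

variable {U V W : Type} [AddCommGroup U] [Module ℂ U] [AddCommGroup V] [Module ℂ V]
  [AddCommGroup W] [Module ℂ W] (ρ : A →ₐ[ℂ] Module.End ℂ U) (σ : A →ₐ[ℂ] Module.End ℂ V)
  (τ : A →ₐ[ℂ] Module.End ℂ W)

lemma tensorAction_comul (h : H.IsTwist H' F) (a : A) (w : U ⊗[ℂ] V) :
    tensorAction ρ σ F.val (tensorAction ρ σ (H.comul a) w) =
      tensorAction ρ σ (H'.comul a) (tensorAction ρ σ F.val w) := by
  rw [← Module.End.mul_apply, ← Module.End.mul_apply, ← map_mul, ← map_mul, h.comul_eq,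
    mul_assoc _ _ F.val, F.inv_mul, mul_one]

lemma assocBy_comulAction (h : H.IsTwist H' F) (w : (U ⊗[ℂ] V) ⊗[ℂ] W) :
    assocBy ρ σ τ (H'.Φ⁻¹).val (tensorAction (comulAction H'.comul ρ σ) τ F.val
      (TensorProduct.map (tensorAction ρ σ F.val) LinearMap.id w)) =
    tensorAction ρ (comulAction H'.comul σ τ) F.val
      (TensorProduct.map LinearMap.id (tensorAction σ τ F.val)
        (assocBy ρ σ τ (H.Φ⁻¹).val w)) := by
  set T := tensorAction ρ (tensorAction σ τ) with hT
  have h1 : TensorProduct.assoc ℂ U V W (tensorAction (comulAction H'.comul ρ σ) τ F.val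
      (TensorProduct.map (tensorAction ρ σ F.val) LinearMap.id w)) =
      T (comulFst H'.comul F.val) (T (leg12 F.val) (TensorProduct.assoc ℂ U V W w)) := by
    rw [assoc_comulAction, ← tensorAction_tmul_one (tensorAction ρ σ) τ, assoc_tensorAction,
      ← leg12_eq_assoc]
    rfl
  have h2 : tensorAction ρ (comulAction H'.comul σ τ) F.val = T (comulSnd H'.comul F.val) :=
    tensorAction_comp_right ρ (tensorAction σ τ) H'.comul F.val
  have h3 : TensorProduct.map LinearMap.id (tensorAction σ τ F.val) = T (leg23 F.val) :=
    (tensorAction_includeRight ρ (tensorAction σ τ) F.val).symm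
  have h4 := congrArg (fun x => T x (TensorProduct.assoc ℂ U V W w)) h.inv_Φ
  simp only [map_mul, Module.End.mul_apply] at h4
  rw [h2, h3, assocBy, assocBy, LinearMap.comp_apply, LinearMap.comp_apply, LinearEquiv.coe_coe,
    h1]
  exact h4

end

end IsTwist

lemma Iso.inv_Φ (e : Iso H' K) : (K.Φ⁻¹).val = Algebra.TensorProduct.map e.toAlgEquiv.toAlgHom
    (Algebra.TensorProduct.map e.toAlgEquiv.toAlgHom e.toAlgEquiv.toAlgHom) (H'.Φ⁻¹).val := by
  refine Units.inv_eq_of_mul_eq_one_right ?_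
  rw [e.coassociator_eq, ← map_mul, Units.mul_inv, map_one]

/-- Restriction of representations along an isomorphism, followed by the identity functor to the
representations of an untwisted quasi-bialgebra. -/
def restrict (H : QuasiBialgebra A) (e : Iso H' K) : K.Rep ⥤ H.Rep where
  obj M := ⟨M.V, M.ρ.comp e.toAlgEquiv.toAlgHom⟩
  map f := ⟨f.hom, fun a v => f.comm (e.toAlgEquiv a) v⟩

instance (e : Iso H' K) : (restrict H e).IsEquivalence where
  faithful := ⟨fun {M N} _ _ h => Rep.hom_ext
    (congrArg (fun f : (restrict H e).obj M ⟶ (restrict H e).obj N => Rep.Hom.hom f) h)⟩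
  full := ⟨fun {M N} f => ⟨⟨f.hom, fun b v => by
    have := f.comm (e.toAlgEquiv.symm b) v
    change f.hom (M.ρ (e.toAlgEquiv (e.toAlgEquiv.symm b)) v) =
      N.ρ (e.toAlgEquiv (e.toAlgEquiv.symm b)) (f.hom v) at this
    rwa [AlgEquiv.apply_symm_apply] at this⟩, rfl⟩⟩
  essSurj := ⟨fun M => ⟨⟨M.V, M.ρ.comp e.toAlgEquiv.symm.toAlgHom⟩,
    ⟨Rep.mkIso (LinearEquiv.refl ℂ M.V) fun a v => by
      change M.ρ (e.toAlgEquiv.symm (e.toAlgEquiv a)) v = M.ρ a v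
      rw [AlgEquiv.symm_apply_apply]⟩⟩⟩

/-- Restriction along the isomorphism is strictly compatible with tensor products for H'. The
passage from H' to H is left to the tensorator. -/
lemma restrict_tensor (e : Iso H' K) (M N : K.Rep) :
    (comulAction K.comul M.ρ N.ρ).comp e.toAlgEquiv.toAlgHom =
      comulAction H'.comul (M.ρ.comp e.toAlgEquiv.toAlgHom) (N.ρ.comp e.toAlgEquiv.toAlgHom) := by
  refine AlgHom.ext fun a => ?_
  change tensorAction _ _ (K.comul (e.toAlgEquiv a)) = tensorAction _ _ (H'.comul a)
  rw [tensorAction_comp, e.comul_eq]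

open MonoidalCategory

/-- The tensorator of `restrict`: the action of the twist. -/
def restrictTensorator (h : H.IsTwist H' F) (e : Iso H' K) (M N : K.Rep) :
    (restrict H e).obj M ⊗ (restrict H e).obj N ≅ (restrict H e).obj (M ⊗ N) :=
  Rep.mkIso (M := Rep.tensor ((restrict H e).obj M) ((restrict H e).obj N))
    (N := (restrict H e).obj (Rep.tensor M N))
    (actionEquiv (tensorAction (M.ρ.comp e.toAlgEquiv.toAlgHom) (N.ρ.comp e.toAlgEquiv.toAlgHom)) F)
    fun a v => by
      change tensorAction _ _ F.val (tensorAction _ _ (H.comul a) v) =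
        (comulAction K.comul M.ρ N.ρ).comp e.toAlgEquiv.toAlgHom a (tensorAction _ _ F.val v)
      rw [restrict_tensor]
      exact h.tensorAction_comul _ _ a v

lemma restrict_associativity (h : H.IsTwist H' F) (e : Iso H' K) (X Y Z : K.Rep)
    (w : (X.V ⊗[ℂ] Y.V) ⊗[ℂ] Z.V) :
    assocBy X.ρ Y.ρ Z.ρ (K.Φ⁻¹).val
      (tensorAction ((comulAction K.comul X.ρ Y.ρ).comp e.toAlgEquiv.toAlgHom)
        (Z.ρ.comp e.toAlgEquiv.toAlgHom) F.val
        (TensorProduct.map (tensorAction (X.ρ.comp e.toAlgEquiv.toAlgHom)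
          (Y.ρ.comp e.toAlgEquiv.toAlgHom) F.val) LinearMap.id w)) =
      tensorAction (X.ρ.comp e.toAlgEquiv.toAlgHom)
        ((comulAction K.comul Y.ρ Z.ρ).comp e.toAlgEquiv.toAlgHom) F.val
        (TensorProduct.map LinearMap.id (tensorAction (Y.ρ.comp e.toAlgEquiv.toAlgHom)
          (Z.ρ.comp e.toAlgEquiv.toAlgHom) F.val)
          (assocBy (X.ρ.comp e.toAlgEquiv.toAlgHom) (Y.ρ.comp e.toAlgEquiv.toAlgHom)
            (Z.ρ.comp e.toAlgEquiv.toAlgHom) (H.Φ⁻¹).val w)) := by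
  rw [restrict_tensor, restrict_tensor, ← h.assocBy_comulAction, assocBy, assocBy,
    tensorAction_comp₃, ← e.inv_Φ]

/-- A twist makes `restrict` a monoidal functor. -/
def restrictMonoidal (h : H.IsTwist H' F) (e : Iso H' K) : (restrict H e).CoreMonoidal where
  εIso := Rep.mkIso (M := Rep.unit H) (N := (restrict H e).obj (Rep.unit K))
    (LinearEquiv.refl ℂ ℂ) fun a v => by
      change counitAction H.counit a v = counitAction K.counit (e.toAlgEquiv a) v
      rw [AlgHom.comp_apply, AlgHom.comp_apply, e.counit_eq, h.counit_eq]
  μIso := restrictTensorator h e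
  μIso_hom_natural_left {X Y} f X' := Rep.hom_ext <| LinearMap.ext fun w => by
    change tensorAction (Y.ρ.comp e.toAlgEquiv.toAlgHom) (X'.ρ.comp e.toAlgEquiv.toAlgHom) F.val
        (TensorProduct.map f.hom LinearMap.id w) = TensorProduct.map f.hom LinearMap.id
      (tensorAction (X.ρ.comp e.toAlgEquiv.toAlgHom) (X'.ρ.comp e.toAlgEquiv.toAlgHom) F.val w)
    exact (map_tensorAction (X.ρ.comp e.toAlgEquiv.toAlgHom) (X'.ρ.comp e.toAlgEquiv.toAlgHom)
      (Y.ρ.comp e.toAlgEquiv.toAlgHom) (X'.ρ.comp e.toAlgEquiv.toAlgHom) f.hom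
      LinearMap.id (fun a u => f.comm (e.toAlgEquiv a) u) (fun _ _ => rfl)
      F.val w).symm
  μIso_hom_natural_right {X Y} X' f := Rep.hom_ext <| LinearMap.ext fun w => by
    change tensorAction (X'.ρ.comp e.toAlgEquiv.toAlgHom) (Y.ρ.comp e.toAlgEquiv.toAlgHom) F.val
        (TensorProduct.map LinearMap.id f.hom w) = TensorProduct.map LinearMap.id f.hom
      (tensorAction (X'.ρ.comp e.toAlgEquiv.toAlgHom) (X.ρ.comp e.toAlgEquiv.toAlgHom) F.val w)
    exact (map_tensorAction (X'.ρ.comp e.toAlgEquiv.toAlgHom) (X.ρ.comp e.toAlgEquiv.toAlgHom)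
      (X'.ρ.comp e.toAlgEquiv.toAlgHom) (Y.ρ.comp e.toAlgEquiv.toAlgHom) LinearMap.id
      f.hom (fun _ _ => rfl) (fun a u => f.comm (e.toAlgEquiv a) u)
      F.val w).symm
  associativity X Y Z := Rep.hom_ext <| LinearMap.ext fun w => restrict_associativity h e X Y Z w
  left_unitality X := Rep.hom_ext <| LinearMap.ext fun w => by
    change TensorProduct.lid ℂ X.V w = TensorProduct.lid ℂ X.V
      (tensorAction ((counitAction K.counit).comp e.toAlgEquiv.toAlgHom)
        (X.ρ.comp e.toAlgEquiv.toAlgHom) F.val (TensorProduct.map LinearMap.id LinearMap.id w))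
    have : (counitAction K.counit).comp e.toAlgEquiv.toAlgHom = counitAction H.counit := by
      refine AlgHom.ext fun a => ?_
      change counitAction K.counit (e.toAlgEquiv a) = counitAction H.counit a
      rw [AlgHom.comp_apply, AlgHom.comp_apply, e.counit_eq, h.counit_eq]
    rw [this, lid_counitAction, h.counit_fst, map_one, TensorProduct.map_id]
    rfl
  right_unitality X := Rep.hom_ext <| LinearMap.ext fun w => by
    change TensorProduct.rid ℂ X.V w = TensorProduct.rid ℂ X.V
      (tensorAction (X.ρ.comp e.toAlgEquiv.toAlgHom)
        ((counitAction K.counit).comp e.toAlgEquiv.toAlgHom) F.val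
          (TensorProduct.map LinearMap.id LinearMap.id w))
    have : (counitAction K.counit).comp e.toAlgEquiv.toAlgHom = counitAction H.counit := by
      refine AlgHom.ext fun a => ?_
      change counitAction K.counit (e.toAlgEquiv a) = counitAction H.counit a
      rw [AlgHom.comp_apply, AlgHom.comp_apply, e.counit_eq, h.counit_eq]
    rw [this, rid_counitAction, h.counit_snd, map_one, TensorProduct.map_id]
    rfl

/-- Twist equivalent quasi-bialgebras have monoidally equivalent representation categories. -/
theorem IsTwistEquivalent.monoidallyEquivalent (h : IsTwistEquivalent H K) :
    MonoidallyEquivalent K H := by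
  obtain ⟨H', F, hF, ⟨e⟩⟩ := h
  exact ⟨restrict H e, inferInstance, ⟨(restrictMonoidal hF e).toMonoidal⟩⟩

end QuasiBialgebra

end QHopf

/-! ### The identity functor, and trivial classes as twists -/

namespace QHopf

namespace QuasiBialgebra

section

variable {A : Type} [Ring A] [Algebra ℂ A]

instance (H K : QuasiBialgebra A) : (idFunctor H K).IsEquivalence where
  faithful := ⟨fun {M N} _ _ h => Rep.hom_ext
    (congrArg (fun f : (idFunctor H K).obj M ⟶ (idFunctor H K).obj N => Rep.Hom.hom f) h)⟩
  full := ⟨fun f => ⟨⟨f.hom, f.comm⟩, rfl⟩⟩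
  essSurj := ⟨fun M => ⟨⟨M.V, M.ρ⟩,
    ⟨Rep.mkIso (LinearEquiv.refl ℂ M.V) fun _ _ => rfl⟩⟩⟩

end

variable {A : Type} [Ring A] [Bialgebra ℂ A]

/-- A coassociator in the trivial class comes from a twist. -/
lemma isTwistEquivalent_of_H3_eq {Φ : A ⊗[ℂ] (A ⊗[ℂ] A)} (h : IsCoassociator Φ)
    (hΦ : H3.mk Φ h = H3.trivial) : IsTwistEquivalent (ofBialgebra A) (ofCoassociator A Φ h) := by
  obtain ⟨F, hF, e⟩ : Cohomologous 1 Φ :=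
    cohomologous_equivalence.symm (Quotient.exact hΦ)
  -- Invariance of F says F Δ F⁻¹ = Δ, so twisting by F keeps the coproduct and changes the
  -- coassociator from 1 to Φ; the required isomorphism is the identity.
  refine ⟨ofCoassociator A Φ h, F, ⟨hF.counit_fst, hF.counit_snd, rfl, fun a => ?_, e⟩,
    ⟨⟨AlgEquiv.refl, fun _ => rfl, fun a => ?_, ?_⟩⟩⟩
  · rw [Units.eq_mul_inv_iff_mul_eq]
    exact (hF.invariant a).symm
  · exact (AlgHom.congr_fun Algebra.TensorProduct.map_id _).symm
  · have : Algebra.TensorProduct.map (AlgHom.id ℂ A)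
        (Algebra.TensorProduct.map (AlgHom.id ℂ A) (AlgHom.id ℂ A)) =
          AlgHom.id ℂ (A ⊗[ℂ] (A ⊗[ℂ] A)) := by
      rw [Algebra.TensorProduct.map_id, Algebra.TensorProduct.map_id]
    exact (AlgHom.congr_fun this _).symm

end QuasiBialgebra
end QHopf

namespace QHopf

/-! ### An invariant of monoidal categories -/

open MonoidalCategory Functor.LaxMonoidal Functor.OplaxMonoidal Functor.Monoidal

universe v₁ v₂ u₁ u₂

variable {C : Type u₁} [Category.{v₁} C] [MonoidalCategory C] {D : Type u₂} [Category.{v₂} D]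
  [MonoidalCategory D]

/-- The object `X` is its own tensor inverse. -/
def SelfInverse (X : C) : Prop := Nonempty (X ⊗ X ≅ 𝟙_ C)

/-- Objects `M` and `T` with an augmentation `p : M ⟶ 𝟙` such that both `M ⊗ T ⟶ T` and
`T ⊗ M ⟶ T` have a unique section, where `T` receives no morphisms from self-inverse objects
and any two morphisms from a self-inverse object to `M` are comparable. -/
structure Crossing (C : Type u₁) [Category.{v₁} C] [MonoidalCategory C] where
  M : C
  T : C
  p : M ⟶ 𝟙_ C
  left : T ⟶ M ⊗ T
  right : T ⟶ T ⊗ M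
  left_p : left ≫ p ▷ T ≫ (λ_ T).hom = 𝟙 T
  right_p : right ≫ T ◁ p ≫ (ρ_ T).hom = 𝟙 T
  left_unique : ∀ s : T ⟶ M ⊗ T, s ≫ p ▷ T ≫ (λ_ T).hom = 𝟙 T → s = left
  right_unique : ∀ s : T ⟶ T ⊗ M, s ≫ T ◁ p ≫ (ρ_ T).hom = 𝟙 T → s = right
  comparable : ∀ X : C, SelfInverse X → ∀ f g : X ⟶ M,
    (∃ s : X ⟶ X, g = s ≫ f) ∨ (∃ s : X ⟶ X, f = s ≫ g)
  subsingleton : ∀ X : C, SelfInverse X → Subsingleton (X ⟶ T)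

/-- The two ways of adding a copy of `M` on both sides of `T` agree. -/
def Crossing.Commutes (c : Crossing C) : Prop :=
  c.left ≫ c.M ◁ c.right = c.right ≫ c.left ▷ c.M ≫ (α_ c.M c.T c.M).hom

section Transport

variable (F : C ⥤ D) [F.Monoidal]

lemma SelfInverse.of_map [F.Full] [F.Faithful] {X : C} (h : SelfInverse (F.obj X)) :
    SelfInverse X := by
  obtain ⟨e⟩ := h
  exact ⟨F.preimageIso ((μIso F X X).symm ≪≫ e ≪≫ εIso F)⟩

lemma SelfInverse.of_iso {X Y : C} (e : X ≅ Y) (h : SelfInverse X) : SelfInverse Y := by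
  obtain ⟨f⟩ := h
  exact ⟨(e.symm ⊗ᵢ e.symm) ≪≫ f⟩

lemma map_left_section {M T : C} (p : M ⟶ 𝟙_ C) (s : T ⟶ M ⊗ T) :
    (F.map s ≫ δ F M T) ≫ (F.map p ≫ η F) ▷ F.obj T ≫ (λ_ (F.obj T)).hom =
      F.map (s ≫ p ▷ T ≫ (λ_ T).hom) := by
  simp

lemma map_right_section {M T : C} (p : M ⟶ 𝟙_ C) (s : T ⟶ T ⊗ M) :
    (F.map s ≫ δ F T M) ≫ F.obj T ◁ (F.map p ≫ η F) ≫ (ρ_ (F.obj T)).hom =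
      F.map (s ≫ T ◁ p ≫ (ρ_ T).hom) := by
  simp

variable [F.IsEquivalence]

/-- Transport of a crossing along a monoidal equivalence. -/
def Crossing.map (c : Crossing C) : Crossing D where
  M := F.obj c.M
  T := F.obj c.T
  p := F.map c.p ≫ η F
  left := F.map c.left ≫ δ F c.M c.T
  right := F.map c.right ≫ δ F c.T c.M
  left_p := by rw [map_left_section, c.left_p, F.map_id]
  right_p := by rw [map_right_section, c.right_p, F.map_id]
  left_unique s hs := by
    -- By fullness every candidate section in D is the image of a morphism of C followed by the
    -- comparison isomorphism, so uniqueness can be checked in C.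
    have e : F.map (F.preimage (s ≫ μ F _ _)) ≫ δ F _ _ = s := by simp
    rw [← e, map_left_section, ← F.map_id] at hs
    rw [← e, c.left_unique _ (F.map_injective hs)]
  right_unique s hs := by
    have e : F.map (F.preimage (s ≫ μ F _ _)) ≫ δ F _ _ = s := by simp
    rw [← e, map_right_section, ← F.map_id] at hs
    rw [← e, c.right_unique _ (F.map_injective hs)]
  comparable X hX f g := by
    -- Self-inverse objects of D are, up to isomorphism, images of self-inverse objects of C;
    -- comparability is transported through this isomorphism.
    let e := F.objObjPreimageIso X
    have h : SelfInverse (F.objPreimage X) := (hX.of_iso e.symm).of_map F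
    have key : ∀ f' g' : X ⟶ F.obj c.M, ∀ s : F.objPreimage X ⟶ F.objPreimage X,
        F.preimage (e.hom ≫ g') = s ≫ F.preimage (e.hom ≫ f') →
          g' = (e.inv ≫ F.map s ≫ e.hom) ≫ f' := by
      intro f' g' s hs
      have := congrArg F.map hs
      simp only [F.map_preimage, F.map_comp] at this
      rw [Category.assoc, Category.assoc, ← this, e.inv_hom_id_assoc]
    rcases c.comparable _ h (F.preimage (e.hom ≫ f)) (F.preimage (e.hom ≫ g)) with
      ⟨s, hs⟩ | ⟨s, hs⟩
    · exact Or.inl ⟨_, key f g s hs⟩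
    · exact Or.inr ⟨_, key g f s hs⟩
  subsingleton X hX := by
    let e := F.objObjPreimageIso X
    have h := c.subsingleton _ ((hX.of_iso e.symm).of_map F)
    refine ⟨fun f g => ?_⟩
    have := congrArg F.map (h.elim (F.preimage (e.hom ≫ f)) (F.preimage (e.hom ≫ g)))
    rwa [F.map_preimage, F.map_preimage, Iso.cancel_iso_hom_left] at this

lemma Crossing.Commutes.of_map {c : Crossing C} (h : (c.map F).Commutes) : c.Commutes := by
  refine F.map_injective ?_
  have h : (F.map c.left ≫ δ F c.M c.T) ≫ F.obj c.M ◁ (F.map c.right ≫ δ F c.T c.M) =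
    (F.map c.right ≫ δ F c.T c.M) ≫ (F.map c.left ≫ δ F c.M c.T) ▷ F.obj c.M ≫
      (α_ (F.obj c.M) (F.obj c.T) (F.obj c.M)).hom := h
  -- Composing with these invertible comparison maps turns the images of the two composites in C
  -- into the two composites of the transported crossing.
  rw [← cancel_mono (δ F c.M (c.T ⊗ c.M) ≫ F.obj c.M ◁ δ F c.T c.M)]
  simpa using h

end Transport

end QHopf

namespace QHopf.Q

open Complex QuasiBialgebra

/-! ### Representations of `Q` -/

section

variable {U V : Type} [AddCommGroup U] [Module ℂ U] [AddCommGroup V] [Module ℂ V]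
  (ρ : Q →ₐ[ℂ] Module.End ℂ U) (σ : Q →ₐ[ℂ] Module.End ℂ V)

lemma act_E_E (u : U) : ρ E (ρ E u) = 0 := by
  rw [← Module.End.mul_apply, ← map_mul, E_mul_E, map_zero, LinearMap.zero_apply]

lemma act_Y_Y (u : U) : ρ Y (ρ Y u) = 0 := by
  rw [← Module.End.mul_apply, ← map_mul, Y_mul_Y, map_zero, LinearMap.zero_apply]

lemma act_K_E (u : U) : ρ K (ρ E u) = -ρ E (ρ K u) := by
  rw [← Module.End.mul_apply, ← map_mul, KE, map_neg, map_mul, LinearMap.neg_apply,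
    Module.End.mul_apply]

lemma act_K_Y (u : U) : ρ K (ρ Y u) = -ρ Y (ρ K u) := by
  rw [← Module.End.mul_apply, ← map_mul, K_mul_Y, map_neg, map_mul, LinearMap.neg_apply,
    Module.End.mul_apply]

lemma act_Y_E (u : U) : ρ Y (ρ E u) = I • ρ e1 u - ρ E (ρ Y u) := by
  rw [← Module.End.mul_apply, ← map_mul, Y_mul_E, map_sub, map_smul, map_mul,
    LinearMap.sub_apply, LinearMap.smul_apply, Module.End.mul_apply]

lemma act_e0 (u : U) : ρ e0 u = (1 / 2 : ℂ) • (u + ρ K (ρ K u)) := by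
  simp [e0, pow_two]

lemma act_e1 (u : U) : ρ e1 u = (1 / 2 : ℂ) • (u - ρ K (ρ K u)) := by
  simp [e1, pow_two]

lemma act_F (u : U) : ρ F u = ρ Y (ρ K (ρ K (ρ K u))) := by
  have : F = Y * (K * (K * K)) := by
    have : K * (K * (K * K)) = 1 := by rw [← KK]; simp only [pow_succ, pow_zero, one_mul, mul_assoc]
    rw [Y, mul_assoc, this, mul_one]
  simp [this]

variable {ρ σ} in
-- E, Y and K generate Q because F = Y K³.
lemma intertwines_of_generators (f : U →ₗ[ℂ] V) (hE : ∀ u, f (ρ E u) = σ E (f u))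
    (hY : ∀ u, f (ρ Y u) = σ Y (f u)) (hK : ∀ u, f (ρ K u) = σ K (f u)) (a : Q) (u : U) :
    f (ρ a u) = σ a (f u) := by
  induction a using Q.induction generalizing u with
  | hE => exact hE u
  | hF => simp only [act_F, hY, hK]
  | hK => exact hK u
  | halg c => simp [Algebra.algebraMap_eq_smul_one]
  | hadd a b ha hb => simp [ha, hb]
  | hmul a b ha hb => simp [ha, hb]

lemma comulAction_E (u : U) (v : V) : comulAction comul ρ σ E (u ⊗ₜ v) =
    u ⊗ₜ σ E v + ρ E u ⊗ₜ σ K v := by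
  rw [AlgHom.comp_apply, comul_E]
  simp

lemma comulAction_Y (u : U) (v : V) : comulAction comul ρ σ Y (u ⊗ₜ v) =
    u ⊗ₜ σ Y v + ρ Y u ⊗ₜ σ K v := by
  rw [AlgHom.comp_apply, comul_Y]
  simp

lemma comulAction_K (u : U) (v : V) : comulAction comul ρ σ K (u ⊗ₜ v) = ρ K u ⊗ₜ σ K v := by
  rw [AlgHom.comp_apply, comul_K]
  simp

variable {ρ σ} in
lemma intertwines_tensor_of_generators {W : Type} [AddCommGroup W] [Module ℂ W]
    {τ : Q →ₐ[ℂ] Module.End ℂ W} (f : U ⊗[ℂ] V →ₗ[ℂ] W)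
    (hE : ∀ u v, f (u ⊗ₜ σ E v + ρ E u ⊗ₜ σ K v) = τ E (f (u ⊗ₜ v)))
    (hY : ∀ u v, f (u ⊗ₜ σ Y v + ρ Y u ⊗ₜ σ K v) = τ Y (f (u ⊗ₜ v)))
    (hK : ∀ u v, f (ρ K u ⊗ₜ σ K v) = τ K (f (u ⊗ₜ v))) (a : Q) (w : U ⊗[ℂ] V) :
    f (comulAction comul ρ σ a w) = τ a (f w) := by
  refine intertwines_of_generators f (fun w => ?_) (fun w => ?_) (fun w => ?_) a w <;>
  induction w with
  | zero => simp only [map_zero]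
  | add p q hp hq => simp only [map_add, hp, hq]
  | tmul u v => simp only [comulAction_E, comulAction_Y, comulAction_K, hE, hY, hK]

end

/-- The character of `Q` with `E, F ↦ 0` and `K ↦ ε`. -/
def signCharacter (ε : ℂ) (hε : ε * ε = 1) : Q →ₐ[ℂ] ℂ :=
  lift 0 0 ε (by simp) (by simp) (by linear_combination (I - I⁻¹)⁻¹ * ε * hε) (by simp) (by simp)
    (by linear_combination (ε * ε + 1) * hε)

section

variable {Ψ : Q ⊗[ℂ] (Q ⊗[ℂ] Q)} {h : IsCoassociator Ψ} {ε : ℂ} (hε : ε * ε = 1)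

@[simp] lemma signCharacter_E : signCharacter ε hε E = 0 := lift_E

@[simp] lemma signCharacter_Y : signCharacter ε hε Y = 0 := by simp [signCharacter, Y]

@[simp] lemma signCharacter_K : signCharacter ε hε K = ε := lift_K

lemma counit_Y : counit Y = 0 := by simp [Y]

variable (h) in
/-- The one-dimensional representation with `E, F ↦ 0` and `K ↦ ε`. -/
abbrev signRep : (ofCoassociator Q Ψ h).Rep := ⟨ℂ, counitAction (signCharacter ε hε)⟩

/-- These are the test objects by which the conditions on self-inverse objects in a crossing become
conditions on joint eigenvectors. -/
lemma selfInverse_signRep : SelfInverse (signRep h hε) :=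
  ⟨QuasiBialgebra.Rep.mkIso (M := Rep.tensor (signRep h hε) (signRep h hε)) (N := Rep.unit _)
    (TensorProduct.lid ℂ ℂ) fun a v =>
    intertwines_tensor_of_generators (ρ := counitAction (signCharacter ε hε))
      (σ := counitAction (signCharacter ε hε)) (τ := counitAction counit)
      (TensorProduct.lid ℂ ℂ).toLinearMap (by simp [Algebra.ofId_apply])
      (by simp [Algebra.ofId_apply, counit_Y]) (fun u v => by
        simp only [AlgHom.comp_apply, signCharacter_K, counit_K, Algebra.ofId_apply,
          Module.algebraMap_end_apply, LinearEquiv.coe_coe, TensorProduct.lid_tmul, smul_eq_mul]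
        linear_combination u * v * hε) a v⟩

/-- A joint eigenvector of the generators as a morphism from a one-dimensional representation. -/
def eigenvectorHom {M : (ofCoassociator Q Ψ h).Rep} (v : M.V) (hE : M.ρ E v = 0) (hY : M.ρ Y v = 0)
    (hK : M.ρ K v = ε • v) : signRep h hε ⟶ M :=
  ⟨LinearMap.toSpanSingleton ℂ M.V v, intertwines_of_generators _
    (fun u => by simp [hE, Algebra.ofId_apply])
    (fun u => by simp [hY, Algebra.ofId_apply])
    (fun u => by simp [hK, Algebra.ofId_apply, mul_smul, smul_comm ε])⟩

end

end QHopf.Q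

namespace QHopf.Q

open Complex QuasiBialgebra

/-! ### Sections of tensor products with an augmented representation -/

section

variable {M T : Type} [AddCommGroup M] [Module ℂ M] [AddCommGroup T] [Module ℂ T]
  (ρ : Q →ₐ[ℂ] Module.End ℂ M) (σ : Q →ₐ[ℂ] Module.End ℂ T)

/-- The map `t ↦ m ⊗ t - i (Y m ⊗ K E t + E m ⊗ K Y t)`. -/
def leftSection (m : M) : T →ₗ[ℂ] M ⊗[ℂ] T :=
  TensorProduct.mk ℂ M T m - I • (TensorProduct.mk ℂ M T (ρ Y m) ∘ₗ σ K ∘ₗ σ E +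
    TensorProduct.mk ℂ M T (ρ E m) ∘ₗ σ K ∘ₗ σ Y)

/-- The map `t ↦ t ⊗ m - i (E t ⊗ Y m + Y t ⊗ E m)`. -/
def rightSection (m : M) : T →ₗ[ℂ] T ⊗[ℂ] M :=
  (TensorProduct.mk ℂ T M).flip m - I • ((TensorProduct.mk ℂ T M).flip (ρ Y m) ∘ₗ σ E +
    (TensorProduct.mk ℂ T M).flip (ρ E m) ∘ₗ σ Y)

variable {m : M}

lemma leftSection_apply (t : T) : leftSection ρ σ m t =
    m ⊗ₜ t - I • (ρ Y m ⊗ₜ σ K (σ E t) + ρ E m ⊗ₜ σ K (σ Y t)) := rfl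

lemma rightSection_apply (t : T) : rightSection ρ σ m t =
    t ⊗ₜ m - I • (σ E t ⊗ₜ ρ Y m + σ Y t ⊗ₜ ρ E m) := rfl

variable {ρ σ}

lemma act_e1_eq_zero (hK : ρ K m = m) : ρ e1 m = 0 := by
  rw [act_e1, hK, hK, sub_self, smul_zero]

lemma act_e0_eq_self (hK : ρ K m = m) : ρ e0 m = m := by
  rw [act_e0, hK, hK, ← two_smul ℂ m, smul_smul, one_div, inv_mul_cancel₀ two_ne_zero, one_smul]

lemma act_Y_E_eq_zero (hK : ρ K m = m) (hEY : ρ E (ρ Y m) = 0) : ρ Y (ρ E m) = 0 := by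
  rw [act_Y_E, act_e1_eq_zero hK, hEY, smul_zero, sub_zero]

lemma act_K_K_eq_neg (hσ : ∀ t, σ e1 t = t) (t : T) : σ K (σ K t) = -t := by
  have h := hσ t
  rw [act_e1] at h
  calc σ K (σ K t) = t - (2 : ℂ) • ((1 / 2 : ℂ) • (t - σ K (σ K t))) := by module
    _ = -t := by rw [h]; module

/-- Applying E to m ⊗ t produces the unwanted term Em ⊗ Kt. The correction cancels it because -i(EY
+ YE) = 1 on T; the same happens with E and Y exchanged. Further terms vanish since EYm = YEm = 0.
-/
lemma leftSection_intertwines (hK : ρ K m = m) (hEY : ρ E (ρ Y m) = 0) (hσ : ∀ t, σ e1 t = t)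
    (a : Q) (t : T) :
    leftSection ρ σ m (σ a t) = comulAction comul ρ σ a (leftSection ρ σ m t) := by
  have hYE := act_Y_E_eq_zero hK hEY
  refine intertwines_of_generators _ (fun t => ?_) (fun t => ?_) (fun t => ?_) a t
  · simp only [leftSection_apply, map_sub, map_smul, map_add, comulAction_E, act_K_E, act_E_E,
      hEY, act_K_Y, act_Y_E, hσ, TensorProduct.tmul_neg, TensorProduct.zero_tmul, map_neg,
      map_zero, TensorProduct.tmul_zero, TensorProduct.tmul_sub, TensorProduct.tmul_smul]
    match_scalars <;> simp
  · simp only [leftSection_apply, map_sub, map_smul, map_add, comulAction_Y, act_K_E, act_Y_Y,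
      hYE, act_K_Y, act_Y_E, hσ, TensorProduct.tmul_neg, TensorProduct.zero_tmul, map_neg,
      map_zero, TensorProduct.tmul_zero, TensorProduct.tmul_sub, TensorProduct.tmul_smul]
    match_scalars <;> simp
  · simp only [leftSection_apply, map_sub, map_smul, map_add, comulAction_K, act_K_E, hK, act_K_Y,
      act_K_K_eq_neg hσ, TensorProduct.tmul_neg, TensorProduct.neg_tmul, map_neg, neg_neg]

lemma rightSection_intertwines (hK : ρ K m = m) (hEY : ρ E (ρ Y m) = 0) (hσ : ∀ t, σ e1 t = t)
    (a : Q) (t : T) :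
    rightSection ρ σ m (σ a t) = comulAction comul σ ρ a (rightSection ρ σ m t) := by
  have hYE := act_Y_E_eq_zero hK hEY
  refine intertwines_of_generators _ (fun t => ?_) (fun t => ?_) (fun t => ?_) a t
  · simp only [rightSection_apply, map_sub, map_smul, map_add, comulAction_E, act_K_E, act_E_E,
      hEY, hK, act_K_Y, act_Y_E, hσ, TensorProduct.tmul_neg, TensorProduct.zero_tmul,
      TensorProduct.tmul_zero, TensorProduct.sub_tmul, ← TensorProduct.smul_tmul']
    match_scalars <;> simp
  · simp only [rightSection_apply, map_sub, map_smul, map_add, comulAction_Y, act_K_E, act_Y_Y,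
      hYE, hK, act_K_Y, act_Y_E, hσ, TensorProduct.tmul_neg, TensorProduct.zero_tmul,
      TensorProduct.tmul_zero, TensorProduct.sub_tmul, ← TensorProduct.smul_tmul']
    match_scalars <;> simp
  · simp only [rightSection_apply, map_sub, map_smul, map_add, comulAction_K, act_K_E, hK, act_K_Y,
      TensorProduct.tmul_neg, TensorProduct.neg_tmul, neg_neg]

/-- The two ways of adding `m` on both sides of `T` differ by a term with one copy of `E m` and one
copy of `Y m`. -/
lemma assoc_map_leftSection_rightSection (hσ : ∀ t, σ e1 t = t) (t : T) :
    TensorProduct.assoc ℂ M T M (TensorProduct.map (leftSection ρ σ m) LinearMap.id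
      (rightSection ρ σ m t)) =
    TensorProduct.map LinearMap.id (rightSection ρ σ m) (leftSection ρ σ m t) -
      I • (ρ E m ⊗ₜ (σ K t ⊗ₜ ρ Y m) + ρ Y m ⊗ₜ (σ K t ⊗ₜ ρ E m)) := by
  simp only [leftSection_apply, rightSection_apply, map_sub, map_smul, map_add, act_K_E, act_Y_E,
    act_K_Y, hσ, act_E_E, act_Y_Y, TensorProduct.map_tmul, LinearMap.id_coe, id_eq,
    TensorProduct.assoc_tmul, TensorProduct.tmul_sub, TensorProduct.tmul_add,
    TensorProduct.sub_tmul, TensorProduct.add_tmul, TensorProduct.tmul_smul, map_neg,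
    TensorProduct.tmul_neg, TensorProduct.neg_tmul, map_zero, TensorProduct.tmul_zero,
    TensorProduct.zero_tmul, ← TensorProduct.smul_tmul']
  match_scalars <;> simp

/-- The idempotents select the block 010, which does not involve β. -/
lemma tensorAction_Φ (β : ℂ) {u v : M} {t : T} (hu : ρ e0 u = u) (ht : σ e1 t = t)
    (hv : ρ e0 v = v) : tensorAction ρ (tensorAction σ ρ) (Φ β) (u ⊗ₜ (t ⊗ₜ v)) =
      tensorAction ρ (tensorAction σ ρ) Φ010 (u ⊗ₜ (t ⊗ₜ v)) := by
  have hu1 : ρ e1 u = 0 := by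
    rw [← hu, ← Module.End.mul_apply, ← map_mul, e1_mul_e0, map_zero, LinearMap.zero_apply]
  have hv1 : ρ e1 v = 0 := by
    rw [← hv, ← Module.End.mul_apply, ← map_mul, e1_mul_e0, map_zero, LinearMap.zero_apply]
  have ht0 : σ e0 t = 0 := by
    rw [← ht, ← Module.End.mul_apply, ← map_mul, e0_mul_e1, map_zero, LinearMap.zero_apply]
  simp [Φ, hu, hv, ht, hu1, hv1, ht0]

end

end QHopf.Q

namespace QHopf.Q

open Complex QuasiBialgebra

/-! ### Crossings of representations for the coassociator `Φ` -/

section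

variable {M T : Type} [AddCommGroup M] [Module ℂ M] [AddCommGroup T] [Module ℂ T]
  {ρ : Q →ₐ[ℂ] Module.End ℂ M} {σ : Q →ₐ[ℂ] Module.End ℂ T} {m : M}

/-- Products of two of E, Y annihilate m, so Φ⁰¹⁰ changes only the leading term m ⊗ t ⊗ m, and there
its EFK ⊗ 1 ⊗ EFK part vanishes. -/
lemma tensorAction_Φ_sections (β : ℂ) (hK : ρ K m = m) (hEY : ρ E (ρ Y m) = 0)
    (hσ : ∀ t, σ e1 t = t) (t : T) :
    tensorAction ρ (tensorAction σ ρ) (Φ β)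
      (TensorProduct.map LinearMap.id (rightSection ρ σ m) (leftSection ρ σ m t)) =
    TensorProduct.map LinearMap.id (rightSection ρ σ m) (leftSection ρ σ m t) -
      (1 + I) • ρ E m ⊗ₜ (σ K t ⊗ₜ ρ Y m) + (1 - I) • ρ Y m ⊗ₜ (σ K t ⊗ₜ ρ E m) := by
  have hYE := act_Y_E_eq_zero hK hEY
  have h0 : ρ e0 m = m := act_e0_eq_self hK
  have hE : ρ e0 (ρ E m) = ρ E m := by
    rw [act_e0, act_K_E, map_neg, act_K_E, hK, hK]
    module
  have hY : ρ e0 (ρ Y m) = ρ Y m := by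
    rw [act_e0, act_K_Y, map_neg, act_K_Y, hK, hK]
    module
  have key : ∀ u v : M, ρ e0 u = u → ρ e0 v = v → ∀ t, tensorAction ρ (tensorAction σ ρ) (Φ β)
      (u ⊗ₜ (t ⊗ₜ v)) = u ⊗ₜ (t ⊗ₜ v) - (1 + I) • ρ E u ⊗ₜ (σ K t ⊗ₜ ρ F v) +
        (1 - I) • ρ F (ρ K u) ⊗ₜ (σ K t ⊗ₜ ρ E (ρ K v)) +
        (2 : ℂ) • ρ E (ρ F (ρ K u)) ⊗ₜ (t ⊗ₜ ρ E (ρ F (ρ K v))) := by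
    intro u v hu hv t
    rw [tensorAction_Φ β hu (hσ t) hv]
    simp [Φ010]
  simp only [leftSection_apply, rightSection_apply, map_sub, map_smul, map_add,
    TensorProduct.map_tmul, LinearMap.id_coe, id_eq, TensorProduct.tmul_sub,
    TensorProduct.tmul_add, TensorProduct.tmul_smul, key, h0, hE, hY]
  simp only [act_F, act_K_E, act_K_Y, hK, map_neg, neg_neg, hEY, hYE, act_E_E, act_Y_Y,
    TensorProduct.zero_tmul, TensorProduct.tmul_zero, smul_zero, sub_zero, add_zero,
    neg_zero, map_zero]
  module

/-- With Em = an and Ym = bn, both discrepancies are multiples of ab n ⊗ Kt ⊗ n, with factors -i · 2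
and -(1+i) + (1-i), which coincide. -/
lemma sections_commute (β : ℂ) (hK : ρ K m = m) (hEY : ρ E (ρ Y m) = 0)
    (hσ : ∀ t, σ e1 t = t) {n : M} {a b : ℂ} (ha : ρ E m = a • n) (hb : ρ Y m = b • n) (t : T) :
    TensorProduct.assoc ℂ M T M (TensorProduct.map (leftSection ρ σ m) LinearMap.id
      (rightSection ρ σ m t)) = tensorAction ρ (tensorAction σ ρ) (Φ β)
        (TensorProduct.map LinearMap.id (rightSection ρ σ m) (leftSection ρ σ m t)) := by
  rw [assoc_map_leftSection_rightSection hσ, tensorAction_Φ_sections β hK hEY hσ, ha, hb]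
  simp only [TensorProduct.tmul_smul, ← TensorProduct.smul_tmul']
  module

/-- A representation without vectors that are killed by `E` and `F` and on which `K` acts by a
sign is killed by `e₀`. -/
lemma act_e0_eq_zero (h : ∀ ε : ℂ, ε * ε = 1 → ∀ t, σ E t = 0 → σ Y t = 0 → σ K t = ε • t → t = 0)
    (t : T) : σ e0 t = 0 := by
  -- When K² fixes t, the vectors t ± Kt are K-eigenvectors with eigenvalue ±1, and t is half their
  -- sum.
  have key : ∀ t, σ E t = 0 → σ Y t = 0 → σ K (σ K t) = t → t = 0 := by
    intro t hE hY hK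
    have h1 := h 1 (by norm_num) (t + σ K t)
      (by rw [map_add, hE, ← neg_eq_iff_eq_neg.2 (act_K_E σ t), hE]; simp)
      (by rw [map_add, hY, ← neg_eq_iff_eq_neg.2 (act_K_Y σ t), hY]; simp)
      (by rw [map_add, hK]; module)
    have h2 := h (-1) (by norm_num) (t - σ K t)
      (by rw [map_sub, hE, ← neg_eq_iff_eq_neg.2 (act_K_E σ t), hE]; simp)
      (by rw [map_sub, hY, ← neg_eq_iff_eq_neg.2 (act_K_Y σ t), hY]; simp)
      (by rw [map_sub, hK]; module)
    calc t = (1 / 2 : ℂ) • (t + σ K t) + (1 / 2 : ℂ) • (t - σ K t) := by module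
      _ = 0 := by rw [h1, h2]; simp
  have he : ∀ u, σ e0 (σ E u) = σ E (σ e0 u) := fun u => by
    rw [← Module.End.mul_apply, ← map_mul, ← E_mul_e0, map_mul, Module.End.mul_apply]
  have he' : ∀ u, σ e0 (σ Y u) = σ Y (σ e0 u) := fun u => by
    rw [← Module.End.mul_apply, ← map_mul, ← Y_mul_e0, map_mul, Module.End.mul_apply]
  have hK : ∀ u, σ e0 u = u → σ K (σ K u) = u := by
    intro u hu
    have h1 : σ (K * K) (σ e0 u) = σ e0 u := by
      rw [← Module.End.mul_apply, ← map_mul, K_sq, sub_mul, e0_mul_e0, e1_mul_e0, sub_zero]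
    rwa [map_mul, Module.End.mul_apply, hu] at h1
  have hYE : ∀ u, σ e0 u = u → σ Y (σ E u) = -σ E (σ Y u) := by
    intro u hu
    have h1 : σ e1 (σ e0 u) = 0 := by
      rw [← Module.End.mul_apply, ← map_mul, e1_mul_e0, map_zero, LinearMap.zero_apply]
    rw [hu] at h1
    rw [act_Y_E, h1, smul_zero, zero_sub]
  obtain ⟨u, hu⟩ : ∃ u, u = σ e0 t := ⟨_, rfl⟩
  have h0 : σ e0 u = u := by
    rw [hu, ← Module.End.mul_apply, ← map_mul, e0_mul_e0]
  have hE0 : σ e0 (σ E u) = σ E u := by rw [he, h0]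
  have hY0 : σ e0 (σ Y u) = σ Y u := by rw [he', h0]
  -- A socle argument: on e₀ the operators E and Y anticommute and square to zero, so EYu is killed
  -- by both and vanishes; after that Yu and Eu are killed by both, and finally u itself.
  have h1 : σ E (σ Y u) = 0 := key _ (act_E_E _ _)
    (by rw [hYE _ hY0, act_Y_Y, map_zero, neg_zero]) (hK _ (by rw [he, hY0]))
  have h2 : σ Y u = 0 := key _ h1 (act_Y_Y _ _) (hK _ hY0)
  have h3 : σ E u = 0 := key _ (act_E_E _ _) (by rw [hYE _ h0, h1, neg_zero]) (hK _ hE0)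
  rw [← hu]
  exact key _ h3 h2 (hK _ h0)

end

end QHopf.Q

/-! ### The structure of an arbitrary crossing of representations -/

namespace QHopf

open Complex Q

section

variable {Ψ : Q ⊗[ℂ] (Q ⊗[ℂ] Q)} {h : IsCoassociator Ψ}
  (c : Crossing (QuasiBialgebra.ofCoassociator Q Ψ h).Rep)

lemma Crossing.lid_left (t : c.T.V) :
    TensorProduct.lid ℂ c.T.V (TensorProduct.map c.p.hom LinearMap.id (c.left.hom t)) = t :=
  LinearMap.congr_fun (congrArg (fun f : c.T ⟶ c.T => QuasiBialgebra.Rep.Hom.hom f) c.left_p) t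

/-- Uniqueness of the section in linear terms. It serves twice: to force EYm = 0, and to identify
the section with the explicit formula. -/
lemma Crossing.left_eq (s : c.T.V →ₗ[ℂ] c.M.V ⊗[ℂ] c.T.V)
    (hs : ∀ a t, s (c.T.ρ a t) = comulAction comul c.M.ρ c.T.ρ a (s t))
    (hp : ∀ t, TensorProduct.lid ℂ c.T.V (TensorProduct.map c.p.hom LinearMap.id (s t)) = t) :
    c.left.hom = s :=
  (congrArg (fun f : c.T ⟶ QuasiBialgebra.Rep.tensor c.M c.T => QuasiBialgebra.Rep.Hom.hom f)
    (c.left_unique ⟨s, hs⟩ (QuasiBialgebra.Rep.hom_ext (LinearMap.ext hp)))).symm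

lemma Crossing.right_eq (s : c.T.V →ₗ[ℂ] c.T.V ⊗[ℂ] c.M.V)
    (hs : ∀ a t, s (c.T.ρ a t) = comulAction comul c.T.ρ c.M.ρ a (s t))
    (hp : ∀ t, TensorProduct.rid ℂ c.T.V (TensorProduct.map LinearMap.id c.p.hom (s t)) = t) :
    c.right.hom = s :=
  (congrArg (fun f : c.T ⟶ QuasiBialgebra.Rep.tensor c.T c.M => QuasiBialgebra.Rep.Hom.hom f)
    (c.right_unique ⟨s, hs⟩ (QuasiBialgebra.Rep.hom_ext (LinearMap.ext hp)))).symm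

/-- Such a vector defines a map from a self-inverse object to T, which must agree with the zero map.
-/
lemma Crossing.eq_zero {ε : ℂ} (hε : ε * ε = 1) (t : c.T.V) (hE : c.T.ρ E t = 0)
    (hY : c.T.ρ Y t = 0) (hK : c.T.ρ K t = ε • t) : t = 0 := by
  have := c.subsingleton _ (selfInverse_signRep (h := h) hε)
  have e : eigenvectorHom hε t hE hY hK = eigenvectorHom hε 0 (map_zero _) (map_zero _) (by simp) :=
    Subsingleton.elim _ _
  simpa [eigenvectorHom] using LinearMap.congr_fun
    (congrArg (fun f : signRep h hε ⟶ c.T => QuasiBialgebra.Rep.Hom.hom f) e) (1 : ℂ)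

lemma Crossing.act_e1 (t : c.T.V) : c.T.ρ e1 t = t := by
  have h0 := act_e0_eq_zero (σ := c.T.ρ) (fun ε hε t => c.eq_zero hε t) t
  calc _ = c.T.ρ (e0 + e1) t := by rw [map_add, LinearMap.add_apply, h0, zero_add]
    _ = t := by rw [e0_add_e1, map_one, Module.End.one_apply]

/-- Endomorphisms of a one-dimensional representation are scalars, so comparability of the two maps
defined by u and v means that one vector is a multiple of the other. Which one is unknown, hence the
common vector n. -/
lemma Crossing.exists_smul {ε : ℂ} (hε : ε * ε = 1) (u v : c.M.V) (hEu : c.M.ρ E u = 0)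
    (hYu : c.M.ρ Y u = 0) (hKu : c.M.ρ K u = ε • u) (hEv : c.M.ρ E v = 0)
    (hYv : c.M.ρ Y v = 0) (hKv : c.M.ρ K v = ε • v) :
    ∃ (n : c.M.V) (a b : ℂ), u = a • n ∧ v = b • n := by
  have key : ∀ {u v : c.M.V} {f g : signRep h hε ⟶ c.M} (_ : f.hom (1 : ℂ) = u)
      (_ : g.hom (1 : ℂ) = v), (∃ s : signRep h hε ⟶ signRep h hε, g = s ≫ f) →
      ∃ a : ℂ, v = a • u := by
    rintro u v f g hf hg ⟨s, hs⟩
    refine ⟨s.hom (1 : ℂ), ?_⟩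
    rw [← hf, ← hg, hs, ← map_smul]
    change f.hom (s.hom (1 : ℂ)) = f.hom (s.hom (1 : ℂ) * 1)
    rw [mul_one]
  have hu : (eigenvectorHom hε u hEu hYu hKu).hom (1 : ℂ) = u := by simp [eigenvectorHom]
  have hv : (eigenvectorHom hε v hEv hYv hKv).hom (1 : ℂ) = v := by simp [eigenvectorHom]
  rcases c.comparable _ (selfInverse_signRep (h := h) hε) (eigenvectorHom hε u hEu hYu hKu)
    (eigenvectorHom hε v hEv hYv hKv) with hs | hs
  · obtain ⟨b, hb⟩ := key hu hv hs
    exact ⟨u, 1, b, (one_smul _ _).symm, hb⟩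
  · obtain ⟨a, ha⟩ := key hv hu hs
    exact ⟨v, a, 1, ha, (one_smul _ _).symm⟩

lemma Crossing.p_act (a : Q) (m : c.M.V) : c.p.hom (c.M.ρ a m) = counit a * c.p.hom m :=
  c.p.comm a m

/-- A nonzero `T` forces `M` to contain a vector as in the construction of the sections. -/
lemma Crossing.exists_seed {t₀ : c.T.V} (ht₀ : t₀ ≠ 0) :
    ∃ m : c.M.V, c.M.ρ K m = m ∧ c.M.ρ E (c.M.ρ Y m) = 0 ∧ c.p.hom m = (1 : ℂ) := by
  obtain ⟨m, hm⟩ : ∃ m : c.M.V, c.p.hom m ≠ (0 : ℂ) := by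
    by_contra! hp
    have hp : c.p.hom = 0 := LinearMap.ext hp
    have := c.lid_left t₀
    rw [hp, TensorProduct.map_zero_left, LinearMap.zero_apply, map_zero] at this
    exact ht₀ this.symm
  obtain ⟨z, hz⟩ : ∃ z : ℂ, z = c.p.hom m := ⟨_, rfl⟩
  rw [← hz] at hm
  -- Averaging over the four powers of K makes the vector K-invariant; the counit of the sum is 4,
  -- so the scalar normalises p to 1.
  obtain ⟨m', hm'⟩ : ∃ m', m' = (z⁻¹ * (1 / 4)) • c.M.ρ (1 + K + K ^ 2 + K ^ 3) m := ⟨_, rfl⟩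
  have hK : c.M.ρ K m' = m' := by
    rw [hm', map_smul, ← Module.End.mul_apply, ← map_mul]
    congr 3
    have := KK
    rw [mul_add, mul_add, mul_add, mul_one, ← pow_two, ← pow_succ', ← pow_succ', KK]
    abel
  have hp : c.p.hom m' = (1 : ℂ) := by
    have h1 : counit (1 + K + K ^ 2 + K ^ 3) = 4 := by simp; norm_num
    rw [hm', map_smul, c.p_act, h1, ← hz]
    change z⁻¹ * (1 / 4) * (4 * z) = 1
    field_simp
  have he1 : c.M.ρ e1 m' = 0 := act_e1_eq_zero hK
  have he1' : c.M.ρ e1 (c.M.ρ Y m') = 0 := by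
    rw [← Module.End.mul_apply, ← map_mul, ← Y_mul_e1, map_mul, Module.End.mul_apply, he1,
      map_zero]
  obtain ⟨w, hw⟩ : ∃ w, w = c.M.ρ E (c.M.ρ Y m') := ⟨_, rfl⟩
  refine ⟨m', hK, ?_, hp⟩
  have hwE : c.M.ρ E w = 0 := by rw [hw, act_E_E]
  have hwY : c.M.ρ Y w = 0 := by
    rw [hw, act_Y_E, he1', act_Y_Y, map_zero, smul_zero, sub_zero]
  have hwK : c.M.ρ K w = w := by
    rw [hw, act_K_E, act_K_Y, map_neg, neg_neg, hK]
  have hwp : c.p.hom w = (0 : ℂ) := by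
    rw [hw, c.p_act, counit_E, zero_mul]
  -- The vector w = EYm' spans a copy of the trivial representation inside the kernel of p, or is
  -- zero. Hence t ↦ w ⊗ t is an intertwiner invisible to p, and adding it to the section gives
  -- another section.
  have e := c.left_eq (c.left.hom + TensorProduct.mk ℂ c.M.V c.T.V w) (fun a t => by
      rw [LinearMap.add_apply, LinearMap.add_apply, map_add]
      congr 1
      · exact c.left.comm a t
      · refine intertwines_of_generators (TensorProduct.mk ℂ c.M.V c.T.V w)
          (fun t => ?_) (fun t => ?_) (fun t => ?_) a t
        · simp [comulAction_E, hwE, -AlgHom.coe_comp]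
        · simp [comulAction_Y, hwY, -AlgHom.coe_comp]
        · simp [comulAction_K, hwK, -AlgHom.coe_comp])
    (fun t => by
      rw [LinearMap.add_apply, map_add, map_add, c.lid_left, TensorProduct.mk_apply,
        TensorProduct.map_tmul, hwp, TensorProduct.zero_tmul, map_zero, add_zero])
  have e2 : w ⊗ₜ[ℂ] t₀ = 0 := by
    exact add_eq_left.1 (LinearMap.congr_fun e t₀).symm
  -- Linear functionals in the first factor turn w ⊗ t₀ = 0 into w = 0, as t₀ is nonzero.
  rw [← hw, ← Module.forall_dual_apply_eq_zero_iff ℂ w]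
  intro φ
  have e3 := congrArg (TensorProduct.lid ℂ c.T.V ∘ TensorProduct.map φ LinearMap.id) e2
  simp only [Function.comp_apply, TensorProduct.map_tmul, TensorProduct.lid_tmul, map_zero,
    LinearMap.id_apply, smul_eq_zero] at e3
  exact e3.resolve_right ht₀

end

/-- Every crossing of representations commutes for the coassociator `Φ`. -/
theorem Crossing.commutes {β : ℂ} {h : IsCoassociator (Φ β)}
    (c : Crossing (QuasiBialgebra.ofCoassociator Q (Φ β) h).Rep) : c.Commutes := by
  refine QuasiBialgebra.Rep.hom_ext (LinearMap.ext fun t => ?_)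
  change TensorProduct.map LinearMap.id c.right.hom (c.left.hom t) =
    assocBy c.M.ρ c.T.ρ c.M.ρ (h.isUnit.unit⁻¹).val
      (TensorProduct.map c.left.hom LinearMap.id (c.right.hom t))
  by_cases ht : t = 0
  · rw [ht]
    simp only [map_zero]
  obtain ⟨m, hK, hEY, hp⟩ := c.exists_seed ht
  have hσ := c.act_e1
  have hYE := act_Y_E_eq_zero hK hEY
  -- K anticommutes with E and Y and fixes m, so Em and Ym both have K-eigenvalue -1.
  obtain ⟨n, a, b, ha, hb⟩ := c.exists_smul (ε := -1) (by norm_num) (c.M.ρ E m)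
    (c.M.ρ Y m) (act_E_E _ _) hYE (by rw [act_K_E, hK, neg_one_smul]) hEY (act_Y_Y _ _)
    (by rw [act_K_Y, hK, neg_one_smul])
  have hpE : c.p.hom (c.M.ρ E m) = (0 : ℂ) := by rw [c.p_act, counit_E, zero_mul]
  have hpY : c.p.hom (c.M.ρ Y m) = (0 : ℂ) := by rw [c.p_act, counit_Y, zero_mul]
  have hl := c.left_eq (leftSection c.M.ρ c.T.ρ m) (leftSection_intertwines hK hEY hσ)
    (fun t => by simp [leftSection_apply, hp, hpE, hpY])
  have hr := c.right_eq (rightSection c.M.ρ c.T.ρ m) (rightSection_intertwines hK hEY hσ)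
    (fun t => by simp [rightSection_apply, hp, hpE, hpY])
  have key := sections_commute β hK hEY hσ ha hb t
  rw [hl, hr, assocBy, LinearMap.comp_apply, LinearEquiv.coe_coe, key, ← Module.End.mul_apply,
    ← map_mul, IsUnit.val_inv_mul, map_one, Module.End.one_apply]

end QHopf

namespace QHopf

open Complex Q

/-! ### A crossing of representations of `Q` that does not commute -/

section

variable {Ψ : Q ⊗[ℂ] (Q ⊗[ℂ] Q)} {h : IsCoassociator Ψ}
  {X : (QuasiBialgebra.ofCoassociator Q Ψ h).Rep}

/-- The square of the dimension is 1. -/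
lemma SelfInverse.finrank_eq_one (hX : SelfInverse X) : Module.finrank ℂ X.V = 1 := by
  obtain ⟨e⟩ := hX
  let e' : X.V ⊗[ℂ] X.V ≃ₗ[ℂ] ℂ := LinearEquiv.ofLinearMap e.hom.hom e.inv.hom
    (congrArg (fun f : QuasiBialgebra.Rep.unit _ ⟶ QuasiBialgebra.Rep.unit _ =>
      QuasiBialgebra.Rep.Hom.hom f) e.inv_hom_id)
    (congrArg (fun f : QuasiBialgebra.Rep.tensor X X ⟶ QuasiBialgebra.Rep.tensor X X =>
      QuasiBialgebra.Rep.Hom.hom f) e.hom_inv_id)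
  have := e'.finrank_eq
  rw [Module.finrank_tensorProduct, Module.finrank_self] at this
  exact Nat.eq_one_of_mul_eq_one_right this

lemma SelfInverse.exists_generator (hX : SelfInverse X) :
    ∃ v : X.V, v ≠ 0 ∧ (∀ w, ∃ c : ℂ, c • v = w) ∧ X.ρ E v = 0 ∧ X.ρ Y v = 0 := by
  obtain ⟨v, hv, hw⟩ := finrank_eq_one_iff'.1 hX.finrank_eq_one
  -- An endomorphism of a line is a scalar, so square zero means zero; this applies to E and Y.
  have key : ∀ f : Module.End ℂ X.V, f (f v) = 0 → f v = 0 := by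
    intro f hf
    obtain ⟨c, hc⟩ := hw (f v)
    rw [← hc, map_smul, ← hc, smul_smul, smul_eq_zero, or_iff_left hv, mul_self_eq_zero] at hf
    rw [← hc, hf, zero_smul]
  exact ⟨v, hv, hw, key _ (act_E_E _ _), key _ (act_Y_Y _ _)⟩

end

namespace Q

/-- The two-dimensional representation with basis `m, n` such that `E m = F m = n`, `K m = m` and
`K n = - n`. -/
def augmented : Q →ₐ[ℂ] Module.End ℂ (Fin 2 → ℂ) :=
  (Matrix.toLinAlgEquiv' (R := ℂ) (n := Fin 2)).toAlgHom.comp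
    (lift !![0, 0; 1, 0] !![0, 0; 1, 0] !![1, 0; 0, -1] (by simp) (by simp)
      (by simp [pow_succ]) (by simp [pow_two]; ext i j; fin_cases i <;> fin_cases j <;> rfl)
      (by simp [pow_two]; ext i j; fin_cases i <;> fin_cases j <;> rfl)
      (by simp [pow_succ, Matrix.one_fin_two]))

lemma augmented_E (v : Fin 2 → ℂ) : augmented E v = ![0, v 0] := by
  ext i
  fin_cases i <;> simp [augmented, Matrix.mulVec, Matrix.vecHead, Matrix.vecTail]

lemma augmented_K (v : Fin 2 → ℂ) : augmented K v = ![v 0, -v 1] := by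
  ext i
  fin_cases i <;> simp [augmented, Matrix.mulVec, Matrix.vecHead, Matrix.vecTail]

lemma augmented_Y (v : Fin 2 → ℂ) : augmented Y v = ![0, v 0] := by
  ext i
  fin_cases i <;> simp [augmented, Y, Matrix.mulVec, Matrix.vecHead, Matrix.vecTail]

/-- The two-dimensional simple representation with `K = diag(i, -i)`. -/
def simpleTwo : Q →ₐ[ℂ] Module.End ℂ (Fin 2 → ℂ) :=
  (Matrix.toLinAlgEquiv' (R := ℂ) (n := Fin 2)).toAlgHom.comp
    (lift !![0, 1; 0, 0] !![0, 0; 1, 0] !![I, 0; 0, -I] (by simp) (by simp)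
      (by
        rw [inv_I_sub]
        ext i j
        fin_cases i <;> fin_cases j <;> simp [pow_succ] <;> ring_nf <;> simp)
      (by simp [pow_two]; ext i j; fin_cases i <;> fin_cases j <;> rfl)
      (by simp [pow_two]; ext i j; fin_cases i <;> fin_cases j <;> rfl)
      (by simp [pow_succ, Matrix.one_fin_two]))

lemma simpleTwo_E (v : Fin 2 → ℂ) : simpleTwo E v = ![v 1, 0] := by
  ext i
  fin_cases i <;> simp [simpleTwo, Matrix.mulVec, Matrix.vecHead, Matrix.vecTail]

lemma simpleTwo_K (v : Fin 2 → ℂ) : simpleTwo K v = ![I * v 0, -(I * v 1)] := by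
  ext i
  fin_cases i <;> simp [simpleTwo, Matrix.mulVec, Matrix.vecHead, Matrix.vecTail]

lemma simpleTwo_Y (v : Fin 2 → ℂ) : simpleTwo Y v = ![0, I * v 0] := by
  ext i
  fin_cases i <;> simp [simpleTwo, Y, Matrix.mulVec, Matrix.vecHead, Matrix.vecTail]

section

variable {M T : Type} [AddCommGroup M] [Module ℂ M] [AddCommGroup T] [Module ℂ T]
  {ρ : Q →ₐ[ℂ] Module.End ℂ M} {σ : Q →ₐ[ℂ] Module.End ℂ T} {m n : M} {p q : M →ₗ[ℂ] ℂ}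

lemma eq_zero_of_eq_neg_self {x : T} (h : x = -x) : x = 0 := by
  have h2 : (2 : ℂ) • x = 0 := by rw [two_smul, ← eq_neg_iff_add_eq_zero, ← h]
  exact (smul_eq_zero.1 h2).resolve_left two_ne_zero

lemma eq_add_tmul (hpq : ∀ v, v = p v • m + q v • n) (z : M ⊗[ℂ] T) :
    z = m ⊗ₜ TensorProduct.lid ℂ T (TensorProduct.map p LinearMap.id z) +
      n ⊗ₜ TensorProduct.lid ℂ T (TensorProduct.map q LinearMap.id z) := by
  induction z with
  | zero => simp
  | add x y hx hy =>
    nth_rewrite 1 [hx, hy]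
    simp only [map_add, TensorProduct.tmul_add]
    abel
  | tmul v t =>
    nth_rewrite 1 [hpq v]
    simp [TensorProduct.add_tmul, TensorProduct.smul_tmul]

lemma eq_add_tmul' (hpq : ∀ v, v = p v • m + q v • n) (z : T ⊗[ℂ] M) :
    z = TensorProduct.rid ℂ T (TensorProduct.map LinearMap.id p z) ⊗ₜ m +
      TensorProduct.rid ℂ T (TensorProduct.map LinearMap.id q z) ⊗ₜ n := by
  induction z with
  | zero => simp
  | add x y hx hy =>
    nth_rewrite 1 [hx, hy]
    simp only [map_add, TensorProduct.add_tmul]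
    abel
  | tmul t v =>
    nth_rewrite 1 [hpq v]
    simp [TensorProduct.tmul_add, TensorProduct.smul_tmul]

variable (hpq : ∀ v, v = p v • m + q v • n) (hn : q n = 1) (hE : ρ E n = 0) (hY : ρ Y n = 0)
  (hK : ρ K n = -n) (hσ : ∀ t, σ E (σ Y t) - σ Y (σ E t) = σ K t) (hσ1 : ∀ t, σ e1 t = t)

-- For uniqueness of sections: d is the difference of two of them. It has the form t ↦ n ⊗ At, where
-- A commutes with E and Y but anticommutes with K. Since K = EY - YE on T, A also commutes with K,
-- so KA = 0, and K is invertible because K² = -1.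
include hpq hn hE hY hK hσ hσ1 in
lemma eq_zero_of_lid_eq_zero (d : T →ₗ[ℂ] M ⊗[ℂ] T)
    (hd : ∀ a t, d (σ a t) = comulAction comul ρ σ a (d t))
    (hp : ∀ t, TensorProduct.lid ℂ T (TensorProduct.map p LinearMap.id (d t)) = 0) (t : T) :
    d t = 0 := by
  obtain ⟨A, hA⟩ : ∃ A : T →ₗ[ℂ] T, A =
    (TensorProduct.lid ℂ T).toLinearMap ∘ₗ TensorProduct.map q LinearMap.id ∘ₗ d := ⟨_, rfl⟩
  have hA' : ∀ t, A t = TensorProduct.lid ℂ T (TensorProduct.map q LinearMap.id (d t)) :=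
    fun t => by rw [hA]; rfl
  have hdA : ∀ t, d t = n ⊗ₜ A t := fun t => by
    have := eq_add_tmul hpq (d t)
    rwa [hp, TensorProduct.tmul_zero, zero_add, ← hA'] at this
  have hAE : ∀ t, A (σ E t) = σ E (A t) := fun t => by
    rw [hA' (σ E t), hd, hdA, comulAction_E, hE]
    simp [hn]
  have hAY : ∀ t, A (σ Y t) = σ Y (A t) := fun t => by
    rw [hA' (σ Y t), hd, hdA, comulAction_Y, hY]
    simp [hn]
  have hAK : ∀ t, A (σ K t) = -σ K (A t) := fun t => by
    rw [hA' (σ K t), hd, hdA, comulAction_K, hK]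
    simp [hn]
  have hAK' : ∀ t, A (σ K t) = σ K (A t) := fun t => by
    rw [← hσ, map_sub, hAE, hAY, hAY, hAE, hσ]
  have h0 : σ K (A t) = 0 := eq_zero_of_eq_neg_self ((hAK' t).symm.trans (hAK t))
  rw [hdA, ← neg_neg (A t), ← act_K_K_eq_neg hσ1 (A t), h0]
  simp

-- With n on the right, Kn = -n makes A anticommute with E and Y as well. It still commutes with EY
-- - YE = K, so the same contradiction of signs gives A = 0.
include hpq hn hE hY hK hσ hσ1 in
lemma eq_zero_of_rid_eq_zero (d : T →ₗ[ℂ] T ⊗[ℂ] M)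
    (hd : ∀ a t, d (σ a t) = comulAction comul σ ρ a (d t))
    (hp : ∀ t, TensorProduct.rid ℂ T (TensorProduct.map LinearMap.id p (d t)) = 0) (t : T) :
    d t = 0 := by
  obtain ⟨A, hA⟩ : ∃ A : T →ₗ[ℂ] T, A =
    (TensorProduct.rid ℂ T).toLinearMap ∘ₗ TensorProduct.map LinearMap.id q ∘ₗ d := ⟨_, rfl⟩
  have hA' : ∀ t, A t = TensorProduct.rid ℂ T (TensorProduct.map LinearMap.id q (d t)) :=
    fun t => by rw [hA]; rfl
  have hdA : ∀ t, d t = A t ⊗ₜ n := fun t => by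
    have := eq_add_tmul' hpq (d t)
    rwa [hp, TensorProduct.zero_tmul, zero_add, ← hA'] at this
  have hAE : ∀ t, A (σ E t) = -σ E (A t) := fun t => by
    rw [hA' (σ E t), hd, hdA, comulAction_E, hE, hK]
    simp [hn]
  have hAY : ∀ t, A (σ Y t) = -σ Y (A t) := fun t => by
    rw [hA' (σ Y t), hd, hdA, comulAction_Y, hY, hK]
    simp [hn]
  have hAK : ∀ t, A (σ K t) = -σ K (A t) := fun t => by
    rw [hA' (σ K t), hd, hdA, comulAction_K, hK]
    simp [hn]
  have hAK' : ∀ t, A (σ K t) = σ K (A t) := fun t => by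
    rw [← hσ, map_sub, hAE, hAY, hAY, hAE, map_neg, map_neg, neg_neg, neg_neg, hσ]
  have h0 : σ K (A t) = 0 := eq_zero_of_eq_neg_self ((hAK' t).symm.trans (hAK t))
  rw [hdA, ← neg_neg (A t), ← act_K_K_eq_neg hσ1 (A t), h0]
  simp

end

/-- The first basis vector of `augmented`. -/
def seed : Fin 2 → ℂ := ![1, 0]

/-- The second basis vector of `augmented`. -/
def odd : Fin 2 → ℂ := ![0, 1]

lemma augmented_K_seed : augmented K seed = seed := by simp [augmented_K, seed]

lemma augmented_E_seed : augmented E seed = odd := by simp [augmented_E, seed, odd]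

lemma augmented_Y_seed : augmented Y seed = odd := by simp [augmented_Y, seed, odd]

lemma augmented_E_odd : augmented E odd = 0 := by simp [augmented_E, odd]

lemma augmented_Y_odd : augmented Y odd = 0 := by simp [augmented_Y, odd]

lemma augmented_K_odd : augmented K odd = -odd := by simp [augmented_K, odd]

lemma augmented_E_Y_seed : augmented E (augmented Y seed) = 0 := by
  rw [augmented_Y_seed, augmented_E_odd]

lemma eq_seed_add_odd (v : Fin 2 → ℂ) :
    v = LinearMap.proj (R := ℂ) (φ := fun _ => ℂ) 0 v • seed +
      LinearMap.proj (R := ℂ) (φ := fun _ => ℂ) 1 v • odd := by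
  ext i
  fin_cases i <;> simp [seed, odd]

lemma simpleTwo_K_K (t : Fin 2 → ℂ) : simpleTwo K (simpleTwo K t) = -t := by
  ext i
  fin_cases i <;> simp [simpleTwo_K, ← mul_assoc]

lemma simpleTwo_e1 (t : Fin 2 → ℂ) : simpleTwo e1 t = t := by
  rw [act_e1, simpleTwo_K_K]
  module

lemma simpleTwo_commutator (t : Fin 2 → ℂ) :
    simpleTwo E (simpleTwo Y t) - simpleTwo Y (simpleTwo E t) = simpleTwo K t := by
  ext i
  fin_cases i <;> simp [simpleTwo_K, simpleTwo_E, simpleTwo_Y]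

/-- The coordinates of `augmented`. -/
abbrev coord (i : Fin 2) : (Fin 2 → ℂ) →ₗ[ℂ] ℂ := LinearMap.proj (R := ℂ) (φ := fun _ => ℂ) i

lemma lid_leftSection (t : Fin 2 → ℂ) : TensorProduct.lid ℂ (Fin 2 → ℂ) (TensorProduct.map
    (coord 0) LinearMap.id (leftSection augmented simpleTwo seed t)) = t := by
  rw [leftSection_apply, augmented_E_seed, augmented_Y_seed]
  simp [seed, odd]

lemma rid_rightSection (t : Fin 2 → ℂ) : TensorProduct.rid ℂ (Fin 2 → ℂ) (TensorProduct.map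
    LinearMap.id (coord 0) (rightSection augmented simpleTwo seed t)) = t := by
  rw [rightSection_apply, augmented_E_seed, augmented_Y_seed]
  simp [seed, odd]

lemma eq_leftSection (s : (Fin 2 → ℂ) →ₗ[ℂ] (Fin 2 → ℂ) ⊗[ℂ] (Fin 2 → ℂ))
    (hs : ∀ a t, s (simpleTwo a t) = comulAction comul augmented simpleTwo a (s t))
    (hp : ∀ t, TensorProduct.lid ℂ (Fin 2 → ℂ)
      (TensorProduct.map (coord 0) LinearMap.id (s t)) = t) :
    s = leftSection augmented simpleTwo seed := by
  refine sub_eq_zero.1 (LinearMap.ext fun t => ?_)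
  refine eq_zero_of_lid_eq_zero eq_seed_add_odd (by simp [odd]) augmented_E_odd augmented_Y_odd
    augmented_K_odd simpleTwo_commutator simpleTwo_e1 _ (fun a t => ?_) (fun t => ?_) t
  · rw [LinearMap.sub_apply, LinearMap.sub_apply, map_sub, hs,
      leftSection_intertwines augmented_K_seed augmented_E_Y_seed simpleTwo_e1]
  · rw [LinearMap.sub_apply, map_sub, map_sub, hp, lid_leftSection, sub_self]

lemma eq_rightSection (s : (Fin 2 → ℂ) →ₗ[ℂ] (Fin 2 → ℂ) ⊗[ℂ] (Fin 2 → ℂ))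
    (hs : ∀ a t, s (simpleTwo a t) = comulAction comul simpleTwo augmented a (s t))
    (hp : ∀ t, TensorProduct.rid ℂ (Fin 2 → ℂ)
      (TensorProduct.map LinearMap.id (coord 0) (s t)) = t) :
    s = rightSection augmented simpleTwo seed := by
  refine sub_eq_zero.1 (LinearMap.ext fun t => ?_)
  refine eq_zero_of_rid_eq_zero eq_seed_add_odd (by simp [odd]) augmented_E_odd augmented_Y_odd
    augmented_K_odd simpleTwo_commutator simpleTwo_e1 _ (fun a t => ?_) (fun t => ?_) t
  · rw [LinearMap.sub_apply, LinearMap.sub_apply, map_sub, hs,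
      rightSection_intertwines augmented_K_seed augmented_E_Y_seed simpleTwo_e1]
  · rw [LinearMap.sub_apply, map_sub, map_sub, hp, rid_rightSection, sub_self]

/-- The two compositions of the sections differ. -/
lemma assoc_sections_ne : TensorProduct.map LinearMap.id (rightSection augmented simpleTwo seed)
      (leftSection augmented simpleTwo seed seed) ≠
    TensorProduct.assoc ℂ _ _ _ (TensorProduct.map (leftSection augmented simpleTwo seed)
      LinearMap.id (rightSection augmented simpleTwo seed seed)) := by
  rw [assoc_map_leftSection_rightSection simpleTwo_e1, augmented_E_seed, augmented_Y_seed, ne_comm,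
    Ne, sub_eq_self]
  intro e
  -- Here Em = Ym, so the discrepancy is -2i times `odd` ⊗ K t ⊗ `odd`, where t is the first basis
  -- vector of `simpleTwo`, for which K t = i t. The functional reads off the one coefficient that
  -- is not zero.
  have e2 := congrArg (coord 0 ∘ TensorProduct.lid ℂ (Fin 2 → ℂ) ∘ TensorProduct.map (coord 1)
    ((TensorProduct.rid ℂ (Fin 2 → ℂ)).toLinearMap ∘ₗ TensorProduct.map LinearMap.id (coord 1))) e
  norm_num [odd, seed, simpleTwo_K] at e2

end Q

/-! ### The standard crossing and the failure of commutation over Q -/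

open Q

variable {Ψ : Q ⊗[ℂ] (Q ⊗[ℂ] Q)} (h : IsCoassociator Ψ)

/-- `augmented` as an object. -/
abbrev augmentedRep : (QuasiBialgebra.ofCoassociator Q Ψ h).Rep := ⟨Fin 2 → ℂ, augmented⟩

/-- `simpleTwo` as an object. -/
abbrev simpleTwoRep : (QuasiBialgebra.ofCoassociator Q Ψ h).Rep := ⟨Fin 2 → ℂ, simpleTwo⟩

/-- The projection of `augmented` to the trivial representation. -/
def augmentation : augmentedRep h ⟶ QuasiBialgebra.Rep.unit _ :=
  ⟨LinearMap.proj (R := ℂ) (φ := fun _ => ℂ) 0, fun a v =>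
    intertwines_of_generators (ρ := augmented) (σ := counitAction counit)
      (LinearMap.proj (R := ℂ) (φ := fun _ => ℂ) 0)
      (fun v => by simp [augmented_E, Algebra.ofId_apply])
      (fun v => by simp [augmented_Y, Algebra.ofId_apply, counit_Y])
      (fun v => by simp [augmented_K, Algebra.ofId_apply]) a v⟩

/-- The crossing formed by `augmented` and `simpleTwo`. -/
def standardCrossing : Crossing (QuasiBialgebra.ofCoassociator Q Ψ h).Rep where
  M := augmentedRep h
  T := simpleTwoRep h
  p := augmentation h
  left := ⟨leftSection augmented simpleTwo seed,
    leftSection_intertwines augmented_K_seed augmented_E_Y_seed simpleTwo_e1⟩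
  right := ⟨rightSection augmented simpleTwo seed,
    rightSection_intertwines augmented_K_seed augmented_E_Y_seed simpleTwo_e1⟩
  left_p := QuasiBialgebra.Rep.hom_ext (LinearMap.ext lid_leftSection)
  right_p := QuasiBialgebra.Rep.hom_ext (LinearMap.ext rid_rightSection)
  left_unique s hs := QuasiBialgebra.Rep.hom_ext (eq_leftSection s.hom s.comm
    (LinearMap.congr_fun (congrArg (fun f : simpleTwoRep h ⟶ simpleTwoRep h =>
      QuasiBialgebra.Rep.Hom.hom f) hs)))
  right_unique s hs := QuasiBialgebra.Rep.hom_ext (eq_rightSection s.hom s.comm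
    (LinearMap.congr_fun (congrArg (fun f : simpleTwoRep h ⟶ simpleTwoRep h =>
      QuasiBialgebra.Rep.Hom.hom f) hs)))
  comparable X hX f g := by
    obtain ⟨v, hv, hw, hE, hY⟩ := hX.exists_generator
    -- E kills the generator of X, and the kernel of E on `augmented` is the line of `odd`; all maps
    -- from X land there and are therefore comparable.
    have key : ∀ f : X ⟶ augmentedRep h, ∃ a : ℂ, f.hom v = a • odd := by
      intro f
      have h1 := f.comm E v
      rw [hE, map_zero] at h1
      change (0 : Fin 2 → ℂ) = augmented E (f.hom v) at h1
      have h2 : f.hom v 0 = 0 := by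
        simpa [augmented_E] using (congrFun h1 1).symm
      refine ⟨f.hom v 1, ?_⟩
      ext i
      fin_cases i
      · simpa [odd] using h2
      · simp [odd]
    have key2 : ∀ (f g : X ⟶ augmentedRep h) (c : ℂ), g.hom v = c • f.hom v →
        ∃ s : X ⟶ X, g = s ≫ f := by
      intro f g c hc
      refine ⟨⟨c • LinearMap.id, fun a w => by simp⟩, ?_⟩
      refine QuasiBialgebra.Rep.hom_ext (LinearMap.ext fun w => ?_)
      obtain ⟨z, rfl⟩ := hw w
      change g.hom (z • v) = f.hom (c • z • v)
      rw [map_smul, hc, map_smul, map_smul, smul_comm]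
    obtain ⟨a, ha⟩ := key f
    obtain ⟨b, hb⟩ := key g
    by_cases h0 : a = 0
    · refine Or.inr (key2 g f 0 ?_)
      rw [ha, h0, zero_smul, zero_smul]
    · refine Or.inl (key2 f g (b / a) ?_)
      rw [ha, hb, smul_smul, div_mul_cancel₀ b h0]
  subsingleton X hX := by
    obtain ⟨v, hv, hw, hE, hY⟩ := hX.exists_generator
    -- The image of v is killed by E and Y, hence by K = EY - YE, and K is invertible.
    have key : ∀ f : X ⟶ simpleTwoRep h, f.hom v = 0 := by
      intro f
      have h1 := f.comm E v
      have h2 := f.comm Y v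
      rw [hE, map_zero] at h1
      rw [hY, map_zero] at h2
      have h3 := simpleTwo_commutator (f.hom v)
      change 0 = simpleTwo E (f.hom v) at h1
      change 0 = simpleTwo Y (f.hom v) at h2
      rw [← h1, ← h2, map_zero, map_zero, sub_zero] at h3
      have h4 := simpleTwo_K_K (f.hom v)
      rw [← h3, map_zero] at h4
      exact neg_eq_zero.1 h4.symm
    refine ⟨fun f g => QuasiBialgebra.Rep.hom_ext (LinearMap.ext fun w => ?_)⟩
    obtain ⟨z, rfl⟩ := hw w
    rw [map_smul, map_smul, key, key]

lemma not_commutes_standardCrossing :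
    ¬ (standardCrossing (isCoassociator_one (A := Q))).Commutes := by
  intro hc
  have h1 : TensorProduct.map LinearMap.id (rightSection augmented simpleTwo seed)
      (leftSection augmented simpleTwo seed seed) = assocBy augmented simpleTwo augmented
      ((isCoassociator_one (A := Q)).isUnit.unit⁻¹).val (TensorProduct.map
        (leftSection augmented simpleTwo seed) LinearMap.id
        (rightSection augmented simpleTwo seed seed)) :=
    LinearMap.congr_fun (congrArg (fun f : simpleTwoRep isCoassociator_one ⟶
      QuasiBialgebra.Rep.tensor (augmentedRep isCoassociator_one) (QuasiBialgebra.Rep.tensor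
        (simpleTwoRep isCoassociator_one) (augmentedRep isCoassociator_one)) =>
      QuasiBialgebra.Rep.Hom.hom f) hc) seed
  have h2 : ((isCoassociator_one (A := Q)).isUnit.unit⁻¹).val = 1 := by
    rw [show (isCoassociator_one (A := Q)).isUnit.unit = 1 from Units.ext rfl, inv_one,
      Units.val_one]
  rw [h2, assocBy, map_one] at h1
  exact assoc_sections_ne h1

/-- `Rep (Q, Φ)` and `Rep Q` are not monoidally equivalent. -/
theorem not_monoidallyEquivalent {β : ℂ} (h : IsCoassociator (Φ β)) :
    ¬ QuasiBialgebra.MonoidallyEquivalent (QuasiBialgebra.ofCoassociator Q (Φ β) h)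
      (QuasiBialgebra.ofBialgebra Q) := by
  rintro ⟨F, hF, ⟨hm⟩⟩
  -- The inverse functor is used: it carries the standard crossing over Q to one over (Q, Φ), which
  -- commutes, so the standard crossing would have to commute as well.
  let e := F.asEquivalence
  have : e.functor.Monoidal := hm
  have : e.inverse.Monoidal := e.inverseMonoidal
  exact not_commutes_standardCrossing (Crossing.Commutes.of_map
    (C := (QuasiBialgebra.ofBialgebra Q).Rep) e.inverse (Crossing.commutes _))

end QHopf

end

theorem mainTheorem5 (β : ℂ) (hβ : β ^ 4 = -1) :
    ∃ h : QHopf.IsCoassociator (QHopf.Q.Φ β),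
      QHopf.H3.mk (QHopf.Q.Φ β) h ≠ QHopf.H3.trivial ∧
      ¬ QHopf.QuasiBialgebra.IsTwistEquivalent (QHopf.QuasiBialgebra.ofBialgebra QHopf.Q)
        (QHopf.QuasiBialgebra.ofCoassociator QHopf.Q (QHopf.Q.Φ β) h) ∧
      IsEmpty (QHopf.QuasiBialgebra.idFunctor
        (QHopf.QuasiBialgebra.ofCoassociator QHopf.Q (QHopf.Q.Φ β) h)
        (QHopf.QuasiBialgebra.ofBialgebra QHopf.Q)).Monoidal ∧
      ¬ QHopf.QuasiBialgebra.MonoidallyEquivalent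
        (QHopf.QuasiBialgebra.ofCoassociator QHopf.Q (QHopf.Q.Φ β) h)
        (QHopf.QuasiBialgebra.ofBialgebra QHopf.Q) := by
  have h := QHopf.Q.isCoassociator_Φ hβ
  have h4 := QHopf.not_monoidallyEquivalent h
  have h2 := mt QHopf.QuasiBialgebra.IsTwistEquivalent.monoidallyEquivalent h4
  -- All four parts come from `h4`: a trivial class gives a twist, a twist gives a monoidal
  -- equivalence, and a monoidal structure on the identity functor would be one directly.
  exact ⟨h, mt (QHopf.QuasiBialgebra.isTwistEquivalent_of_H3_eq h) h2, h2,
    ⟨fun hm => h4 ⟨_, inferInstance, ⟨hm⟩⟩⟩, h4⟩
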